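/- **Theorem.** There are absolute constants $c>0$, $K,M,D,\Delta\in\mathbb N$ with $D\ge 1$, $\alpha>0$, $\beta>3/4$, and two fixed programs (a sequential and a parallel decoder) such that the following holds for all integers $n_0>1$, $N>1$ with $n_0\mid N$. Write $B=N/n_0$. Let $H_0=[\,I_{n_0-1}\mid \mathbf 1\,]$ and $G_0=(1\,1\cdots 1)$ be the parity check and generator matrices of the binary repetition code of length $n_0$, and let $H_1=I_B\otimes H_0$, $G_1=I_B\otimes G_0$ (the inner code, a direct sum of $B$ repetition codes). There are integers $m,k,d$ and a matrix $H_2\in\mathbb F_2^{m\times B}$, the parity check matrix of the outer code $C_2=\ker H_2$, such that: 1. *(Outer code.)* $C_2$ has dimension $k\ge cB$ and minimum distance at least $d\ge cB$. If $B\ge M$, then $C_2$ is an expander code: in the Tanner graph of $H_2$ every variable (column) has degree exactly $D$, every check (row) has degree at most $\Delta$, and every set $S$ of at most $\alpha B$ variables has at least $\beta D|S|$ neighbouring checks. 2. *(Quantum code.)* Put $\mathscr H_X=H_2G_1$, $\mathscr H_Z=H_1$, $\mathscr C_X=\ker\mathscr H_X$, $\mathscr C_Z=\ker\mathscr H_Z$.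 Then $\mathscr H_X\mathscr H_Z^{T}=0$, and the partially concatenated CSS code $\mathscr A\subseteq(\mathbb C^2)^{\otimes N}$ stabilized by $X(a)$ for the rows $a$ of $\mathscr H_X$ and $Z(b)$ for the rows $b$ of $\mathscr H_Z$ has dimension $2^k$ and distances $$d_Z=\mathrm{wt}_H(\mathscr C_X\setminus\mathscr C_Z^\perp)\ge d\ge cN/n_0,\qquad d_X=\mathrm{wt}_H(\mathscr C_Z\setminus\mathscr C_X^\perp)\ge n_0,$$ where $\mathrm{wt}_H(S)$ is the least Hamming weight of an element of $S$. That is, $\mathscr A=[[N,\Omega(N/n_0),d_Z\ge\Omega(N/n_0)/d_X\ge n_0]]$. 3. *(Syndrome decoding.)* Given the syndromes $\mathscr H_Xe_Z^T$ and $\mathscr H_Ze_X^T$ of a $Z$-error $e_Z$ and an $X$-error $e_X$, the sequential program outputs $\tilde e_Z,\tilde e_X$ with $e_Z+\tilde e_Z\in\mathscr C_Z^\perp$ whenever $\mathrm{wt}_H(e_Z)\le\lfloor (d-1)/2\rfloor$, and $e_X+\tilde e_X\in\mathscr C_X^\perp$ whenever $\mathrm{wt}_H(e_X)\le\lfloor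 (n_0-1)/2\rfloor$. For all errors it halts after at most $KN$ steps of a random access machine with one processor. The parallel program has the same input and output and halts after at most $K(\log(N/n_0)+n_0)$ steps of a synchronous parallel random access machine (concurrent reads, exclusive writes) with at most $K\bigl(N/n_0+(N/n_0)\log(N/n_0)\bigr)$ processors. The words and addresses that the programs write are at most $KN$, and besides the syndromes the memory initially contains a table of at most $KN$ words, each at most $KN$, that depends only on the code. 4. *(Encoding.)* There is a circuit of Hadamard and C-NOT gates on the $N$ qubits, of size at most $K\bigl((N/n_0)^2+N\bigr)$ and depth at most $K(N/n_0+n_0)$, that maps the states $|\psi\rangle\otimes|0\cdots0\rangle$, with $|\psi\rangle$ an arbitrary state of some $k$ of the qubits, onto $\mathscr A$. -/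

import Mathlib

namespace PCCSS

open scoped Kronecker

/-! ### Binary linear codes -/

/-- The binary linear code with parity check matrix `H`. -/
def codeOf {ρ ι : Type*} [Fintype ι] (H : Matrix ρ ι (ZMod 2)) : Submodule (ZMod 2) (ι → ZMod 2) :=
  LinearMap.ker H.mulVecLin

/-- The dual code `C^⊥`. -/
def dualCode {ι : Type*} [Fintype ι] (C : Submodule (ZMod 2) (ι → ZMod 2)) :
    Submodule (ZMod 2) (ι → ZMod 2) where
  carrier := {v | ∀ w ∈ C, w ⬝ᵥ v = 0}
  add_mem' := by
    intro a b ha hb w hw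
    rw [dotProduct_add, ha w hw, hb w hw, add_zero]
  zero_mem' := by
    intro w _
    exact dotProduct_zero w
  smul_mem' := by
    intro r a ha w hw
    rw [dotProduct_smul, ha w hw, smul_zero]

/-- `wt_H(C ∖ D)`: the least Hamming weight of a vector of `C` outside `D`
(it is `0` if there is no such vector). -/
noncomputable def minWeightOutside {ι : Type*} [Fintype ι]
    (C D : Submodule (ZMod 2) (ι → ZMod 2)) : ℕ :=
  sInf {w | ∃ v ∈ C, v ∉ D ∧ hammingNorm v = w}

/-- The Tanner graph of the parity check matrix `H` (variables = columns, checks = rows) is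
`D`-regular on the variable side, has check degrees at most `Δ`, and every set `S` of at most
`α n` variables has at least `β D |S|` neighbouring checks. -/
structure IsExpanderCheckMatrix {m n : ℕ} (H : Matrix (Fin m) (Fin n) (ZMod 2))
    (D Δ : ℕ) (α β : ℝ) : Prop where
  variableDegree : ∀ j, (Finset.univ.filter fun i => H i j ≠ 0).card = D
  checkDegree : ∀ i, (Finset.univ.filter fun j => H i j ≠ 0).card ≤ Δ
  expansion : ∀ S : Finset (Fin n), (S.card : ℝ) ≤ α * n →
    β * D * S.card ≤ ((S.biUnion fun j => Finset.univ.filter fun i => H i j ≠ 0).card : ℝ)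

/-! ### Partial concatenation with a direct sum of repetition codes -/

/-- Parity check matrix `[I | 1]` of the binary repetition code of length `n`. -/
def repCheck (n : ℕ) : Matrix (Fin (n - 1)) (Fin n) (ZMod 2) :=
  Matrix.of fun i j => if j.val = i.val ∨ j.val = n - 1 then 1 else 0

/-- Generator matrix `(1 1 … 1)` of the binary repetition code of length `n`. -/
def repGen (n : ℕ) : Matrix (Fin 1) (Fin n) (ZMod 2) :=
  Matrix.of fun _ _ => 1

/-- Parity check matrix `I_B ⊗ H₀` of the direct sum of `B` repetition codes of length `n`. -/
def innerCheck (B n : ℕ) : Matrix (Fin B × Fin (n - 1)) (Fin B × Fin n) (ZMod 2) :=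
  (1 : Matrix (Fin B) (Fin B) (ZMod 2)) ⊗ₖ repCheck n

/-- Generator matrix `I_B ⊗ G₀` of the direct sum of `B` repetition codes of length `n`. -/
def innerGen (B n : ℕ) : Matrix (Fin B) (Fin B × Fin n) (ZMod 2) :=
  ((1 : Matrix (Fin B) (Fin B) (ZMod 2)) ⊗ₖ repGen n).submatrix (fun b => (b, 0)) id

/-- The `X`-stabilizer matrix `H₂ G₁` of the PC-CSS code with outer parity check matrix `H₂`. -/
def pcX {m B : ℕ} (n : ℕ) (H₂ : Matrix (Fin m) (Fin B) (ZMod 2)) :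
    Matrix (Fin m) (Fin B × Fin n) (ZMod 2) :=
  H₂ * innerGen B n

/-! ### Quantum CSS codes: states are functions on the computational basis `𝔽₂^ι` -/

/-- `X(u) |a⟩ = |a + u⟩`. -/
def pauliX {ι : Type*} (u : ι → ZMod 2) :
    ((ι → ZMod 2) → ℂ) →ₗ[ℂ] ((ι → ZMod 2) → ℂ) where
  toFun ψ x := ψ (x - u)
  map_add' _ _ := rfl
  map_smul' _ _ := rfl

/-- `Z(v) |a⟩ = (-1)^{v·a} |a⟩`. -/
def pauliZ {ι : Type*} [Fintype ι] (v : ι → ZMod 2) :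
    ((ι → ZMod 2) → ℂ) →ₗ[ℂ] ((ι → ZMod 2) → ℂ) where
  toFun ψ x := (-1) ^ (v ⬝ᵥ x).val * ψ x
  map_add' ψ φ := by
    funext x
    simp [mul_add]
  map_smul' r ψ := by
    funext x
    simp [mul_left_comm]

/-- The stabilizer code whose stabilizer generators are `X(a)` for the rows `a` of `HX` and `Z(b)`
for the rows `b` of `HZ`. -/
def cssSpace {ρ σ ι : Type*} [Fintype ι] (HX : Matrix ρ ι (ZMod 2)) (HZ : Matrix σ ι (ZMod 2)) :
    Submodule ℂ ((ι → ZMod 2) → ℂ) where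
  carrier := {ψ | (∀ i, pauliX (HX i) ψ = ψ) ∧ ∀ i, pauliZ (HZ i) ψ = ψ}
  add_mem' := by
    rintro a b ⟨ha, ha'⟩ ⟨hb, hb'⟩
    exact ⟨fun i => by rw [map_add, ha, hb], fun i => by rw [map_add, ha', hb']⟩
  zero_mem' := ⟨fun i => map_zero _, fun i => map_zero _⟩
  smul_mem' := by
    rintro r a ⟨ha, ha'⟩
    exact ⟨fun i => by rw [map_smul, ha], fun i => by rw [map_smul, ha']⟩

/-! ### Quantum circuits of Hadamard and C-NOT gates -/

inductive Gate (ι : Type*) where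
  | had (i : ι)
  | cnot (control target : ι) (h : control ≠ target)

namespace Gate

variable {ι : Type*} [DecidableEq ι]

/-- The qubits on which a gate acts. -/
def support : Gate ι → Finset ι
  | had i => {i}
  | cnot i j _ => {i, j}

/-- The unitary operator of a gate. -/
noncomputable def op : Gate ι → (((ι → ZMod 2) → ℂ) →ₗ[ℂ] ((ι → ZMod 2) → ℂ))
  | had i =>
    { toFun := fun ψ x => ((√2 : ℝ) : ℂ)⁻¹ *
        (ψ (Function.update x i 0) + (-1) ^ (x i).val * ψ (Function.update x i 1))
      map_add' := by
        intro ψ φ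
        funext x
        simp only [Pi.add_apply]
        ring
      map_smul' := by
        intro r ψ
        funext x
        simp only [Pi.smul_apply, smul_eq_mul, RingHom.id_apply]
        ring }
  | cnot i j _ =>
    { toFun := fun ψ x => ψ (Function.update x j (x j + x i))
      map_add' := fun _ _ => rfl
      map_smul' := fun _ _ => rfl }

end Gate

/-- A circuit: a list of layers, executed from left to right; the gates of one layer act on
pairwise disjoint sets of qubits. -/
structure Circuit (ι : Type*) [DecidableEq ι] where
  layers : List (List (Gate ι))
  disjoint : ∀ L ∈ layers, L.Pairwise fun g h => Disjoint g.support h.support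

namespace Circuit

variable {ι : Type*} [DecidableEq ι]

def depth (C : Circuit ι) : ℕ := C.layers.length

/-- The number of gates. -/
def size (C : Circuit ι) : ℕ := C.layers.flatten.length

/-- The unitary operator of a circuit (the first gate is applied first). -/
noncomputable def op (C : Circuit ι) : ((ι → ZMod 2) → ℂ) →ₗ[ℂ] ((ι → ZMod 2) → ℂ) :=
  C.layers.flatten.foldl (fun U g => g.op ∘ₗ U) LinearMap.id

end Circuit

/-- The states `|ψ⟩ ⊗ |0 … 0⟩` with an arbitrary state `|ψ⟩` on the qubits `inp i`, and all other
qubits in state `|0⟩`. -/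
def inputSpace {ι : Type*} {k : ℕ} (inp : Fin k ↪ ι) : Submodule ℂ ((ι → ZMod 2) → ℂ) where
  carrier := {ψ | ∀ x : ι → ZMod 2, (∃ i, i ∉ Set.range inp ∧ x i ≠ 0) → ψ x = 0}
  add_mem' := by
    intro a b ha hb x hx
    rw [Pi.add_apply, ha x hx, hb x hx, add_zero]
  zero_mem' := fun _ _ => rfl
  smul_mem' := by
    intro r a ha x hx
    rw [Pi.smul_apply, ha x hx, smul_zero]

/-- The circuit `C` encodes `k` qubits into the code space `Q`, without further ancillas. -/
def Circuit.Encodes {ι : Type*} [DecidableEq ι] (C : Circuit ι) (k : ℕ)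
    (Q : Submodule ℂ ((ι → ZMod 2) → ℂ)) : Prop :=
  ∃ inp : Fin k ↪ ι, (inputSpace inp).map C.op = Q

/-! ### Classical machine: a synchronous random access machine with exclusive writes

The shared memory consists of arrays of natural numbers. In one parallel step, every processor
`p` below a given number evaluates a fixed guard, address and value in the memory before the step
and, if the guard is nonzero, writes the value; different processors must write to
different cells. With a single processor this is an ordinary random access machine. -/

/-- Cell `i` of array `a` is `s a i`. -/
abbrev Mem := ℕ → ℕ → ℕ

inductive Expr where
  | const (n : ℕ)
  | pid
  | read (a : ℕ) (i : Expr)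
  | add (e f : Expr)
  | sub (e f : Expr)
  | mul (e f : Expr)
  | lt (e f : Expr)

/-- Value of an expression in memory `s` for processor number `p`; subtraction is truncated and
a comparison yields `1` (true) or `0` (false). -/
def Expr.eval (s : Mem) (p : ℕ) : Expr → ℕ
  | const n => n
  | pid => p
  | read a i => s a (i.eval s p)
  | add e f => e.eval s p + f.eval s p
  | sub e f => e.eval s p - f.eval s p
  | mul e f => e.eval s p * f.eval s p
  | lt e f => if e.eval s p < f.eval s p then 1 else 0

inductive Cmd where
  | skip
  /-- For all `p < count` in parallel: if `guard ≠ 0` then `a[addr] := val`. -/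
  | par (count guard : Expr) (a : ℕ) (addr val : Expr)
  | seq (c d : Cmd)
  | ite (e : Expr) (c d : Cmd)
  | loop (e : Expr) (c : Cmd)

/-- Processor `p` is active in a parallel step. -/
def Active (count guard : Expr) (s : Mem) (p : ℕ) : Prop :=
  p < count.eval s 0 ∧ guard.eval s p ≠ 0

/-- `Exec W P c s t s'`: started in memory `s`, the command `c` halts after `t` steps in memory
`s'`, uses at most `P` processors at any time, and all written values and addresses are
at most `W`. Programs are fixed objects, so a step evaluates expressions of bounded size. -/
inductive Exec (W P : ℕ) : Cmd → Mem → ℕ → Mem → Prop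
  | skip (s : Mem) : Exec W P Cmd.skip s 1 s
  | par (count guard : Expr) (a : ℕ) (addr val : Expr) (s s' : Mem)
      (procs : count.eval s 0 ≤ P)
      (word : ∀ p, Active count guard s p → addr.eval s p ≤ W ∧ val.eval s p ≤ W)
      (exclusive : ∀ p q, Active count guard s p → Active count guard s q →
        addr.eval s p = addr.eval s q → p = q)
      (written : ∀ p, Active count guard s p → s' a (addr.eval s p) = val.eval s p)
      (unchanged : ∀ b i, (¬ ∃ p, Active count guard s p ∧ b = a ∧ i = addr.eval s p) →
        s' b i = s b i) :
      Exec W P (Cmd.par count guard a addr val) s 1 s'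
  | seq (c d : Cmd) (s s' s'' : Mem) (t t' : ℕ) :
      Exec W P c s t s' → Exec W P d s' t' s'' → Exec W P (Cmd.seq c d) s (t + t') s''
  | iteTrue (e : Expr) (c d : Cmd) (s s' : Mem) (t : ℕ) :
      e.eval s 0 ≠ 0 → Exec W P c s t s' → Exec W P (Cmd.ite e c d) s (t + 1) s'
  | iteFalse (e : Expr) (c d : Cmd) (s s' : Mem) (t : ℕ) :
      e.eval s 0 = 0 → Exec W P d s t s' → Exec W P (Cmd.ite e c d) s (t + 1) s'
  | loopDone (e : Expr) (c : Cmd) (s : Mem) :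
      e.eval s 0 = 0 → Exec W P (Cmd.loop e c) s 1 s
  | loopStep (e : Expr) (c : Cmd) (s s' s'' : Mem) (t t' : ℕ) :
      e.eval s 0 ≠ 0 → Exec W P c s t s' → Exec W P (Cmd.loop e c) s' t' s'' →
      Exec W P (Cmd.loop e c) s (t + t' + 1) s''

/-! ### Syndrome decoding -/

/-- A bit vector as the contents of an array. -/
def bitArray {n : ℕ} (f : Fin n → ZMod 2) (i : ℕ) : ℕ :=
  if h : i < n then (f ⟨i, h⟩).val else 0

/-- A doubly indexed bit vector as the contents of an array; entry `(b, j)` is in cell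
`b * n + j`. -/
def bitArray₂ {B n : ℕ} (f : Fin B × Fin n → ZMod 2) : ℕ → ℕ :=
  bitArray fun i : Fin (B * n) => f (finProdFinEquiv.symm i)

/-- Initial memory: array `0` holds a precomputed table describing the code, arrays `1` and `2`
hold the two syndromes, everything else is zero. -/
def initMem (table : List ℕ) (s₁ s₂ : ℕ → ℕ) : Mem := fun a i =>
  if a = 0 then table.getD i 0 else if a = 1 then s₁ i else if a = 2 then s₂ i else 0

/-- The error read off from array `a` of the final memory. -/
def output {B n : ℕ} (s : Mem) (a : ℕ) : Fin B × Fin n → ZMod 2 :=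
  fun q => (s a (q.1.val * n + q.2.val) : ZMod 2)

/-- The program `prog` is a syndrome decoder for the PC-CSS code with outer parity check matrix
`H₂` and `B` repetition blocks of length `n`, correcting (up to stabilizers) every `Z`-error of
weight at most `tZ` and every `X`-error of weight at most `tX`. On the syndromes of
arbitrary errors it halts within time `T`, using at most `P` processors and words of size at most
`W`; the table depends on the code only and has at most `W` entries, each at most `W`. The estimated
`Z`- and `X`-errors are left in the arrays `3` and `4`. -/
def DecodesWithin {m B : ℕ} (n : ℕ) (H₂ : Matrix (Fin m) (Fin B) (ZMod 2)) (prog : Cmd)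
    (tZ tX W : ℕ) (T P : ℝ) : Prop :=
  ∃ table : List ℕ, table.length ≤ W ∧ (∀ a ∈ table, a ≤ W) ∧
    ∀ eZ eX : Fin B × Fin n → ZMod 2, ∃ (p t : ℕ) (s : Mem), (p : ℝ) ≤ P ∧ (t : ℝ) ≤ T ∧
      Exec W p prog
        (initMem table (bitArray ((pcX n H₂).mulVec eZ)) (bitArray₂ ((innerCheck B n).mulVec eX)))
        t s ∧
      (hammingNorm eZ ≤ tZ → eZ + output s 3 ∈ dualCode (codeOf (innerCheck B n))) ∧
      (hammingNorm eX ≤ tX → eX + output s 4 ∈ dualCode (codeOf (pcX n H₂)))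

end PCCSS

/-!
The outer code is an expander code: counting shows that some bipartite graph of constant variable
degree expands, and splitting its checks of large degree keeps the expansion. A `Z`-error acts on
the concatenated code only through its block parities, so correcting it is decoding the outer code
by bit flipping, where a variable is flipped if most of its checks are violated. Flipping one
variable at a time decreases the number of violated checks, hence takes linear time; flipping all
such variables at once halves the weight of the error, hence takes logarithmically many rounds.
An `X`-error of small weight is less than half of every block and is found by a majority vote.

For the encoder, choose a generator matrix in systematic form of the code spanned by the rows of
the outer check matrix. Hadamard gates on its pivots followed by C-NOT gates superpose the words
of that code, and C-NOT gates inside the blocks repeat every bit.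
-/

namespace PCCSS

open Finset

/-! ### Random bipartite graphs expand -/

section ExpandingMaps

theorem choose_le_exp_mul_div_pow (n k : ℕ) :
    (n.choose k : ℝ) ≤ (Real.exp 1 * n / k) ^ k := by
  rcases k.eq_zero_or_pos with rfl | hk
  · simp
  have hk' : (0 : ℝ) < k := by exact_mod_cast hk
  have hexp : (k : ℝ) ^ k / k.factorial ≤ Real.exp 1 ^ k := by
    rw [← Real.exp_nat_mul, mul_one]
    exact Real.pow_div_factorial_le_exp k hk'.le k
  calc (n.choose k : ℝ) ≤ (n : ℝ) ^ k / k.factorial := Nat.choose_le_pow_div k n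
    _ = (n / k : ℝ) ^ k * ((k : ℝ) ^ k / k.factorial) := by rw [div_pow]; field_simp
    _ ≤ (n / k : ℝ) ^ k * Real.exp 1 ^ k := by gcongr
    _ = (Real.exp 1 * n / k) ^ k := by rw [← mul_pow]; ring

theorem prod_le_sum_div_card_pow {ι : Type*} [Fintype ι] [Nonempty ι] {a : ι → ℝ}
    (ha : ∀ i, 0 ≤ a i) : ∏ i, a i ≤ ((∑ i, a i) / Fintype.card ι) ^ Fintype.card ι := by
  have hprod : 0 ≤ ∏ i, a i := prod_nonneg fun i _ => ha i
  have amgm := Real.geom_mean_le_arith_mean univ (fun _ => (1 : ℝ)) a (by simp)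
    (by simp [Fintype.card_pos]) fun i _ => ha i
  simp only [Real.rpow_one, sum_const, card_univ, nsmul_eq_mul, mul_one, one_mul] at amgm
  calc ∏ i, a i = ((∏ i, a i) ^ (Fintype.card ι : ℝ)⁻¹) ^ Fintype.card ι :=
        (Real.rpow_inv_natCast_pow hprod Fintype.card_ne_zero).symm
    _ ≤ _ := pow_le_pow_left₀ (Real.rpow_nonneg hprod _) amgm _

variable {V ι R : Type*} [Fintype ι] [DecidableEq ι] [DecidableEq R]

/-- The neighbours of `S` in the bipartite graph that joins `v : V`, for every colour `i : ι`, to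
the vertex `f v i` in the copy of `R` of colour `i`. All vertices of `V` have degree `|ι|`. -/
def coloredNeighbors (f : V → ι → R) (S : Finset V) : Finset (ι × R) :=
  S.biUnion fun v => univ.image fun i => (i, f v i)

theorem coloredNeighbors_subset_iff {f : V → ι → R} {S : Finset V} {T : Finset (ι × R)} :
    coloredNeighbors f S ⊆ T ↔ ∀ v ∈ S, ∀ i, (i, f v i) ∈ T := by
  simp [coloredNeighbors, image_subset_iff]

theorem sum_card_color_class [Fintype R] (T : Finset (ι × R)) : ∑ i, #{x | (i, x) ∈ T} = #T := by
  rw [card_eq_sum_card_fiberwise (f := Prod.fst) (t := univ) (by simp)]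
  refine sum_congr rfl fun i _ => card_bij (fun x _ => (i, x)) ?_ ?_ ?_
  · simp
  · simp
  · rintro ⟨a, x⟩ hax
    obtain ⟨hT, rfl⟩ := mem_filter.1 hax
    exact ⟨x, by simpa using hT, rfl⟩

variable [Fintype V] [Fintype R]

theorem card_coloredNeighbors_subset [DecidableEq V] (S : Finset V) (T : Finset (ι × R)) :
    #{f : V → ι → R | coloredNeighbors f S ⊆ T} =
      (∏ i, #{x | (i, x) ∈ T}) ^ #S * (Fintype.card R ^ Fintype.card ι) ^ #Sᶜ := by
  have hpi : ({f : V → ι → R | coloredNeighbors f S ⊆ T} : Finset _) =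
      Fintype.piFinset fun v => Fintype.piFinset fun i =>
        if v ∈ S then ({x | (i, x) ∈ T} : Finset R) else univ := by
    ext f
    simp only [coloredNeighbors_subset_iff, mem_filter, mem_univ, true_and, Fintype.mem_piFinset]
    refine forall_congr' fun v => ?_
    by_cases hv : v ∈ S <;> simp [hv]
  have hfactor (v : V) : #(Fintype.piFinset fun i =>
      if v ∈ S then ({x | (i, x) ∈ T} : Finset R) else univ) =
        if v ∈ S then ∏ i, #{x | (i, x) ∈ T} else Fintype.card R ^ Fintype.card ι := by
    rw [Fintype.card_piFinset]
    split_ifs <;> simp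
  rw [hpi, Fintype.card_piFinset, prod_congr rfl fun v _ => hfactor v, prod_ite, prod_const,
    prod_const, filter_mem_eq_inter, univ_inter, filter_not, filter_mem_eq_inter, univ_inter,
    compl_eq_univ_sdiff]

theorem card_coloredNeighbors_subset_le [DecidableEq V] [Nonempty ι] [Nonempty R] (S : Finset V)
    (T : Finset (ι × R)) :
    (#{f : V → ι → R | coloredNeighbors f S ⊆ T} : ℝ) ≤
      (#T / (Fintype.card ι * Fintype.card R : ℕ) : ℝ) ^ (Fintype.card ι * #S) *
        Fintype.card (V → ι → R) := by
  have amgm := prod_le_sum_div_card_pow (a := fun i : ι => (#{x | (i, x) ∈ T} : ℝ))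
    fun _ => Nat.cast_nonneg _
  rw [← Nat.cast_sum, sum_card_color_class] at amgm
  rw [card_coloredNeighbors_subset, Fintype.card_fun, Fintype.card_fun,
    ← card_add_card_compl S, pow_add]
  have hq : (0 : ℝ) < Fintype.card R := by exact_mod_cast Fintype.card_pos
  push_cast
  generalize Fintype.card R = q at *
  generalize Fintype.card ι = D at *
  calc (∏ i, (#{x | (i, x) ∈ T} : ℝ)) ^ #S * ((q : ℝ) ^ D) ^ #Sᶜ
      ≤ ((#T / D : ℝ) ^ D) ^ #S * ((q : ℝ) ^ D) ^ #Sᶜ := by gcongr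
    _ = (#T / (D * q) : ℝ) ^ (D * #S) * (((q : ℝ) ^ D) ^ #S * ((q : ℝ) ^ D) ^ #Sᶜ) := by
        rw [← div_div, div_pow _ (q : ℝ), pow_mul, pow_mul, ← mul_assoc,
          div_mul_cancel₀ _ (by positivity)]

theorem card_exists_coloredNeighbors_le [DecidableEq V] [Nonempty ι] [Nonempty R] {s t : ℕ}
    (ht : t ≤ Fintype.card ι * Fintype.card R) :
    (#{f : V → ι → R | ∃ S, #S = s ∧ #(coloredNeighbors f S) ≤ t} : ℝ) ≤
      (Fintype.card V).choose s * (Fintype.card ι * Fintype.card R).choose t *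
        (t / (Fintype.card ι * Fintype.card R : ℕ) : ℝ) ^ (Fintype.card ι * s) *
          Fintype.card (V → ι → R) := by
  have hcover : ({f : V → ι → R | ∃ S, #S = s ∧ #(coloredNeighbors f S) ≤ t} : Finset _) ⊆
      (powersetCard s univ ×ˢ powersetCard t univ).biUnion fun ST =>
        {f : V → ι → R | coloredNeighbors f ST.1 ⊆ ST.2} := by
    intro f hf
    obtain ⟨S, hS, hft⟩ := (mem_filter.1 hf).2
    obtain ⟨T, hT, hTt⟩ := exists_superset_card_eq hft (by rwa [Fintype.card_prod])
    exact mem_biUnion.2 ⟨(S, T), by simp [hS, hTt], by simpa using hT⟩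
  calc (#{f : V → ι → R | ∃ S, #S = s ∧ #(coloredNeighbors f S) ≤ t} : ℝ)
      ≤ ∑ ST ∈ powersetCard s (univ : Finset V) ×ˢ powersetCard t (univ : Finset (ι × R)),
          (#{f : V → ι → R | coloredNeighbors f ST.1 ⊆ ST.2} : ℝ) := by
        exact_mod_cast (card_le_card hcover).trans card_biUnion_le
    _ ≤ #(powersetCard s (univ : Finset V) ×ˢ powersetCard t (univ : Finset (ι × R))) •
          ((t / (Fintype.card ι * Fintype.card R : ℕ) : ℝ) ^ (Fintype.card ι * s) *
            Fintype.card (V → ι → R)) := by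
        refine sum_le_card_nsmul _ _ _ fun ST hST => ?_
        obtain ⟨hS, hT⟩ := mem_product.1 hST
        rw [← (mem_powersetCard.1 hS).2, ← (mem_powersetCard.1 hT).2]
        exact card_coloredNeighbors_subset_le ST.1 ST.2
    _ = _ := by
        rw [card_product, card_powersetCard, card_powersetCard, card_univ, card_univ,
          Fintype.card_prod, nsmul_eq_mul, Nat.cast_mul, ← mul_assoc]

/-- The relative size up to which a random graph of left degree `g + 2` expands by the factor `g`,
when the left side is at most `lam` times as large as the right side. It is chosen such that the
union bound over the sets of size `s` is `4⁻ˢ`. -/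
noncomputable def expansionRadius (g : ℕ) (lam : ℝ) : ℝ :=
  1 / (4 * (Real.exp 1 ^ (g + 1) * g ^ 2 * lam ^ 2))

theorem expansionRadius_pos {g : ℕ} {lam : ℝ} (hg : 0 < g) (hlam : 0 < lam) :
    0 < expansionRadius g lam := by
  unfold expansionRadius
  positivity

theorem expansionRadius_mul_le_one {g : ℕ} {lam : ℝ} (hg : 0 < g) (hlam : 1 ≤ lam) :
    expansionRadius g lam * (g * lam) ≤ 1 := by
  have hg' : (1 : ℝ) ≤ g := by exact_mod_cast hg
  have hexp : 1 ≤ Real.exp 1 ^ (g + 1) := one_le_pow₀ (Real.one_le_exp zero_le_one)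
  rw [expansionRadius, one_div_mul_eq_div, div_le_one (by positivity)]
  calc (g * lam : ℝ) ≤ 1 * (g ^ 2 * lam ^ 2) := by rw [one_mul]; gcongr <;> nlinarith
    _ ≤ Real.exp 1 ^ (g + 1) * (g ^ 2 * lam ^ 2) := by gcongr
    _ ≤ 4 * (Real.exp 1 ^ (g + 1) * g ^ 2 * lam ^ 2) := by
        rw [mul_assoc (Real.exp 1 ^ (g + 1))]
        exact le_mul_of_one_le_left (by positivity) (by norm_num)

theorem choose_mul_choose_mul_pow_le {B Q s g : ℕ} {lam : ℝ} (hs : 0 < s) (hg : 0 < g)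
    (hQ : 0 < Q) (hlam : 0 < lam) (hsB : s ≤ expansionRadius g lam * B) (hBQ : B ≤ lam * Q) :
    (B.choose s : ℝ) * Q.choose (g * s) * ((g * s : ℕ) / Q : ℝ) ^ ((g + 2) * s) ≤
      (1 / 4) ^ s := by
  have hradius := expansionRadius_pos hg hlam
  calc (B.choose s : ℝ) * Q.choose (g * s) * ((g * s : ℕ) / Q : ℝ) ^ ((g + 2) * s)
      ≤ (Real.exp 1 * B / s) ^ s * (Real.exp 1 * Q / (g * s : ℕ)) ^ (g * s) *
          ((g * s : ℕ) / Q : ℝ) ^ ((g + 2) * s) := by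
        gcongr <;> apply choose_le_exp_mul_div_pow
    _ = (Real.exp 1 ^ (g + 1) * g ^ 2 * (B * s / Q ^ 2)) ^ s := by
        rw [pow_mul, pow_mul, ← mul_pow, ← mul_pow]
        congr 1
        push_cast
        simp only [div_pow, mul_pow, pow_add]
        field_simp
    _ ≤ (Real.exp 1 ^ (g + 1) * g ^ 2 * (expansionRadius g lam * lam ^ 2)) ^ s := by
        gcongr
        rw [div_le_iff₀ (by positivity)]
        calc (B * s : ℝ) ≤ B * (expansionRadius g lam * B) := by gcongr
          _ = expansionRadius g lam * B ^ 2 := by ring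
          _ ≤ expansionRadius g lam * (lam * Q) ^ 2 := by gcongr
          _ = expansionRadius g lam * lam ^ 2 * Q ^ 2 := by ring
    _ = (1 / 4) ^ s := by
        rw [expansionRadius]
        field_simp

theorem sum_Icc_quarter_pow_lt_one (n : ℕ) : ∑ s ∈ Icc 1 n, (1 / 4 : ℝ) ^ s < 1 := by
  have hsum : ∑ s ∈ Icc 1 n, (1 / 4 : ℝ) ^ s = 1 / 3 - 1 / 3 * (1 / 4) ^ n := by
    induction n with
    | zero => simp
    | succ n ih => rw [sum_Icc_succ_top (by omega), ih]; ring
  rw [hsum]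
  linarith [pow_pos (by norm_num : (0 : ℝ) < 1 / 4) n]

theorem exists_expanding_map [Nonempty R] {g : ℕ} {lam : ℝ} (hg : 0 < g) (hlam : 1 ≤ lam)
    (hι : Fintype.card ι = g + 2)
    (hV : Fintype.card V ≤ lam * (Fintype.card ι * Fintype.card R : ℕ)) :
    ∃ f : V → ι → R, ∀ S : Finset V, #S ≤ expansionRadius g lam * Fintype.card V →
      g * #S ≤ #(coloredNeighbors f S) := by
  classical
  have : Nonempty ι := Fintype.card_pos_iff.1 (by omega)
  have hradius := expansionRadius_pos hg (zero_lt_one.trans_le hlam)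
  set Q := Fintype.card ι * Fintype.card R with hQ
  have hQ0 : 0 < Q := Nat.mul_pos Fintype.card_pos Fintype.card_pos
  set n := ⌊expansionRadius g lam * Fintype.card V⌋₊
  have le_of_le_floor {s : ℕ} (hs : s ≤ n) : (s : ℝ) ≤ expansionRadius g lam * Fintype.card V :=
    (Nat.le_floor_iff (by positivity)).1 hs
  have mul_le_right_card {s : ℕ} (hs : s ≤ n) : g * s ≤ Q := by
    have : (g * s : ℝ) ≤ Q := calc
      (g * s : ℝ) ≤ g * (expansionRadius g lam * (lam * Q)) := by
          gcongr
          exact (le_of_le_floor hs).trans (by gcongr)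
      _ = expansionRadius g lam * (g * lam) * Q := by ring
      _ ≤ Q := mul_le_of_le_one_left (Nat.cast_nonneg _) (expansionRadius_mul_le_one hg hlam)
    exact_mod_cast this
  by_contra! hbad
  have hcover : (univ : Finset (V → ι → R)) ⊆ (Icc 1 n).biUnion fun s =>
      {f : V → ι → R | ∃ S, #S = s ∧ #(coloredNeighbors f S) ≤ g * s} := by
    intro f _
    obtain ⟨S, hS, hlt⟩ := hbad f
    exact mem_biUnion.2 ⟨#S, mem_Icc.2 ⟨Nat.pos_of_mul_pos_left (Nat.zero_lt_of_lt hlt),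
      Nat.le_floor hS⟩, mem_filter.2 ⟨mem_univ _, S, rfl, hlt.le⟩⟩
  have hunion : (Fintype.card (V → ι → R) : ℝ) ≤
      ∑ s ∈ Icc 1 n, (1 / 4 : ℝ) ^ s * Fintype.card (V → ι → R) := by
    refine (Nat.cast_le.2 ((card_le_card hcover).trans card_biUnion_le)).trans ?_
    rw [Nat.cast_sum]
    refine sum_le_sum fun s hs => ?_
    obtain ⟨hs0, hsn⟩ := mem_Icc.1 hs
    refine (card_exists_coloredNeighbors_le (mul_le_right_card hsn)).trans ?_
    rw [← hQ, hι]
    gcongr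
    exact choose_mul_choose_mul_pow_le hs0 hg hQ0 (by linarith) (le_of_le_floor hsn) hV
  rw [← sum_mul] at hunion
  have htotal : (0 : ℝ) < Fintype.card (V → ι → R) := by exact_mod_cast Fintype.card_pos
  exact (mul_lt_of_lt_one_left htotal (sum_Icc_quarter_pow_lt_one n)).not_ge hunion

end ExpandingMaps

/-! ### Expander codes -/

theorem exists_balanced_grouping {α : Type*} (A : Finset α) {Δ : ℕ} (hΔ : 0 < Δ) :
    ∃ r : α → ℕ, (∀ g, (A.filter fun a => r a = g).card ≤ Δ) ∧ ∀ a ∈ A, r a < #A / Δ + 1 := by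
  classical
  refine ⟨fun a => A.toList.idxOf a / Δ, fun g => ?_, fun a ha => ?_⟩
  · have hmaps : Set.MapsTo A.toList.idxOf (A.filter fun a => A.toList.idxOf a / Δ = g)
        (Ico (g * Δ) (g * Δ + Δ)) := by
      intro a ha
      simpa [Nat.div_eq_iff hΔ, add_mul, Nat.lt_iff_le_pred, hΔ, Nat.succ_le_iff,
        Nat.add_sub_assoc] using (mem_filter.1 ha).2
    refine (card_le_card_of_injOn _ hmaps fun a ha b _ hab => ?_).trans_eq (by simp)
    exact (List.idxOf_inj (mem_toList.2 (mem_filter.1 ha).1)).1 hab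
  · have : A.toList.idxOf a < #A := by
      simpa using List.idxOf_lt_length_of_mem (mem_toList.2 ha)
    exact Nat.lt_succ_of_le (Nat.div_le_div_right this.le)

/-- Every vertex of large degree is split into copies of degree at most `Δ`; the map `π` sends a
copy to the original vertex. -/
theorem exists_bounded_degree_splitting {B D q Δ : ℕ} (hΔ : 0 < Δ) (f : Fin B → Fin D → Fin q) :
    ∃ (m : ℕ) (e : Fin B → Fin D → Fin m) (π : Fin m → Fin D × Fin q),
      Δ * m ≤ D * B + Δ * (D * q) ∧ (∀ j i, π (e j i) = (i, f j i)) ∧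
        ∀ c, #{j | ∃ i, e j i = c} ≤ Δ := by
  set A : Fin D × Fin q → Finset (Fin B) := fun v => {j | f j v.1 = v.2} with hA
  choose r hr_card hr_lt using fun v => exists_balanced_grouping (A v) hΔ
  set copy : Fin B × Fin D → (Fin D × Fin q) × ℕ :=
    fun p => ((p.2, f p.1 p.2), r (p.2, f p.1 p.2) p.1) with hcopy
  set E := univ.image copy with hE
  have mem_E (p) : copy p ∈ E := mem_image_of_mem _ (mem_univ p)
  have hE_sub : E ⊆ univ.biUnion fun v => (range (#(A v) / Δ + 1)).image (Prod.mk v) := by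
    rw [hE, image_subset_iff]
    rintro ⟨j, i⟩ -
    exact mem_biUnion.2 ⟨(i, f j i), mem_univ _,
      mem_image_of_mem _ (mem_range.2 (hr_lt _ _ (by simp [hA])))⟩
  have sum_card_A : ∑ v, #(A v) = D * B := by
    rw [Fintype.sum_prod_type]
    have hcolor (i : Fin D) : ∑ x, #(A (i, x)) = B := by
      simpa [hA] using (card_eq_sum_card_fiberwise (s := univ) (t := univ)
        (f := fun j => f j i) (by simp)).symm
    simp [hcolor]
  refine ⟨#E, fun j i => E.equivFin ⟨copy (j, i), mem_E _⟩, fun c => (E.equivFin.symm c).val.1,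
    ?_, fun j i => by simp [hcopy], fun c => ?_⟩
  · calc Δ * #E ≤ Δ * ∑ v, (#(A v) / Δ + 1) := by
          gcongr
          refine (card_le_card hE_sub).trans (card_biUnion_le.trans (sum_le_sum fun v _ => ?_))
          exact card_image_le.trans_eq (card_range _)
      _ = ∑ v, Δ * (#(A v) / Δ) + Δ * (D * q) := by
          simp [mul_sum, mul_add, sum_add_distrib]
      _ ≤ ∑ v, #(A v) + Δ * (D * q) := by
          gcongr with v
          exact Nat.mul_div_le _ _
      _ = D * B + Δ * (D * q) := by rw [sum_card_A]
  · refine (card_le_card fun j hj => ?_).trans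
      (hr_card (E.equivFin.symm c).val.1 (E.equivFin.symm c).val.2)
    obtain ⟨i, rfl⟩ := (mem_filter.1 hj).2
    simp [hcopy, hA]

theorem exists_checkMatrix_of_map {B D q Δ : ℕ} (hΔ : 0 < Δ) (f : Fin B → Fin D → Fin q) :
    ∃ (m : ℕ) (H : Matrix (Fin m) (Fin B) (ZMod 2)), Δ * m ≤ D * B + Δ * (D * q) ∧
      (∀ j, #{c | H c j ≠ 0} = D) ∧ (∀ c, #{j | H c j ≠ 0} ≤ Δ) ∧
        ∀ S, #(coloredNeighbors f S) ≤ #(S.biUnion fun j => {c | H c j ≠ 0}) := by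
  obtain ⟨m, e, π, hm, hπ, hdeg⟩ := exists_bounded_degree_splitting hΔ f
  set H : Matrix (Fin m) (Fin B) (ZMod 2) :=
    Matrix.of fun c j => if ∃ i, e j i = c then 1 else 0 with hH
  have H_ne_zero (c j) : H c j ≠ 0 ↔ ∃ i, e j i = c := by simp [hH]
  refine ⟨m, H, hm, fun j => ?_, fun c => by simpa only [H_ne_zero] using hdeg c, fun S => ?_⟩
  · have himage : ({c | H c j ≠ 0} : Finset _) = univ.image (e j) := by
      ext c
      simp [H_ne_zero]
    have hinj : Function.Injective (e j) := fun i i' h => by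
      simpa [hπ] using congrArg (fun c => (π c).1) h
    rw [himage, card_image_of_injective _ hinj, card_univ, Fintype.card_fin]
  · refine (card_le_card (coloredNeighbors_subset_iff.2 fun j hj i => ?_)).trans
      (card_image_le (f := π))
    rw [← hπ j i]
    exact mem_image_of_mem _ (mem_biUnion.2 ⟨j, hj, by simp [H_ne_zero]⟩)

theorem exists_isExpanderCheckMatrix {g B q Δ : ℕ} {lam : ℝ} (hg : 0 < g) (hlam : 1 ≤ lam)
    (hΔ : 0 < Δ) (hq : 0 < q) (hB : B ≤ lam * ((g + 2) * q : ℕ)) :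
    ∃ (m : ℕ) (H : Matrix (Fin m) (Fin B) (ZMod 2)),
      Δ * m ≤ (g + 2) * B + Δ * ((g + 2) * q) ∧
        IsExpanderCheckMatrix H (g + 2) Δ (expansionRadius g lam) (g / (g + 2)) := by
  have : Nonempty (Fin q) := ⟨⟨0, hq⟩⟩
  obtain ⟨f, hf⟩ := exists_expanding_map (V := Fin B) (ι := Fin (g + 2)) (R := Fin q) hg hlam
    (by simp) (by simpa using hB)
  obtain ⟨m, H, hm, hcol, hrow, hnbr⟩ := exists_checkMatrix_of_map hΔ f
  refine ⟨m, H, hm, hcol, hrow, fun S hS => ?_⟩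
  have hgS : (g * #S : ℝ) ≤ #(S.biUnion fun j => {c | H c j ≠ 0}) := by
    exact_mod_cast (hf S (by simpa using hS)).trans (hnbr S)
  refine le_trans (le_of_eq ?_) hgS
  push_cast
  field_simp

/-! ### Bit flipping on expander codes -/

theorem zmod_two_cases (a : ZMod 2) : a = 0 ∨ a = 1 := by
  revert a
  decide

section TannerGraph

variable {ρ ι : Type*}

/-- The positions of the errors; `hammingNorm y` is its cardinality by definition. -/
def supp [Fintype ι] (y : ι → ZMod 2) : Finset ι := {j | y j ≠ 0}

/-- The checks in which the variable `j` takes part. -/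
def checksOf [Fintype ρ] (H : Matrix ρ ι (ZMod 2)) (j : ι) : Finset ρ := {c | H c j ≠ 0}

/-- The variables that take part in the check `c`. -/
def varsOf [Fintype ι] (H : Matrix ρ ι (ZMod 2)) (c : ρ) : Finset ι := {j | H c j ≠ 0}

/-- The checks with exactly one neighbour in `S`. -/
def uniqueChecks [Fintype ρ] (H : Matrix ρ ι (ZMod 2)) (S : Finset ι) : Finset ρ :=
  {c | #{j ∈ S | H c j ≠ 0} = 1}

/-- The checks violated by the error `y`, i.e. the support of its syndrome. -/
def unsat [Fintype ρ] [Fintype ι] (H : Matrix ρ ι (ZMod 2)) (y : ι → ZMod 2) : Finset ρ :=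
  {c | H.mulVec y c ≠ 0}

variable {H : Matrix ρ ι (ZMod 2)}

@[simp]
theorem mem_checksOf [Fintype ρ] {j : ι} {c : ρ} : c ∈ checksOf H j ↔ H c j ≠ 0 := by
  simp [checksOf]

theorem sum_card_checksOf_inter [Fintype ρ] [DecidableEq ρ] (S : Finset ι)
    (T : Finset ρ) :
    ∑ j ∈ S, #(checksOf H j ∩ T) = ∑ c ∈ T, #{j ∈ S | H c j ≠ 0} := by
  refine Eq.trans (sum_congr rfl fun j _ => congrArg card ?_)
    (sum_card_bipartiteAbove_eq_sum_card_bipartiteBelow (s := S) (t := T) fun j c => H c j ≠ 0)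
  ext c
  simp [bipartiteAbove, and_comm]

theorem sum_card_checksOf_inter_uniqueChecks [Fintype ρ] [DecidableEq ρ] (S : Finset ι) :
    ∑ j ∈ S, #(checksOf H j ∩ uniqueChecks H S) = #(uniqueChecks H S) := by
  rw [sum_card_checksOf_inter, card_eq_sum_ones]
  exact sum_congr rfl fun c hc => (mem_filter.1 hc).2

theorem two_mul_card_biUnion_checksOf_le [Fintype ρ] [DecidableEq ρ] (S : Finset ι) :
    2 * #(S.biUnion (checksOf H)) ≤ ∑ j ∈ S, #(checksOf H j) + #(uniqueChecks H S) := by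
  have hbiUnion : S.biUnion (checksOf H) = ({c | 0 < #{j ∈ S | H c j ≠ 0}} : Finset ρ) := by
    ext c
    simp [card_pos, Finset.Nonempty]
  have hedges : ∑ j ∈ S, #(checksOf H j) = ∑ c, #{j ∈ S | H c j ≠ 0} := by
    simpa using sum_card_checksOf_inter (H := H) S univ
  rw [hbiUnion, hedges, card_filter, uniqueChecks, card_filter, mul_sum, ← sum_add_distrib]
  refine sum_le_sum fun c _ => ?_
  split_ifs <;> omega

variable [Fintype ι]

@[simp]
theorem mem_supp {y : ι → ZMod 2} {j : ι} : j ∈ supp y ↔ y j ≠ 0 := by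
  simp [supp]

@[simp]
theorem mem_varsOf {j : ι} {c : ρ} : j ∈ varsOf H c ↔ H c j ≠ 0 := by
  simp [varsOf]

theorem mulVec_eq_sum_varsOf (y : ι → ZMod 2) (c : ρ) : H.mulVec y c = ∑ j ∈ varsOf H c, y j := by
  rw [varsOf, sum_filter, Matrix.mulVec, dotProduct]
  refine sum_congr rfl fun j _ => ?_
  rcases zmod_two_cases (H c j) with h | h <;> simp [h]

theorem mulVec_eq_card (y : ι → ZMod 2) (c : ρ) :
    H.mulVec y c = (#{j ∈ supp y | H c j ≠ 0} : ZMod 2) := by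
  rw [mulVec_eq_sum_varsOf, card_filter, Nat.cast_sum, supp, varsOf, sum_filter, sum_filter]
  refine sum_congr rfl fun j _ => ?_
  rcases zmod_two_cases (H c j) with h | h <;> rcases zmod_two_cases (y j) with hy | hy <;>
    simp [h, hy]

theorem mulVec_add_single [DecidableEq ι] (y : ι → ZMod 2) (j : ι) (c : ρ) :
    H.mulVec (y + Pi.single j 1) c = H.mulVec y c + H c j := by
  rw [Matrix.mulVec_add, Pi.add_apply, Matrix.mulVec_single_one, Matrix.col_apply]

theorem hammingNorm_flip_le [DecidableEq ι] (y : ι → ZMod 2) (j : ι) :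
    hammingNorm (y + Pi.single j 1) ≤ hammingNorm y + 1 := by
  refine (card_le_card (t := insert j (supp y)) fun i hi => ?_).trans (card_insert_le _ _)
  by_cases h : i = j
  · exact mem_insert.2 (Or.inl h)
  · simpa [h] using hi

variable [Fintype ρ]

@[simp]
theorem mem_unsat {y : ι → ZMod 2} {c : ρ} : c ∈ unsat H y ↔ H.mulVec y c ≠ 0 := by
  simp [unsat]

theorem uniqueChecks_subset_unsat (y : ι → ZMod 2) : uniqueChecks H (supp y) ⊆ unsat H y := by
  intro c hc
  rw [mem_unsat, mulVec_eq_card, (mem_filter.1 hc).2, Nat.cast_one]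
  exact one_ne_zero

variable [DecidableEq ρ]

/-- The number of violated checks in which the variable `j` takes part. -/
def unsatDeg (H : Matrix ρ ι (ZMod 2)) (y : ι → ZMod 2) (j : ι) : ℕ := #(checksOf H j ∩ unsat H y)

theorem unsatDeg_le_card_unsat (y : ι → ZMod 2) (j : ι) : unsatDeg H y j ≤ #(unsat H y) :=
  card_le_card inter_subset_right

theorem unsatDeg_flip_of_disjoint [DecidableEq ι] {y : ι → ZMod 2} {i j : ι}
    (h : Disjoint (checksOf H i) (checksOf H j)) :
    unsatDeg H (y + Pi.single j 1) i = unsatDeg H y i := by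
  unfold unsatDeg
  congr 1
  ext c
  simp only [mem_inter, mem_unsat, mulVec_add_single]
  refine and_congr_right fun hc => ?_
  have hcj : H c j = 0 := by simpa using disjoint_left.1 h hc
  rw [hcj, add_zero]

theorem unsat_subset_biUnion (y : ι → ZMod 2) : unsat H y ⊆ (supp y).biUnion (checksOf H) := by
  intro c hc
  rw [mem_unsat, mulVec_eq_card] at hc
  obtain ⟨j, hj⟩ : Finset.Nonempty {j ∈ supp y | H c j ≠ 0} := by
    rw [nonempty_iff_ne_empty]
    intro h
    simp [h] at hc
  obtain ⟨hjy, hcj⟩ := mem_filter.1 hj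
  exact mem_biUnion.2 ⟨j, hjy, mem_checksOf.2 hcj⟩

theorem unsat_flip_subset [DecidableEq ι] (y : ι → ZMod 2) (j : ι) :
    unsat H (y + Pi.single j 1) ⊆ (unsat H y \ checksOf H j) ∪ (checksOf H j \ unsat H y) := by
  intro c
  simp only [mem_unsat, mem_union, mem_sdiff, mem_checksOf, mulVec_add_single]
  generalize H.mulVec y c = a
  generalize H c j = b
  revert a b
  decide

theorem card_unsat_flip_lt [DecidableEq ι] {D : ℕ} {y : ι → ZMod 2} {j : ι}
    (hdeg : #(checksOf H j) ≤ D) (hj : D < 2 * unsatDeg H y j) :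
    #(unsat H (y + Pi.single j 1)) < #(unsat H y) := by
  have hflip := (card_le_card (unsat_flip_subset (H := H) y j)).trans (card_union_le _ _)
  have hold := card_sdiff_add_card_inter (unsat H y) (checksOf H j)
  have hnew := card_sdiff_add_card_inter (checksOf H j) (unsat H y)
  rw [inter_comm] at hold
  unfold unsatDeg at hj
  omega

end TannerGraph

/-- The Tanner graph of `H` has left degrees at most `D`, and every set `S` of at most `e` variables
has at least `β D |S|` neighbouring checks. -/
structure Expands {ρ ι : Type*} [Fintype ρ] [Fintype ι] [DecidableEq ρ] (H : Matrix ρ ι (ZMod 2))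
    (D : ℕ) (β : ℝ) (e : ℕ) : Prop where
  card_checksOf_le : ∀ j, #(checksOf H j) ≤ D
  le_card_biUnion : ∀ S : Finset ι, #S ≤ e → β * D * #S ≤ #(S.biUnion (checksOf H))

namespace Expands

variable {ρ ι : Type*} [Fintype ρ] [Fintype ι] [DecidableEq ρ] {H : Matrix ρ ι (ZMod 2)}
  {D e : ℕ} {β : ℝ} {y : ι → ZMod 2}

theorem card_biUnion_le (hH : Expands H D β e) (S : Finset ι) :
    #(S.biUnion (checksOf H)) ≤ D * #S := by
  rw [mul_comm]
  exact card_biUnion_le_card_mul _ _ _ fun j _ => hH.card_checksOf_le j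

theorem card_unsat_le (hH : Expands H D β e) (y : ι → ZMod 2) :
    #(unsat H y) ≤ D * hammingNorm y :=
  (card_le_card (unsat_subset_biUnion y)).trans (hH.card_biUnion_le _)

theorem le_card_uniqueChecks (hH : Expands H D β e) {S : Finset ι} (hS : #S ≤ e) :
    (2 * β - 1) * D * #S ≤ #(uniqueChecks H S) := by
  have hexp := hH.le_card_biUnion S hS
  have hunique : (2 * #(S.biUnion (checksOf H)) : ℝ) ≤ D * #S + #(uniqueChecks H S) := by
    have hedges : ∑ j ∈ S, #(checksOf H j) ≤ #S • D :=
      sum_le_card_nsmul _ _ _ fun j _ => hH.card_checksOf_le j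
    rw [smul_eq_mul, mul_comm] at hedges
    exact_mod_cast (two_mul_card_biUnion_checksOf_le S).trans (by gcongr)
  linarith

theorem le_card_unsat (hH : Expands H D β e) (hy : hammingNorm y ≤ e) :
    (2 * β - 1) * D * hammingNorm y ≤ #(unsat H y) :=
  (hH.le_card_uniqueChecks hy).trans
    (Nat.cast_le.2 (card_le_card (uniqueChecks_subset_unsat y)))

theorem lt_hammingNorm (hH : Expands H D β e) (hD : 0 < D) (hβ : 1 / 2 < β)
    (hy : y ∈ codeOf H) (hy0 : y ≠ 0) : e < hammingNorm y := by
  by_contra! hye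
  have hlow := hH.le_card_unsat hye
  have hunsat : unsat H y = ∅ := by
    have : H.mulVec y = 0 := hy
    simp [unsat, this]
  have hnorm : (0 : ℝ) < hammingNorm y := by exact_mod_cast hammingNorm_pos_iff.2 hy0
  have hD' : (0 : ℝ) < D := by exact_mod_cast hD
  rw [hunsat, card_empty, Nat.cast_zero] at hlow
  exact hlow.not_gt (by have : 0 < 2 * β - 1 := by linarith
                        positivity)

theorem card_stuck_le (hH : Expands H D β e) (hD : 0 < D) (hy : hammingNorm y ≤ e) :
    (#{j ∈ supp y | ¬ D < 2 * unsatDeg H y j} : ℝ) ≤ 4 * (1 - β) * hammingNorm y := by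
  set flipped := {j ∈ supp y | D < 2 * unsatDeg H y j}
  set stuck := {j ∈ supp y | ¬ D < 2 * unsatDeg H y j}
  have hcard : (#flipped + #stuck : ℝ) = hammingNorm y := by
    exact_mod_cast card_filter_add_card_filter_not (s := supp y) _
  have hunique : #(uniqueChecks H (supp y)) =
      ∑ j ∈ flipped, #(checksOf H j ∩ uniqueChecks H (supp y)) +
        ∑ j ∈ stuck, #(checksOf H j ∩ uniqueChecks H (supp y)) := by
    rw [sum_filter_add_sum_filter_not, sum_card_checksOf_inter_uniqueChecks]
  have hflipped : ∑ j ∈ flipped, #(checksOf H j ∩ uniqueChecks H (supp y)) ≤ #flipped • D :=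
    sum_le_card_nsmul _ _ _ fun j _ =>
      (card_le_card inter_subset_left).trans (hH.card_checksOf_le j)
  have hstuck : 2 * ∑ j ∈ stuck, #(checksOf H j ∩ uniqueChecks H (supp y)) ≤ #stuck • D := by
    rw [mul_sum]
    refine sum_le_card_nsmul _ _ _ fun j hj => le_trans ?_ (not_lt.1 (mem_filter.1 hj).2)
    gcongr
    exact card_le_card (inter_subset_inter_left (uniqueChecks_subset_unsat y))
  have hD' : (0 : ℝ) < D := by exact_mod_cast hD
  have hlow : (2 * β - 1) * D * hammingNorm y ≤ #(uniqueChecks H (supp y)) :=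
    hH.le_card_uniqueChecks hy
  rify [smul_eq_mul] at hflipped hstuck hunique
  refine le_of_mul_le_mul_left (a := (D : ℝ)) ?_ hD'
  have hedges : (#flipped + #stuck : ℝ) * D = hammingNorm y * D := by rw [hcard]
  linarith

theorem exists_flippable (hH : Expands H D β e) (hD : 0 < D) (hβ : 3 / 4 < β)
    (hy : hammingNorm y ≤ e) (hy0 : y ≠ 0) : ∃ j, D < 2 * unsatDeg H y j := by
  by_contra! h
  have hstuck := hH.card_stuck_le hD hy
  rw [filter_true_of_mem fun j _ => (h j).not_gt] at hstuck
  change (hammingNorm y : ℝ) ≤ _ at hstuck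
  have hnorm : (0 : ℝ) < hammingNorm y := by exact_mod_cast hammingNorm_pos_iff.2 hy0
  nlinarith

/-- The number of violated checks never grows and controls the weight, so sequential bit flipping
stays within the radius of expansion. -/
theorem flip_invariant [DecidableEq ι] (hH : Expands H D β e) (hβ : 3 / 4 < β)
    {t : ℕ} (ht : 2 * t ≤ e) {j : ι} (hy : hammingNorm y ≤ 2 * t) (hunsat : #(unsat H y) ≤ D * t)
    (hj : D < 2 * unsatDeg H y j) :
    hammingNorm (y + Pi.single j 1) ≤ 2 * t ∧ #(unsat H (y + Pi.single j 1)) ≤ D * t := by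
  have hlow := hH.le_card_unsat (hy.trans ht)
  have hD : 0 < D * t := by
    have := unsatDeg_le_card_unsat (H := H) y j
    omega
  have ht0 : (0 : ℝ) < t := by exact_mod_cast Nat.pos_of_mul_pos_left hD
  have hD0 : (0 : ℝ) < D := by exact_mod_cast Nat.pos_of_mul_pos_right hD
  have hlt : hammingNorm y < 2 * t := by
    have hup : (#(unsat H y) : ℝ) ≤ D * t := by exact_mod_cast hunsat
    have hweight : (2 * β - 1) * hammingNorm y ≤ t := by
      refine le_of_mul_le_mul_left (a := (D : ℝ)) ?_ hD0
      linarith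
    have : (hammingNorm y : ℝ) < 2 * t := by nlinarith
    exact_mod_cast this
  exact ⟨(hammingNorm_flip_le y j).trans hlt,
    ((card_unsat_flip_lt (hH.card_checksOf_le j) hj).le).trans hunsat⟩

theorem card_new_le (hH : Expands H D β e) (hD : 0 < D) {C : Finset ι}
    (hC : ∀ j ∈ C, j ∉ supp y ∧ D < 2 * unsatDeg H y j) (hCe : hammingNorm y + #C ≤ e) :
    (β - 1 / 2) * #C ≤ (1 - β) * hammingNorm y := by
  classical
  have hdisj : Disjoint (supp y) C := disjoint_right.2 fun j hj => (hC j hj).1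
  have hlow := hH.le_card_biUnion (supp y ∪ C) ((card_union_of_disjoint hdisj).trans_le hCe)
  rw [card_union_of_disjoint hdisj] at hlow
  have hsub : (supp y ∪ C).biUnion (checksOf H) ⊆
      (supp y).biUnion (checksOf H) ∪ C.biUnion fun j => checksOf H j \ unsat H y := by
    intro c hc
    obtain ⟨j, hj, hcj⟩ := mem_biUnion.1 hc
    rcases mem_union.1 hj with hj | hj
    · exact mem_union_left _ (mem_biUnion.2 ⟨j, hj, hcj⟩)
    · by_cases hu : c ∈ unsat H y
      · exact mem_union_left _ (unsat_subset_biUnion y hu)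
      · exact mem_union_right _ (mem_biUnion.2 ⟨j, hj, mem_sdiff.2 ⟨hcj, hu⟩⟩)
  have hsat : 2 * ∑ j ∈ C, #(checksOf H j \ unsat H y) ≤ #C • D := by
    rw [mul_sum]
    refine sum_le_card_nsmul _ _ _ fun j hj => ?_
    have hsplit := card_sdiff_add_card_inter (checksOf H j) (unsat H y)
    have hdeg := hH.card_checksOf_le j
    have hflip := (hC j hj).2
    unfold unsatDeg at hflip
    omega
  have hup : 2 * #((supp y ∪ C).biUnion (checksOf H)) ≤ 2 * (D * hammingNorm y) + #C * D := by
    have hold := hH.card_biUnion_le (supp y)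
    have hunion := (card_le_card hsub).trans (card_union_le _ _)
    have hnew := Finset.card_biUnion_le (s := C) (t := fun j => checksOf H j \ unsat H y)
    change _ ≤ D * hammingNorm y at hold
    rw [smul_eq_mul] at hsat
    omega
  have hD' : (0 : ℝ) < D := by exact_mod_cast hD
  rify at hup hlow
  change β * D * (hammingNorm y + #C) ≤ _ at hlow
  refine le_of_mul_le_mul_left (a := (D : ℝ)) ?_ hD'
  linarith

end Expands

section ParallelFlipping

variable {ρ ι : Type*} [Fintype ρ] [Fintype ι] [DecidableEq ρ] {H : Matrix ρ ι (ZMod 2)}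
  {D e : ℕ} {β : ℝ} {y : ι → ZMod 2}

/-- One round of parallel bit flipping: all variables for which more than `D / 2` checks are
violated are flipped. -/
def flipAll (H : Matrix ρ ι (ZMod 2)) (D : ℕ) (y : ι → ZMod 2) : ι → ZMod 2 :=
  fun j => y j + if D < 2 * unsatDeg H y j then 1 else 0

theorem supp_flipAll_subset [DecidableEq ι] : supp (flipAll H D y) ⊆
    {j ∈ supp y | ¬ D < 2 * unsatDeg H y j} ∪
      ({j | j ∉ supp y ∧ D < 2 * unsatDeg H y j} : Finset ι) := by
  intro j hj
  rw [mem_supp, flipAll] at hj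
  by_cases h : D < 2 * unsatDeg H y j
  · rw [if_pos h] at hj
    rcases zmod_two_cases (y j) with hy | hy
    · simp [h, hy]
    · rw [hy] at hj
      exact absurd (by decide) hj
  · rw [if_neg h, add_zero] at hj
    simp [not_lt.1 h, hj]

theorem Expands.card_flipped_correct_le [DecidableEq ι] (hH : Expands H D β e) (hD : 0 < D)
    (hβ : 3 / 4 < β) (hy : 2 * hammingNorm y ≤ e) :
    (β - 1 / 2) * #{j | j ∉ supp y ∧ D < 2 * unsatDeg H y j} ≤ (1 - β) * hammingNorm y := by
  set C : Finset ι := {j | j ∉ supp y ∧ D < 2 * unsatDeg H y j}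
  have hC : ∀ j ∈ C, j ∉ supp y ∧ D < 2 * unsatDeg H y j := fun j hj => (mem_filter.1 hj).2
  rcases le_total #C (hammingNorm y) with hle | hle
  · exact hH.card_new_le hD hC (by omega)
  · obtain ⟨C', hC', hcard⟩ := exists_subset_card_eq hle
    have hnew := hH.card_new_le hD (fun j hj => hC j (hC' hj)) (by omega)
    have hy0 : hammingNorm y = 0 := by
      by_contra h
      have : (0 : ℝ) < hammingNorm y := by exact_mod_cast Nat.pos_of_ne_zero h
      rw [hcard] at hnew
      nlinarith
    have hempty : C = ∅ := eq_empty_of_forall_notMem fun j hj => by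
      have hunsat := hH.card_unsat_le y
      have hflip := (hC j hj).2
      have := unsatDeg_le_card_unsat (H := H) y j
      rw [hy0, mul_zero] at hunsat
      omega
    simp [hempty, hy0]

theorem Expands.two_mul_hammingNorm_flipAll_le (hH : Expands H D β e) (hD : 0 < D)
    (hβ : 15 / 16 ≤ β) (hy : 2 * hammingNorm y ≤ e) :
    2 * hammingNorm (flipAll H D y) ≤ hammingNorm y := by
  classical
  have hcard : (hammingNorm (flipAll H D y) : ℝ) ≤
      #{j ∈ supp y | ¬ D < 2 * unsatDeg H y j} +
        #{j | j ∉ supp y ∧ D < 2 * unsatDeg H y j} := by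
    exact_mod_cast (card_le_card (supp_flipAll_subset (H := H) (D := D) (y := y))).trans
      (card_union_le _ _)
  have hstuck := hH.card_stuck_le hD (y := y) (by omega)
  have hnew := hH.card_flipped_correct_le hD (by linarith) hy
  have hweight := mul_nonneg (sub_nonneg.2 hβ) (Nat.cast_nonneg (α := ℝ) (hammingNorm y))
  have hnewβ := mul_nonneg (sub_nonneg.2 hβ)
    (Nat.cast_nonneg (α := ℝ) #{j | j ∉ supp y ∧ D < 2 * unsatDeg H y j})
  have : (2 * hammingNorm (flipAll H D y) : ℝ) ≤ hammingNorm y := by linarith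
  exact_mod_cast this

theorem Expands.two_pow_mul_hammingNorm_iterate_flipAll_le (hH : Expands H D β e) (hD : 0 < D)
    (hβ : 15 / 16 ≤ β) (hy : 2 * hammingNorm y ≤ e) (r : ℕ) :
    2 ^ r * hammingNorm ((flipAll H D)^[r] y) ≤ hammingNorm y := by
  induction r with
  | zero => simp
  | succ r ih =>
    have hle : hammingNorm ((flipAll H D)^[r] y) ≤ hammingNorm y :=
      (Nat.le_mul_of_pos_left _ (by positivity)).trans ih
    rw [Function.iterate_succ_apply', pow_succ, mul_assoc]
    exact (Nat.mul_le_mul_left _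
      (hH.two_mul_hammingNorm_flipAll_le hD hβ (by omega))).trans ih

theorem Expands.iterate_flipAll_eq_zero (hH : Expands H D β e) (hD : 0 < D) (hβ : 15 / 16 ≤ β)
    (hy : 2 * hammingNorm y ≤ e) {r : ℕ} (hr : Fintype.card ι < 2 ^ r) :
    (flipAll H D)^[r] y = 0 := by
  have hdecay := hH.two_pow_mul_hammingNorm_iterate_flipAll_le hD hβ hy r
  have hnorm : hammingNorm y ≤ Fintype.card ι := hammingNorm_le_card_fintype
  by_contra h
  have := Nat.le_mul_of_pos_right (2 ^ r) (hammingNorm_pos_iff.2 h)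
  omega

end ParallelFlipping

/-! ### The partially concatenated code -/

section Concatenated

variable {m B n : ℕ}

/-- The sums of the entries of the blocks; a `Z`-error acts on the code through these alone. -/
def blockParity (v : Fin B × Fin n → ZMod 2) : Fin B → ZMod 2 := fun b => ∑ j, v (b, j)

/-- The encoder of the inner code, which repeats every entry `n` times. -/
def rep (n : ℕ) : (Fin B → ZMod 2) →ₗ[ZMod 2] (Fin B × Fin n → ZMod 2) :=
  LinearMap.funLeft (ZMod 2) (ZMod 2) Prod.fst

theorem rep_apply (x : Fin B → ZMod 2) (q : Fin B × Fin n) : rep n x q = x q.1 := rfl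

theorem pcX_eq_rep (H : Matrix (Fin m) (Fin B) (ZMod 2)) (i : Fin m) :
    pcX n H i = rep n (H i) := by
  ext q
  simp [pcX, innerGen, Matrix.mul_apply, Matrix.one_apply, repGen, rep_apply]

theorem rep_dotProduct (x : Fin B → ZMod 2) (v : Fin B × Fin n → ZMod 2) :
    rep n x ⬝ᵥ v = x ⬝ᵥ blockParity v := by
  simp only [dotProduct, blockParity, Fintype.sum_prod_type, mul_sum, rep_apply]

theorem pcX_mulVec (H : Matrix (Fin m) (Fin B) (ZMod 2)) (v : Fin B × Fin n → ZMod 2) :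
    (pcX n H).mulVec v = H.mulVec (blockParity v) := by
  ext i
  rw [Matrix.mulVec, pcX_eq_rep, rep_dotProduct, Matrix.mulVec]

theorem innerCheck_mulVec (hn : 0 < n) (v : Fin B × Fin n → ZMod 2) (b : Fin B)
    (i : Fin (n - 1)) : (innerCheck B n).mulVec v (b, i) =
      v (b, Fin.castLE (Nat.sub_le n 1) i) + v (b, ⟨n - 1, Nat.sub_lt hn one_pos⟩) := by
  have hrow : ∀ j : Fin n, repCheck n i j * v (b, j) =
      (if j = Fin.castLE (Nat.sub_le n 1) i then v (b, j) else 0) +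
        if j = ⟨n - 1, Nat.sub_lt hn one_pos⟩ then v (b, j) else 0 := by
    intro j
    simp only [repCheck, Matrix.of_apply, ite_mul, one_mul, zero_mul, Fin.ext_iff,
      Fin.val_castLE]
    have := i.isLt
    split_ifs <;> first | omega | simp
  rw [Matrix.mulVec, dotProduct, Fintype.sum_prod_type]
  simp only [innerCheck, Matrix.kroneckerMap_apply, Matrix.one_apply, ite_mul, one_mul, zero_mul]
  rw [sum_eq_single b]
  · simp only [if_true, hrow, sum_add_distrib, sum_ite_eq', mem_univ]
  · intro b' _ hb'
    simp [hb'.symm]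
  · simp

theorem mem_codeOf_iff {ρ ι : Type*} [Fintype ι] {H : Matrix ρ ι (ZMod 2)} {v : ι → ZMod 2} :
    v ∈ codeOf H ↔ ∀ i, H.mulVec v i = 0 := by
  rw [codeOf, LinearMap.mem_ker, Matrix.mulVecLin_apply, funext_iff]
  rfl

theorem mem_codeOf_innerCheck {v : Fin B × Fin n → ZMod 2} :
    v ∈ codeOf (innerCheck B n) ↔ ∀ b j j', v (b, j) = v (b, j') := by
  rw [mem_codeOf_iff]
  constructor
  · intro hcheck b j j'
    have hn : 0 < n := j.pos
    have hlast : ∀ j : Fin n, v (b, j) = v (b, ⟨n - 1, Nat.sub_lt hn one_pos⟩) := by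
      intro j
      by_cases hj : j.val < n - 1
      · have hbj := hcheck (b, ⟨j, hj⟩)
        rw [innerCheck_mulVec hn] at hbj
        exact CharTwo.add_eq_zero.1 hbj
      · congr 2
        exact Fin.ext (by simp only; omega)
    rw [hlast j, hlast j']
  · rintro hconst ⟨b, i⟩
    have hn : 0 < n := i.pos.trans_le (Nat.sub_le _ _)
    rw [innerCheck_mulVec hn, hconst b _ ⟨n - 1, Nat.sub_lt hn one_pos⟩,
      CharTwo.add_self_eq_zero]

theorem rep_mem_codeOf_innerCheck (x : Fin B → ZMod 2) : rep n x ∈ codeOf (innerCheck B n) :=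
  mem_codeOf_innerCheck.2 fun _ _ _ => rfl

theorem exists_rep_eq (hn : 0 < n) {v : Fin B × Fin n → ZMod 2}
    (hv : v ∈ codeOf (innerCheck B n)) : ∃ x, rep n x = v :=
  ⟨fun b => v (b, ⟨0, hn⟩), funext fun _ => mem_codeOf_innerCheck.1 hv _ _ _⟩

theorem mem_dualCode_innerCheck (hn : 0 < n) {v : Fin B × Fin n → ZMod 2} :
    v ∈ dualCode (codeOf (innerCheck B n)) ↔ blockParity v = 0 := by
  constructor
  · intro h
    ext b
    have hb := h _ (rep_mem_codeOf_innerCheck (Pi.single b 1))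
    rwa [rep_dotProduct, single_dotProduct, one_mul] at hb
  · intro h w hw
    obtain ⟨x, rfl⟩ := exists_rep_eq hn hw
    rw [rep_dotProduct, h, dotProduct_zero]

theorem mem_codeOf_pcX {H : Matrix (Fin m) (Fin B) (ZMod 2)} {v : Fin B × Fin n → ZMod 2} :
    v ∈ codeOf (pcX n H) ↔ blockParity v ∈ codeOf H := by
  simp only [codeOf, LinearMap.mem_ker, Matrix.mulVecLin_apply, pcX_mulVec]

theorem pcX_mul_transpose_innerCheck (H : Matrix (Fin m) (Fin B) (ZMod 2)) :
    pcX n H * (innerCheck B n).transpose = 0 := by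
  ext i q
  have hrow : pcX n H i ∈ codeOf (innerCheck B n) := by
    rw [pcX_eq_rep]
    exact rep_mem_codeOf_innerCheck (H i)
  rw [Matrix.mul_apply']
  exact (dotProduct_comm _ _).trans (mem_codeOf_iff.1 hrow q)

theorem blockParity_add (v w : Fin B × Fin n → ZMod 2) :
    blockParity (v + w) = blockParity v + blockParity w :=
  funext fun _ => sum_add_distrib

theorem hammingNorm_blockParity_le (v : Fin B × Fin n → ZMod 2) :
    hammingNorm (blockParity v) ≤ hammingNorm v := by
  refine (card_le_card (t := (supp v).image Prod.fst) ?_).trans card_image_le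
  intro b hb
  obtain ⟨j, -, hj⟩ := exists_ne_zero_of_sum_ne_zero (mem_filter.1 hb).2
  exact mem_image.2 ⟨(b, j), by simpa using hj, rfl⟩

/-- The vector with the block parities `x` that is supported on the first entries of the blocks. -/
def firstInBlock (hn : 0 < n) (x : Fin B → ZMod 2) : Fin B × Fin n → ZMod 2 :=
  fun q => if q.2 = ⟨0, hn⟩ then x q.1 else 0

theorem blockParity_firstInBlock (hn : 0 < n) (x : Fin B → ZMod 2) :
    blockParity (firstInBlock hn x) = x := by
  ext b
  simp [blockParity, firstInBlock]

theorem le_minWeightOutside_X {H : Matrix (Fin m) (Fin B) (ZMod 2)} (hn : 0 < n) {d : ℕ}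
    (hd : ∀ x ∈ codeOf H, x ≠ 0 → d ≤ hammingNorm x) (hne : ∃ x ∈ codeOf H, x ≠ 0) :
    d ≤ minWeightOutside (codeOf (pcX n H)) (dualCode (codeOf (innerCheck B n))) := by
  refine le_csInf ?_ ?_
  · obtain ⟨x, hx, hx0⟩ := hne
    refine ⟨_, firstInBlock hn x, ?_, ?_, rfl⟩
    · rwa [mem_codeOf_pcX, blockParity_firstInBlock]
    · rwa [mem_dualCode_innerCheck hn, blockParity_firstInBlock]
  · rintro _ ⟨v, hv, hv', rfl⟩
    rw [mem_dualCode_innerCheck hn] at hv'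
    exact (hd _ (mem_codeOf_pcX.1 hv) hv').trans (hammingNorm_blockParity_le v)

theorem le_minWeightOutside_Z {H : Matrix (Fin m) (Fin B) (ZMod 2)} (hn : 0 < n)
    (hne : ∃ x ∈ codeOf H, x ≠ 0) :
    n ≤ minWeightOutside (codeOf (innerCheck B n)) (dualCode (codeOf (pcX n H))) := by
  refine le_csInf ?_ ?_
  · obtain ⟨x, hx, hx0⟩ := hne
    obtain ⟨b, hb⟩ := Function.ne_iff.1 hx0
    refine ⟨_, rep n (Pi.single b 1), rep_mem_codeOf_innerCheck _, fun h => hb ?_, rfl⟩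
    have horth := h (firstInBlock hn x) (by rwa [mem_codeOf_pcX, blockParity_firstInBlock])
    rwa [dotProduct_comm, rep_dotProduct, blockParity_firstInBlock, single_dotProduct,
      one_mul] at horth
  · rintro _ ⟨v, hv, hv', rfl⟩
    have hv0 : v ≠ 0 := by
      rintro rfl
      exact hv' (Submodule.zero_mem _)
    obtain ⟨⟨b, j⟩, hb⟩ := Function.ne_iff.1 hv0
    calc n = #(univ.image fun j : Fin n => (b, j)) := by
          rw [card_image_of_injective _ (Prod.mk_right_injective b), card_fin]
      _ ≤ #(supp v) := by
          refine card_le_card fun q hq => ?_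
          obtain ⟨j', -, rfl⟩ := mem_image.1 hq
          rwa [mem_supp, mem_codeOf_innerCheck.1 hv b j' j]

end Concatenated

/-! ### Systematic generators of a linear code -/

section Systematic

variable {K ι : Type*} [Field K] [DecidableEq ι] {R : Submodule K (ι → K)} {P : Finset ι}
  {g : ι → ι → K}

/-- `P` is an information set of the linear code `R`, and the words `g p` with `p ∈ P` are the rows
of the generator matrix of `R` that is the identity on the columns in `P`. -/
structure IsSystematic (R : Submodule K (ι → K)) (P : Finset ι) (g : ι → ι → K) : Prop where
  mem : ∀ p ∈ P, g p ∈ R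
  apply_eq : ∀ p ∈ P, ∀ p' ∈ P, g p p' = if p = p' then 1 else 0
  eq_sum : ∀ r ∈ R, r = ∑ p ∈ P, r p • g p

theorem sum_smul_apply_of_eq_ite (hg : ∀ p ∈ P, ∀ p' ∈ P, g p p' = if p = p' then 1 else 0)
    (x : ι → K) {p' : ι} (hp' : p' ∈ P) : (∑ p ∈ P, x p • g p) p' = x p' := by
  rw [Finset.sum_apply, sum_congr rfl fun p hp => by rw [Pi.smul_apply, hg p hp p' hp']]
  simp [hp']

theorem IsSystematic.finrank_eq_card (hg : IsSystematic R P g) : Module.finrank K R = #P := by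
  let restrict : R →ₗ[K] (P → K) := LinearMap.funLeft K K Subtype.val ∘ₗ R.subtype
  have hinj : Function.Injective restrict := by
    intro r r' h
    apply Subtype.ext
    rw [hg.eq_sum r r.2, hg.eq_sum r' r'.2]
    refine sum_congr rfl fun p hp => ?_
    rw [show r.val p = r'.val p from congrFun h ⟨p, hp⟩]
  have hsurj : Function.Surjective restrict := by
    intro y
    let x : ι → K := fun p => if hp : p ∈ P then y ⟨p, hp⟩ else 0
    refine ⟨⟨∑ p ∈ P, x p • g p, Submodule.sum_mem _ fun p hp =>
      Submodule.smul_mem _ _ (hg.mem p hp)⟩, ?_⟩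
    funext p
    exact (sum_smul_apply_of_eq_ite hg.apply_eq x p.2).trans (dif_pos p.2)
  rw [(LinearEquiv.ofBijective restrict ⟨hinj, hsurj⟩).finrank_eq,
    Module.finrank_fintype_fun_eq_card, Fintype.card_coe]

/-- A minimal set of coordinates that determine the words of `R` is an information set. -/
theorem exists_isSystematic [Finite ι] (R : Submodule K (ι → K)) :
    ∃ P g, IsSystematic R P g := by
  classical
  have := Fintype.ofFinite ι
  let Determines (P : Finset ι) : Prop := ∀ r ∈ R, (∀ p ∈ P, r p = 0) → r = 0
  obtain ⟨P, hP, hmin⟩ := exists_min_image ({P | Determines P} : Finset (Finset ι)) card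
    ⟨univ, mem_filter.2 ⟨mem_univ _, fun r _ h => funext fun p => h p (mem_univ p)⟩⟩
  replace hP : Determines P := (mem_filter.1 hP).2
  have hrow : ∀ p ∈ P, ∃ r ∈ R, ∀ p' ∈ P, r p' = if p = p' then 1 else 0 := by
    intro p hp
    have herase : ¬ Determines (P.erase p) := fun h =>
      (card_erase_lt_of_mem hp).not_ge (hmin _ (mem_filter.2 ⟨mem_univ _, h⟩))
    obtain ⟨r, hr, hzero, hr0⟩ :
        ∃ r ∈ R, (∀ p' ∈ P.erase p, r p' = 0) ∧ r ≠ 0 := by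
      by_contra! h
      exact herase h
    have hrp : r p ≠ 0 := fun hrp => hr0 (hP r hr fun p' hp' => by
      by_cases h : p' = p
      · rw [h, hrp]
      · exact hzero p' (mem_erase.2 ⟨h, hp'⟩))
    refine ⟨(r p)⁻¹ • r, R.smul_mem _ hr, fun p' hp' => ?_⟩
    split_ifs with h
    · rw [← h, Pi.smul_apply, smul_eq_mul, inv_mul_cancel₀ hrp]
    · rw [Pi.smul_apply, hzero p' (mem_erase.2 ⟨Ne.symm h, hp'⟩), smul_zero]
  choose! g hg hδ using hrow
  refine ⟨P, g, hg, hδ, fun r hr => sub_eq_zero.1 ?_⟩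
  refine hP _ (R.sub_mem hr (R.sum_mem fun p hp => R.smul_mem _ (hg p hp))) fun p' hp' => ?_
  rw [Pi.sub_apply, sum_smul_apply_of_eq_ite hδ r hp', sub_self]

end Systematic

section Rank

variable {ρ ι : Type*} [Fintype ι] (H : Matrix ρ ι (ZMod 2))

theorem rank_add_finrank_codeOf :
    H.rank + Module.finrank (ZMod 2) (codeOf H) = Fintype.card ι := by
  rw [← Module.finrank_fintype_fun_eq_card (ZMod 2)]
  exact LinearMap.finrank_range_add_finrank_ker H.mulVecLin

theorem card_le_finrank_codeOf_add_card [Fintype ρ] :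
    Fintype.card ι ≤ Module.finrank (ZMod 2) (codeOf H) + Fintype.card ρ := by
  have hadd := rank_add_finrank_codeOf H
  have hle := H.rank_le_card_height
  omega

variable {H}

theorem IsSystematic.finrank_codeOf [Finite ρ] [DecidableEq ι] {P : Finset ι} {g : ι → ι → ZMod 2}
    (hg : IsSystematic (Submodule.span (ZMod 2) (Set.range H.row)) P g) :
    Module.finrank (ZMod 2) (codeOf H) = #Pᶜ := by
  have hrank := hg.finrank_eq_card
  rw [← Matrix.rank_eq_finrank_span_row] at hrank
  have hadd := rank_add_finrank_codeOf H
  rw [card_compl]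
  omega

end Rank

/-! ### Circuits -/

section Circuits

variable {ι : Type*} [DecidableEq ι]

/-- The operator of a list of gates. -/
noncomputable def gatesOp (l : List (Gate ι)) : ((ι → ZMod 2) → ℂ) →ₗ[ℂ] ((ι → ZMod 2) → ℂ) :=
  l.foldl (fun U g => g.op ∘ₗ U) LinearMap.id

theorem foldl_gates_eq (l : List (Gate ι)) (V : ((ι → ZMod 2) → ℂ) →ₗ[ℂ] ((ι → ZMod 2) → ℂ)) :
    l.foldl (fun U g => g.op ∘ₗ U) V = gatesOp l ∘ₗ V := by
  induction l generalizing V with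
  | nil => rfl
  | cons g l ih =>
    rw [gatesOp, List.foldl_cons, List.foldl_cons, ih, ih (g.op ∘ₗ LinearMap.id),
      LinearMap.comp_id, LinearMap.comp_assoc]

theorem gatesOp_cons (g : Gate ι) (l : List (Gate ι)) :
    gatesOp (g :: l) = gatesOp l ∘ₗ g.op := by
  rw [gatesOp, List.foldl_cons, foldl_gates_eq, LinearMap.comp_id]

theorem gatesOp_append (l l' : List (Gate ι)) :
    gatesOp (l ++ l') = gatesOp l' ∘ₗ gatesOp l := by
  rw [gatesOp, List.foldl_append, foldl_gates_eq]
  rfl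

theorem had_had (i : ι) (ψ : (ι → ZMod 2) → ℂ) : (Gate.had i).op ((Gate.had i).op ψ) = ψ := by
  funext x
  have hsqrt : (((√2 : ℝ) : ℂ)⁻¹) * ((√2 : ℝ) : ℂ)⁻¹ = 1 / 2 := by
    rw [← mul_inv, ← Complex.ofReal_mul, Real.mul_self_sqrt (by norm_num)]
    norm_num
  have hx : ψ x = ψ (Function.update x i (x i)) := by rw [Function.update_eq_self]
  simp only [Gate.op, LinearMap.coe_mk, AddHom.coe_mk, Function.update_idem,
    Function.update_self, ZMod.val_zero, pow_zero, one_mul, ZMod.val_one, pow_one]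
  rw [hx]
  rcases zmod_two_cases (x i) with h | h <;>
    simp only [h, ZMod.val_zero, pow_zero, one_mul, ZMod.val_one, pow_one]
  · linear_combination (2 * ψ (Function.update x i 0)) * hsqrt
  · linear_combination (2 * ψ (Function.update x i 1)) * hsqrt

theorem gate_op_involutive (g : Gate ι) (ψ : (ι → ZMod 2) → ℂ) : g.op (g.op ψ) = ψ := by
  cases g with
  | had i => exact had_had i ψ
  | cnot i j h =>
    funext x
    simp only [Gate.op, LinearMap.coe_mk, AddHom.coe_mk, Function.update_self,
      Function.update_of_ne h, Function.update_idem]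
    rw [add_assoc, CharTwo.add_self_eq_zero, add_zero, Function.update_eq_self]

theorem gatesOp_injective (l : List (Gate ι)) : Function.Injective (gatesOp l) := by
  induction l with
  | nil => exact Function.injective_id
  | cons g l ih =>
    rw [gatesOp_cons, LinearMap.coe_comp]
    exact ih.comp (Function.LeftInverse.injective (gate_op_involutive g))

/-- The states stabilized by `X` on the qubits in `A` and by `Z` on the qubits in `Z`. -/
def xzSpace (A Z : Set ι) : Submodule ℂ ((ι → ZMod 2) → ℂ) where
  carrier := {ψ | (∀ a ∈ A, ∀ x, ψ (x + Pi.single a 1) = ψ x) ∧ ∀ z ∈ Z, ∀ x, x z ≠ 0 → ψ x = 0}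
  add_mem' := by
    rintro ψ φ ⟨hψX, hψZ⟩ ⟨hφX, hφZ⟩
    exact ⟨fun a ha x => by rw [Pi.add_apply, hψX a ha, hφX a ha]; rfl,
      fun z hz x hx => by rw [Pi.add_apply, hψZ z hz x hx, hφZ z hz x hx, add_zero]⟩
  zero_mem' := ⟨fun _ _ _ => rfl, fun _ _ _ _ => rfl⟩
  smul_mem' := by
    rintro r ψ ⟨hX, hZ⟩
    exact ⟨fun a ha x => by rw [Pi.smul_apply, hX a ha]; rfl,
      fun z hz x hx => by rw [Pi.smul_apply, hZ z hz x hx, smul_zero]⟩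

theorem inputSpace_eq_xzSpace {k : ℕ} (inp : Fin k ↪ ι) :
    inputSpace inp = xzSpace ∅ (Set.range inp)ᶜ := by
  ext ψ
  constructor
  · intro h
    exact ⟨fun a ha => absurd ha (Set.notMem_empty a), fun z hz x hx => h x ⟨z, hz, hx⟩⟩
  · rintro ⟨-, h⟩ x ⟨z, hz, hx⟩
    exact h z hz x hx

theorem update_add_single {a i : ι} (h : a ≠ i) (x : ι → ZMod 2) (v : ZMod 2) :
    Function.update (x + Pi.single a 1) i v = Function.update x i v + Pi.single a 1 := by
  funext j
  by_cases hj : j = i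
  · subst hj
    simp [Pi.single_eq_of_ne h.symm]
  · simp [hj]

theorem had_apply (i : ι) (ψ : (ι → ZMod 2) → ℂ) (x : ι → ZMod 2) :
    (Gate.had i).op ψ x = ((√2 : ℝ) : ℂ)⁻¹ *
      (ψ (Function.update x i 0) + (-1) ^ (x i).val * ψ (Function.update x i 1)) := rfl

theorem had_mem_of_mem_Z {A Z : Set ι} {i : ι} (hi : i ∈ Z) (hiA : i ∉ A)
    {ψ : (ι → ZMod 2) → ℂ} (hψ : ψ ∈ xzSpace A Z) :
    (Gate.had i).op ψ ∈ xzSpace (insert i A) (Z \ {i}) := by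
  have hop : ∀ x, (Gate.had i).op ψ x = ((√2 : ℝ) : ℂ)⁻¹ * ψ (Function.update x i 0) := by
    intro x
    rw [had_apply, hψ.2 i hi (Function.update x i 1) (by simp), mul_zero, add_zero]
  refine ⟨fun a ha x => ?_, fun z hz x hx => ?_⟩
  · rw [hop, hop]
    rcases ha with rfl | ha
    · congr 2
      funext j
      by_cases hj : j = a
      · subst hj
        simp
      · simp [hj]
    · have hai : a ≠ i := by
        rintro rfl
        exact hiA ha
      rw [update_add_single hai, hψ.1 a ha]
  · have hzi : z ≠ i := hz.2
    rw [hop, hψ.2 z hz.1 _ (by rwa [Function.update_of_ne hzi]), mul_zero]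

theorem had_mem_of_mem_X {A Z : Set ι} {i : ι} (hi : i ∈ A) (hiZ : i ∉ Z)
    {ψ : (ι → ZMod 2) → ℂ} (hψ : ψ ∈ xzSpace A Z) :
    (Gate.had i).op ψ ∈ xzSpace (A \ {i}) (insert i Z) := by
  have hflip : ∀ x, ψ (Function.update x i 1) = ψ (Function.update x i 0) := by
    intro x
    rw [← hψ.1 i hi (Function.update x i 0)]
    congr 1
    funext j
    by_cases hj : j = i
    · subst hj
      simp
    · simp [hj]
  refine ⟨fun a ha x => ?_, fun z hz x hx => ?_⟩
  · have hai : a ≠ i := ha.2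
    rw [had_apply, had_apply, update_add_single hai, update_add_single hai, hψ.1 a ha.1,
      hψ.1 a ha.1, Pi.add_apply, Pi.single_eq_of_ne hai.symm, add_zero]
  · rw [had_apply]
    rcases hz with rfl | hz
    · rw [hflip, (zmod_two_cases _).resolve_left hx, ZMod.val_one, pow_one]
      ring
    · have hzi : z ≠ i := by
        rintro rfl
        exact hiZ hz
      rw [hψ.2 z hz _ (by rwa [Function.update_of_ne hzi]),
        hψ.2 z hz _ (by rwa [Function.update_of_ne hzi])]
      simp

theorem map_had {A Z : Set ι} {i : ι} (hi : i ∈ Z) (hiA : i ∉ A) :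
    (xzSpace A Z).map (Gate.had i).op = xzSpace (insert i A) (Z \ {i}) := by
  apply le_antisymm
  · rintro _ ⟨ψ, hψ, rfl⟩
    exact had_mem_of_mem_Z hi hiA hψ
  · intro φ hφ
    have hmem := had_mem_of_mem_X (Set.mem_insert i A) (fun h => h.2 rfl) hφ
    rw [Set.insert_sdiff_of_mem _ (Set.mem_singleton i), Set.sdiff_singleton_eq_self hiA,
      Set.insert_sdiff_singleton, Set.insert_eq_of_mem hi] at hmem
    exact ⟨_, hmem, had_had i φ⟩

theorem map_hads (l : List ι) (hl : l.Nodup) {A Z : Set ι} (hlZ : ∀ i ∈ l, i ∈ Z)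
    (hlA : ∀ i ∈ l, i ∉ A) :
    (xzSpace A Z).map (gatesOp (l.map Gate.had)) = xzSpace (A ∪ {i | i ∈ l}) (Z \ {i | i ∈ l}) := by
  induction l generalizing A Z with
  | nil =>
    simp [gatesOp]
  | cons i l ih =>
    rw [List.map_cons, gatesOp_cons, Submodule.map_comp,
      map_had (hlZ i List.mem_cons_self) (hlA i List.mem_cons_self), ih (List.nodup_cons.1 hl).2]
    · congr 1
      · ext j
        simp only [Set.mem_union, Set.mem_insert_iff, Set.mem_ofPred_eq, List.mem_cons]
        tauto
      · ext j
        simp only [Set.mem_sdiff, Set.mem_singleton_iff, Set.mem_ofPred_eq, List.mem_cons]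
        tauto
    · intro j hj
      refine ⟨hlZ j (List.mem_cons_of_mem _ hj), ?_⟩
      rintro rfl
      exact (List.nodup_cons.1 hl).1 hj
    · rintro j hj (rfl | h)
      · exact (List.nodup_cons.1 hl).1 hj
      · exact hlA j (List.mem_cons_of_mem _ hj) h

/-- The C-NOT gate with control `p.1` and target `p.2`, if these are different. -/
def cnotList (p : ι × ι) : List (Gate ι) :=
  if h : p.1 ≠ p.2 then [Gate.cnot p.1 p.2 h] else []

theorem eq_cnot_of_mem_cnotList {p : ι × ι} {g : Gate ι} (hg : g ∈ cnotList p) :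
    ∃ hne, g = Gate.cnot p.1 p.2 hne := by
  unfold cnotList at hg
  split_ifs at hg with hne
  · exact ⟨hne, List.mem_singleton.1 hg⟩
  · exact absurd hg List.not_mem_nil

theorem length_cnotList_le_one (p : ι × ι) : (cnotList p).length ≤ 1 := by
  unfold cnotList
  split_ifs <;> simp

/-- Since no target is a control, the gates commute and every target receives the sum of the
original values of its controls. -/
theorem gatesOp_cnots (A : Set ι) (l : List (ι × ι)) (hl : ∀ p ∈ l, p.1 ∈ A ∧ p.2 ∉ A)
    (ψ : (ι → ZMod 2) → ℂ) (x : ι → ZMod 2) :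
    gatesOp (l.flatMap cnotList) ψ x =
      ψ fun t => x t + (l.map fun p => if p.2 = t then x p.1 else 0).sum := by
  induction l generalizing ψ with
  | nil => simp [gatesOp]
  | cons p l ih =>
    have hp := hl p List.mem_cons_self
    have hne : p.1 ≠ p.2 := fun h => hp.2 (h ▸ hp.1)
    have hl' : ∀ q ∈ l, q.1 ∈ A ∧ q.2 ∉ A := fun q hq => hl q (List.mem_cons_of_mem _ hq)
    have hzero : (l.map fun q => if q.2 = p.1 then x q.1 else 0).sum = 0 := by
      refine List.sum_eq_zero fun a ha => ?_
      obtain ⟨q, hq, rfl⟩ := List.mem_map.1 ha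
      exact if_neg fun h : q.2 = p.1 => (hl' q hq).2 (h ▸ hp.1)
    rw [List.flatMap_cons, gatesOp_append, LinearMap.comp_apply, ih hl']
    have hop : ∀ y, gatesOp (cnotList p) ψ y = ψ (Function.update y p.2 (y p.2 + y p.1)) := by
      intro y
      rw [cnotList, dif_pos hne]
      rfl
    rw [hop]
    congr 1
    funext t
    rw [List.map_cons, List.sum_cons, hzero, add_zero]
    by_cases ht : t = p.2
    · subst ht
      rw [Function.update_self, if_pos rfl]
      ring
    · rw [Function.update_of_ne ht, if_neg (fun h => ht h.symm), zero_add]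

/-- C-NOT gates for the given pairs `(control, target)`, the pair `p` being in layer `κ p`. -/
noncomputable def cnotLayers (pairs : Finset (ι × ι)) {w : ℕ} (κ : ι × ι → Fin w) :
    List (List (Gate ι)) :=
  (List.finRange w).map fun ℓ => ({p ∈ pairs | κ p = ℓ} : Finset (ι × ι)).toList.flatMap cnotList

theorem cnotLayers_disjoint {A : Set ι} {pairs : Finset (ι × ι)} {w : ℕ} {κ : ι × ι → Fin w}
    (hA : ∀ p ∈ pairs, p.1 ∈ A ∧ p.2 ∉ A)
    (hκ : ∀ p ∈ pairs, ∀ p' ∈ pairs, κ p = κ p' → p.1 = p'.1 ∨ p.2 = p'.2 → p = p') :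
    ∀ L ∈ cnotLayers pairs κ, L.Pairwise fun g h => Disjoint g.support h.support := by
  intro L hL
  obtain ⟨ℓ, -, rfl⟩ := List.mem_map.1 hL
  rw [List.pairwise_flatMap]
  refine ⟨fun p _ => ?_, ?_⟩
  · unfold cnotList
    split_ifs <;> simp
  · refine List.Pairwise.imp_of_mem ?_ (nodup_toList _)
    intro p p' hp hp' hne g hg g' hg'
    rw [mem_toList, mem_filter] at hp hp'
    obtain ⟨_, rfl⟩ := eq_cnot_of_mem_cnotList hg
    obtain ⟨_, rfl⟩ := eq_cnot_of_mem_cnotList hg'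
    have hlayer := hκ p hp.1 p' hp'.1 (hp.2.trans hp'.2.symm)
    have hcontrol : p'.1 ≠ p.1 := fun h => hne (hlayer (Or.inl h.symm))
    have htarget : p'.2 ≠ p.2 := fun h => hne (hlayer (Or.inr h.symm))
    have hcross : p'.2 ≠ p.1 := fun h => (hA p' hp'.1).2 (h ▸ (hA p hp.1).1)
    have hcross' : p'.1 ≠ p.2 := fun h => (hA p hp.1).2 (h ▸ (hA p' hp'.1).1)
    simp [Gate.support, hcontrol, htarget, hcross, hcross']

theorem length_cnotLayers (pairs : Finset (ι × ι)) {w : ℕ} (κ : ι × ι → Fin w) :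
    (cnotLayers pairs κ).length = w := by
  simp [cnotLayers]

theorem length_flatten_cnotLayers_le (pairs : Finset (ι × ι)) {w : ℕ} (κ : ι × ι → Fin w) :
    (cnotLayers pairs κ).flatten.length ≤ #pairs := by
  rw [cnotLayers, List.length_flatten, List.map_map,
    card_eq_sum_card_fiberwise (f := κ) (t := univ) (by simp), ← List.ofFn_eq_map,
    List.sum_ofFn]
  refine sum_le_sum fun ℓ _ => ?_
  rw [Function.comp_apply, List.length_flatMap, ← length_toList]
  refine (List.sum_le_card_nsmul _ 1 fun a ha => ?_).trans (by simp)
  obtain ⟨p, -, rfl⟩ := List.mem_map.1 ha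
  exact length_cnotList_le_one p

theorem gatesOp_cnotLayers {A : Set ι} {pairs : Finset (ι × ι)} {w : ℕ} (κ : ι × ι → Fin w)
    (hA : ∀ p ∈ pairs, p.1 ∈ A ∧ p.2 ∉ A) (ψ : (ι → ZMod 2) → ℂ) (x : ι → ZMod 2) :
    gatesOp (cnotLayers pairs κ).flatten ψ x =
      ψ fun t => x t + ∑ p ∈ pairs, if p.2 = t then x p.1 else 0 := by
  have hflat : (cnotLayers pairs κ).flatten =
      ((List.finRange w).flatMap fun ℓ => ({p ∈ pairs | κ p = ℓ} : Finset (ι × ι)).toList).flatMap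
        cnotList := by
    rw [cnotLayers, List.flatMap_assoc, List.flatMap_def]
  rw [hflat, gatesOp_cnots A]
  · congr 1
    funext t
    rw [List.map_flatMap, List.flatMap_def, List.sum_flatten, List.map_map, ← List.ofFn_eq_map,
      List.sum_ofFn, ← sum_fiberwise pairs κ]
    congr 1
    exact sum_congr rfl fun ℓ _ => sum_map_toList _ _
  · intro p hp
    obtain ⟨ℓ, -, hp⟩ := List.mem_flatMap.1 hp
    rw [mem_toList, mem_filter] at hp
    exact hA p hp.1

end Circuits

theorem extend_comp_eq_self {ι κ M : Type*} [Zero M] {f : κ → ι} (hf : Function.Injective f)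
    {x : ι → M} (hx : ∀ i, i ∉ Set.range f → x i = 0) : Function.extend f (x ∘ f) 0 = x := by
  funext i
  by_cases hi : i ∈ Set.range f
  · obtain ⟨j, rfl⟩ := hi
    rw [hf.extend_apply, Function.comp_apply]
  · rw [Function.extend_apply' _ _ _ hi, hx i hi, Pi.zero_apply]

open Classical in
/-- The state `|ψ⟩ ⊗ |0 … 0⟩` of all qubits corresponds to the state `|ψ⟩` of the input qubits. -/
noncomputable def inputSpaceEquiv {ι : Type*} {k : ℕ} (inp : Fin k ↪ ι) :
    inputSpace inp ≃ₗ[ℂ] ((Fin k → ZMod 2) → ℂ) where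
  toFun ψ y := ψ.val (Function.extend inp y 0)
  map_add' _ _ := rfl
  map_smul' _ _ := rfl
  invFun χ := ⟨fun x => if ∃ i, i ∉ Set.range inp ∧ x i ≠ 0 then 0 else χ (x ∘ inp),
    fun _ hx => if_pos hx⟩
  left_inv ψ := by
    ext x
    simp only
    split_ifs with hx
    · exact (ψ.2 x hx).symm
    · push Not at hx
      rw [extend_comp_eq_self inp.injective hx]
  right_inv χ := by
    funext y
    simp only
    rw [if_neg, Function.extend_comp inp.injective]
    rintro ⟨i, hi, hyi⟩
    exact hyi (Function.extend_apply' _ _ _ hi)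

theorem finrank_inputSpace {ι : Type*} {k : ℕ} (inp : Fin k ↪ ι) :
    Module.finrank ℂ (inputSpace inp) = 2 ^ k := by
  rw [(inputSpaceEquiv inp).finrank_eq, Module.finrank_fintype_fun_eq_card]
  simp [ZMod.card]

theorem Circuit.Encodes.finrank_eq {ι : Type*} [DecidableEq ι] {C : Circuit ι} {k : ℕ}
    {Q : Submodule ℂ ((ι → ZMod 2) → ℂ)} (h : C.Encodes k Q) : Module.finrank ℂ Q = 2 ^ k := by
  obtain ⟨inp, rfl⟩ := h
  have hinj : Function.Injective C.op := gatesOp_injective _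
  rw [← (Submodule.equivMapOfInjective C.op hinj (inputSpace inp)).finrank_eq, finrank_inputSpace]

/-! ### The encoder -/

/-- The vectors `u` with `X(u) φ = φ`. -/
def transStab {ι : Type*} (φ : (ι → ZMod 2) → ℂ) : Submodule (ZMod 2) (ι → ZMod 2) where
  carrier := {u | ∀ x, φ (x + u) = φ x}
  add_mem' := by
    intro u v hu hv x
    rw [← add_assoc, hv, hu]
  zero_mem' := fun x => by rw [add_zero]
  smul_mem' := by
    intro r u hu x
    rcases zmod_two_cases r with rfl | rfl
    · rw [zero_smul, add_zero]
    · rw [one_smul, hu]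

theorem mem_transStab {ι : Type*} {φ : (ι → ZMod 2) → ℂ} {u : ι → ZMod 2} :
    u ∈ transStab φ ↔ ∀ x, φ (x + u) = φ x := Iff.rfl

theorem pauliX_eq_self_iff {ι : Type*} {φ : (ι → ZMod 2) → ℂ} {u : ι → ZMod 2} :
    pauliX u φ = φ ↔ u ∈ transStab φ := by
  rw [mem_transStab, funext_iff]
  refine forall_congr' fun x => ?_
  have hsub : x - u = x + u := funext fun i => CharTwo.sub_eq_add _ _
  rw [← hsub]
  rfl

theorem pauliZ_eq_self_iff {ι : Type*} [Fintype ι] {φ : (ι → ZMod 2) → ℂ} {v : ι → ZMod 2} :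
    pauliZ v φ = φ ↔ ∀ x, v ⬝ᵥ x ≠ 0 → φ x = 0 := by
  rw [funext_iff]
  refine forall_congr' fun x => ?_
  change (-1) ^ (v ⬝ᵥ x).val * φ x = φ x ↔ _
  rcases zmod_two_cases (v ⬝ᵥ x) with h | h <;> rw [h]
  · simp
  · rw [ZMod.val_one, pow_one]
    simp only [ne_eq, one_ne_zero, not_false_eq_true, forall_const]
    constructor
    · intro hneg
      linear_combination (-1 / 2) * hneg
    · intro hzero
      rw [hzero, mul_zero]

section Encoder

variable {m B n : ℕ}

theorem mem_cssSpace_iff {H : Matrix (Fin m) (Fin B) (ZMod 2)}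
    {φ : (Fin B × Fin n → ZMod 2) → ℂ} :
    φ ∈ cssSpace (pcX n H) (innerCheck B n) ↔
      Submodule.span (ZMod 2) (Set.range H.row) ≤ (transStab φ).comap (rep n) ∧
        ∀ x, x ∉ codeOf (innerCheck B n) → φ x = 0 := by
  refine and_congr ?_ ?_
  · rw [Submodule.span_le, Set.range_subset_iff]
    refine forall_congr' fun i => ?_
    rw [pauliX_eq_self_iff, pcX_eq_rep]
    rfl
  · simp only [pauliZ_eq_self_iff]
    simp only [mem_codeOf_iff, not_forall, forall_exists_index]
    exact forall_comm

/-- Adding the entry number `z` of every block to all other entries of the block. -/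
def copyMap (z : Fin n) : (Fin B × Fin n → ZMod 2) →+ (Fin B × Fin n → ZMod 2) where
  toFun x q := x q + if q.2 = z then 0 else x (q.1, z)
  map_zero' := by
    funext q
    simp
  map_add' x y := by
    funext q
    simp only [Pi.add_apply]
    split_ifs <;> ring

/-- Adding to the entries `(b, z)`, `b ∉ P`, the combination of the entries `(p, z)`, `p ∈ P`, with
the coefficients `g p b`. -/
def mixMap (z : Fin n) (P : Finset (Fin B)) (g : Fin B → Fin B → ZMod 2) :
    (Fin B × Fin n → ZMod 2) →+ (Fin B × Fin n → ZMod 2) where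
  toFun x q := x q + if q.2 = z ∧ q.1 ∉ P then ∑ p ∈ P, g p q.1 * x (p, z) else 0
  map_zero' := by
    funext q
    simp
  map_add' x y := by
    funext q
    simp only [Pi.add_apply, mul_add, sum_add_distrib]
    split_ifs <;> ring

theorem copyMap_apply (z : Fin n) (x : Fin B × Fin n → ZMod 2) (q : Fin B × Fin n) :
    copyMap z x q = x q + if q.2 = z then 0 else x (q.1, z) := rfl

theorem mixMap_apply (z : Fin n) (P : Finset (Fin B)) (g : Fin B → Fin B → ZMod 2)
    (x : Fin B × Fin n → ZMod 2) (q : Fin B × Fin n) :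
    mixMap z P g x q = x q + if q.2 = z ∧ q.1 ∉ P then ∑ p ∈ P, g p q.1 * x (p, z) else 0 := rfl

theorem copyMap_copyMap (z : Fin n) (x : Fin B × Fin n → ZMod 2) :
    copyMap z (copyMap z x) = x := by
  funext q
  simp only [copyMap_apply]
  split_ifs <;> simp [add_assoc, CharTwo.add_self_eq_zero]

theorem mixMap_mixMap (z : Fin n) (P : Finset (Fin B)) (g : Fin B → Fin B → ZMod 2)
    (x : Fin B × Fin n → ZMod 2) : mixMap z P g (mixMap z P g x) = x := by
  funext q
  have hpivot : ∀ p ∈ P, mixMap z P g x (p, z) = x (p, z) := by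
    intro p hp
    simp [mixMap_apply, hp]
  rw [mixMap_apply, sum_congr rfl fun p hp => by rw [hpivot p hp], mixMap_apply, add_assoc,
    CharTwo.add_self_eq_zero, add_zero]

theorem mixMap_copyMap_of_ne {z : Fin n} {P : Finset (Fin B)} {g : Fin B → Fin B → ZMod 2}
    (x : Fin B × Fin n → ZMod 2) {b : Fin B} {j : Fin n} (hj : j ≠ z) :
    mixMap z P g (copyMap z x) (b, j) = x (b, j) + x (b, z) := by
  simp [mixMap_apply, copyMap_apply, hj]

theorem mixMap_copyMap_rep {R : Submodule (ZMod 2) (Fin B → ZMod 2)} {z : Fin n}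
    {P : Finset (Fin B)} {g : Fin B → Fin B → ZMod 2} (hg : IsSystematic R P g) {p : Fin B}
    (hp : p ∈ P) : mixMap z P g (copyMap z (rep n (g p))) = Pi.single (p, z) 1 := by
  funext ⟨b, j⟩
  by_cases hj : j = z
  · subst hj
    have hsum : ∀ b, ∑ p' ∈ P, g p' b * g p p' = g p b := by
      intro b
      rw [sum_congr rfl fun p' hp' => by rw [hg.apply_eq p hp p' hp']]
      simp [hp]
    simp only [mixMap_apply, copyMap_apply, rep_apply, if_true, add_zero, hsum, true_and]
    by_cases hb : b ∈ P
    · rw [if_neg (not_not.2 hb), add_zero, hg.apply_eq p hp b hb]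
      simp [Pi.single_apply, eq_comm]
    · have hbp : b ≠ p := fun h => hb (h ▸ hp)
      rw [if_pos hb, CharTwo.add_self_eq_zero]
      simp [hbp]
  · rw [mixMap_copyMap_of_ne _ hj, rep_apply, rep_apply, CharTwo.add_self_eq_zero]
    simp [hj]

theorem map_xzSpace_eq_cssSpace {H : Matrix (Fin m) (Fin B) (ZMod 2)} (z : Fin n)
    {P : Finset (Fin B)} {g : Fin B → Fin B → ZMod 2}
    (hg : IsSystematic (Submodule.span (ZMod 2) (Set.range H.row)) P g) :
    (xzSpace {q | q.1 ∈ P ∧ q.2 = z} {q : Fin B × Fin n | q.2 ≠ z}).map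
        (LinearMap.funLeft ℂ ℂ fun x => mixMap z P g (copyMap z x)) =
      cssSpace (pcX n H) (innerCheck B n) := by
  ext φ
  rw [mem_cssSpace_iff, Submodule.mem_map]
  constructor
  · rintro ⟨ψ, ⟨hX, hZ⟩, rfl⟩
    constructor
    · intro r hr
      rw [hg.eq_sum r hr]
      refine Submodule.sum_mem _ fun p hp => Submodule.smul_mem _ _ fun x => ?_
      rw [LinearMap.funLeft_apply, LinearMap.funLeft_apply, map_add, map_add,
        mixMap_copyMap_rep hg hp, hX _ ⟨hp, rfl⟩]
    · intro x hx
      rw [mem_codeOf_innerCheck] at hx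
      obtain ⟨b, j, hbj⟩ : ∃ b j, x (b, j) ≠ x (b, z) := by
        by_contra! h
        exact hx fun b j j' => by rw [h b j, h b j']
      have hj : j ≠ z := fun h => hbj (by rw [h])
      rw [LinearMap.funLeft_apply]
      refine hZ (b, j) hj _ ?_
      rw [mixMap_copyMap_of_ne x hj]
      exact fun h => hbj (CharTwo.add_eq_zero.1 h)
  · rintro ⟨hX, hZ⟩
    refine ⟨fun x => φ (copyMap z (mixMap z P g x)), ⟨?_, ?_⟩, ?_⟩
    · rintro ⟨p, _⟩ ⟨hp, rfl⟩ x
      simp only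
      rw [← mixMap_copyMap_rep hg hp, map_add, map_add, mixMap_mixMap, copyMap_copyMap]
      exact hX (hg.mem p hp) _
    · rintro ⟨b, j⟩ hj x hx
      refine hZ _ fun hcode => hx ?_
      have hbj := mixMap_copyMap_of_ne (P := P) (g := g) (copyMap z (mixMap z P g x)) (b := b) hj
      rwa [copyMap_copyMap, mixMap_mixMap, mem_codeOf_innerCheck.1 hcode b j z,
        CharTwo.add_self_eq_zero] at hbj
    · funext x
      rw [LinearMap.funLeft_apply, mixMap_mixMap, copyMap_copyMap]

/-- The pairs `(control, target)` of the C-NOT gates that implement `mixMap`. -/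
def mixPairs (z : Fin n) (P : Finset (Fin B)) (g : Fin B → Fin B → ZMod 2) :
    Finset ((Fin B × Fin n) × (Fin B × Fin n)) :=
  {e | (e.1.2 = z ∧ e.1.1 ∈ P) ∧ (e.2.2 = z ∧ e.2.1 ∉ P) ∧ g e.1.1 e.2.1 ≠ 0}

/-- The pairs `(control, target)` of the C-NOT gates that implement `copyMap`. -/
def copyPairs (z : Fin n) : Finset ((Fin B × Fin n) × (Fin B × Fin n)) :=
  {e | e.1 = (e.2.1, z) ∧ e.2.2 ≠ z}

theorem mixPairs_source_target {z : Fin n} {P : Finset (Fin B)} {g : Fin B → Fin B → ZMod 2} :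
    ∀ e ∈ mixPairs z P g, e.1 ∈ {q : Fin B × Fin n | q.1 ∈ P} ∧ e.2 ∉ {q | q.1 ∈ P} := by
  intro e he
  obtain ⟨hsource, htarget, -⟩ := (mem_filter.1 he).2
  exact ⟨hsource.2, htarget.2⟩

theorem copyPairs_source_target {z : Fin n} : ∀ e ∈ copyPairs (B := B) z,
    e.1 ∈ {q : Fin B × Fin n | q.2 = z} ∧ e.2 ∉ {q | q.2 = z} := by
  intro e he
  obtain ⟨hsource, htarget⟩ := (mem_filter.1 he).2
  exact ⟨congrArg Prod.snd hsource, htarget⟩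

theorem mixPairs_ext {z : Fin n} {P : Finset (Fin B)} {g : Fin B → Fin B → ZMod 2}
    {e e' : (Fin B × Fin n) × (Fin B × Fin n)} (he : e ∈ mixPairs z P g)
    (he' : e' ∈ mixPairs z P g) (hsource : e.1.1 = e'.1.1) (htarget : e.2.1 = e'.2.1) :
    e = e' := by
  obtain ⟨⟨hz₁, -⟩, ⟨hz₂, -⟩, -⟩ := (mem_filter.1 he).2
  obtain ⟨⟨hz₁', -⟩, ⟨hz₂', -⟩, -⟩ := (mem_filter.1 he').2
  exact Prod.ext (Prod.ext hsource (hz₁.trans hz₁'.symm)) (Prod.ext htarget (hz₂.trans hz₂'.symm))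

theorem copyPairs_ext {z : Fin n} {e e' : (Fin B × Fin n) × (Fin B × Fin n)}
    (he : e ∈ copyPairs z) (he' : e' ∈ copyPairs z) (htarget : e.2 = e'.2) : e = e' := by
  refine Prod.ext ?_ htarget
  rw [(mem_filter.1 he).2.1, (mem_filter.1 he').2.1, htarget]

theorem mixPairs_layer_injective [NeZero B] {z : Fin n} {P : Finset (Fin B)}
    {g : Fin B → Fin B → ZMod 2} : ∀ e ∈ mixPairs z P g, ∀ e' ∈ mixPairs z P g,
      e.1.1 + e.2.1 = e'.1.1 + e'.2.1 → e.1 = e'.1 ∨ e.2 = e'.2 → e = e' := by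
  rintro e he e' he' hlayer (hsource | htarget)
  · rw [hsource] at hlayer
    exact mixPairs_ext he he' (congrArg Prod.fst hsource) (add_left_cancel hlayer)
  · rw [htarget] at hlayer
    exact mixPairs_ext he he' (add_right_cancel hlayer) (congrArg Prod.fst htarget)

theorem copyPairs_layer_injective {z : Fin n} : ∀ e ∈ copyPairs (B := B) z, ∀ e' ∈ copyPairs z,
    e.2.2 = e'.2.2 → e.1 = e'.1 ∨ e.2 = e'.2 → e = e' := by
  rintro e he e' he' hlayer (hsource | htarget)
  · refine copyPairs_ext he he' (Prod.ext ?_ hlayer)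
    rw [(mem_filter.1 he).2.1, (mem_filter.1 he').2.1] at hsource
    exact (Prod.mk.inj hsource).1
  · exact copyPairs_ext he he' htarget

theorem card_mixPairs_le (z : Fin n) (P : Finset (Fin B)) (g : Fin B → Fin B → ZMod 2) :
    #(mixPairs z P g) ≤ B ^ 2 := by
  have hcard : #(univ : Finset (Fin B × Fin B)) = B ^ 2 := by simp [sq]
  rw [← hcard]
  refine card_le_card_of_injOn (fun e => (e.1.1, e.2.1)) (by simp) fun e he e' he' h => ?_
  exact mixPairs_ext he he' (Prod.mk.inj h).1 (Prod.mk.inj h).2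

theorem card_copyPairs_le (z : Fin n) : #(copyPairs (B := B) z) ≤ B * n := by
  have hcard : #(univ : Finset (Fin B × Fin n)) = B * n := by simp
  rw [← hcard]
  exact card_le_card_of_injOn Prod.snd (by simp) fun e he e' he' h => copyPairs_ext he he' h

theorem sum_mixPairs (z : Fin n) (P : Finset (Fin B)) (g : Fin B → Fin B → ZMod 2)
    (x : Fin B × Fin n → ZMod 2) :
    (fun t => x t + ∑ e ∈ mixPairs z P g, if e.2 = t then x e.1 else 0) = mixMap z P g x := by
  funext t
  rw [mixMap_apply]
  congr 1
  rw [mixPairs, sum_filter, Fintype.sum_prod_type]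
  have htarget : ∀ p : Fin B × Fin n, (∑ q : Fin B × Fin n,
      if (p.2 = z ∧ p.1 ∈ P) ∧ (q.2 = z ∧ q.1 ∉ P) ∧ g p.1 q.1 ≠ 0 then
        if q = t then x p else 0 else 0) =
      if p.2 = z then if p.1 ∈ P then
        if t.2 = z ∧ t.1 ∉ P then g p.1 t.1 * x p else 0 else 0 else 0 := by
    intro p
    rw [sum_eq_single t]
    · rcases zmod_two_cases (g p.1 t.1) with h | h <;> simp only [h] <;> split_ifs <;>
        simp_all
    · intro q _ hq
      simp [hq]
    · simp
  simp only [htarget, Fintype.sum_prod_type, sum_ite_eq', mem_univ, if_true]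
  rw [sum_ite_mem, univ_inter]
  split_ifs <;> simp

theorem sum_copyPairs (z : Fin n) (x : Fin B × Fin n → ZMod 2) :
    (fun t => x t + ∑ e ∈ copyPairs z, if e.2 = t then x e.1 else 0) = copyMap z x := by
  funext t
  rw [copyMap_apply]
  congr 1
  rw [copyPairs, sum_filter, Fintype.sum_prod_type, sum_comm, sum_eq_single t]
  · rw [sum_eq_single (t.1, z)]
    · simp
    · intro p _ hp
      simp [hp]
    · simp
  · intro q _ hq
    simp [hq]
  · simp

/-- The qubits that are prepared in the state `|+⟩`. -/
noncomputable def pivots (z : Fin n) (P : Finset (Fin B)) : List (Fin B × Fin n) :=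
  P.toList.map fun p => (p, z)

theorem mem_pivots {z : Fin n} {P : Finset (Fin B)} {q : Fin B × Fin n} :
    q ∈ pivots z P ↔ q.1 ∈ P ∧ q.2 = z := by
  obtain ⟨b, j⟩ := q
  simp [pivots, eq_comm]

theorem nodup_pivots (z : Fin n) (P : Finset (Fin B)) : (pivots z P).Nodup :=
  P.nodup_toList.map fun _ _ h => congrArg Prod.fst h

/-- The encoding circuit: Hadamard gates on the pivots `(p, z)`, `p ∈ P`; then C-NOT gates from
pivots to other blocks, where the pair of blocks `(p, b)` is scheduled in layer `p + b` modulo `B`;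
then C-NOT gates that copy the entry `z` of each block to the entry `j` in layer `j`. -/
noncomputable def encoder [NeZero B] (z : Fin n) (P : Finset (Fin B))
    (g : Fin B → Fin B → ZMod 2) : Circuit (Fin B × Fin n) where
  layers := (pivots z P).map Gate.had ::
    (cnotLayers (mixPairs z P g) (fun e => e.1.1 + e.2.1) ++
      cnotLayers (copyPairs z) fun e => e.2.2)
  disjoint L hL := by
    rw [List.mem_cons, List.mem_append] at hL
    rcases hL with rfl | hL | hL
    · rw [List.pairwise_map]
      refine (nodup_pivots z P).imp fun hne => ?_
      simpa [Gate.support] using hne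
    · exact cnotLayers_disjoint mixPairs_source_target mixPairs_layer_injective L hL
    · exact cnotLayers_disjoint copyPairs_source_target copyPairs_layer_injective L hL

theorem size_encoder_le [NeZero B] (z : Fin n) (P : Finset (Fin B))
    (g : Fin B → Fin B → ZMod 2) : (encoder z P g).size ≤ B + B ^ 2 + B * n := by
  have hpivots : #P ≤ B := by simpa using P.card_le_univ
  have hmix := (length_flatten_cnotLayers_le (mixPairs z P g) fun e => e.1.1 + e.2.1).trans
    (card_mixPairs_le z P g)
  have hcopy := (length_flatten_cnotLayers_le (copyPairs (B := B) z) fun e => e.2.2).trans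
    (card_copyPairs_le z)
  rw [Circuit.size, encoder, List.flatten_cons, List.flatten_append, List.length_append,
    List.length_append, List.length_map, pivots, List.length_map, length_toList]
  omega

theorem depth_encoder [NeZero B] (z : Fin n) (P : Finset (Fin B))
    (g : Fin B → Fin B → ZMod 2) : (encoder z P g).depth = 1 + B + n := by
  rw [Circuit.depth, encoder, List.length_cons, List.length_append, length_cnotLayers,
    length_cnotLayers]
  omega

theorem op_encoder_apply [NeZero B] (z : Fin n) (P : Finset (Fin B))
    (g : Fin B → Fin B → ZMod 2) (ψ : (Fin B × Fin n → ZMod 2) → ℂ)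
    (x : Fin B × Fin n → ZMod 2) :
    (encoder z P g).op ψ x =
      gatesOp ((pivots z P).map Gate.had) ψ (mixMap z P g (copyMap z x)) := by
  change gatesOp (encoder z P g).layers.flatten ψ x = _
  rw [encoder, List.flatten_cons, List.flatten_append, gatesOp_append, gatesOp_append,
    LinearMap.comp_apply, LinearMap.comp_apply, gatesOp_cnotLayers _ copyPairs_source_target,
    sum_copyPairs, gatesOp_cnotLayers _ mixPairs_source_target, sum_mixPairs]

/-- The embedding of the input qubits `(b, z)`, `b ∉ P`. -/
noncomputable def inputQubits (z : Fin n) (P : Finset (Fin B)) : Fin #Pᶜ ↪ Fin B × Fin n :=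
  Pᶜ.equivFin.symm.toEmbedding.trans
    ((Function.Embedding.subtype (· ∈ Pᶜ)).trans (Function.Embedding.sectL (Fin B) z))

theorem mem_range_inputQubits {z : Fin n} {P : Finset (Fin B)} {q : Fin B × Fin n} :
    q ∈ Set.range (inputQubits z P) ↔ q.1 ∉ P ∧ q.2 = z := by
  obtain ⟨b, j⟩ := q
  constructor
  · rintro ⟨i, hi⟩
    obtain ⟨rfl, rfl⟩ := Prod.mk.inj hi
    exact ⟨mem_compl.1 (Pᶜ.equivFin.symm i).2, rfl⟩
  · rintro ⟨hb, rfl⟩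
    refine ⟨Pᶜ.equivFin ⟨b, mem_compl.2 hb⟩, ?_⟩
    simp [inputQubits]

theorem map_hads_inputSpace (z : Fin n) (P : Finset (Fin B)) :
    (inputSpace (inputQubits z P)).map (gatesOp ((pivots z P).map Gate.had)) =
      xzSpace {q | q.1 ∈ P ∧ q.2 = z} {q | q.2 ≠ z} := by
  rw [inputSpace_eq_xzSpace, map_hads _ (nodup_pivots z P)]
  · congr 1
    · ext q
      simp [mem_pivots]
    · ext q
      simp only [Set.mem_sdiff, Set.mem_compl_iff, mem_range_inputQubits, Set.mem_ofPred_eq,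
        mem_pivots]
      tauto
  · intro q hq
    rw [Set.mem_compl_iff, mem_range_inputQubits]
    exact fun h => h.1 (mem_pivots.1 hq).1
  · exact fun q _ => Set.notMem_empty q

theorem encoder_encodes [NeZero B] {H : Matrix (Fin m) (Fin B) (ZMod 2)} (z : Fin n)
    {P : Finset (Fin B)} {g : Fin B → Fin B → ZMod 2}
    (hg : IsSystematic (Submodule.span (ZMod 2) (Set.range H.row)) P g) :
    (encoder z P g).Encodes #Pᶜ (cssSpace (pcX n H) (innerCheck B n)) := by
  refine ⟨inputQubits z P, ?_⟩
  have hop : (encoder z P g).op =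
      LinearMap.funLeft ℂ ℂ (fun x => mixMap z P g (copyMap z x)) ∘ₗ
        gatesOp ((pivots z P).map Gate.had) :=
    LinearMap.ext fun ψ => funext fun x => op_encoder_apply z P g ψ x
  rw [hop, Submodule.map_comp, map_hads_inputSpace, map_xzSpace_eq_cssSpace z hg]

theorem exists_encoder (hB : 0 < B) (hn : 0 < n) (H : Matrix (Fin m) (Fin B) (ZMod 2)) :
    ∃ C : Circuit (Fin B × Fin n),
      C.Encodes (Module.finrank (ZMod 2) (codeOf H)) (cssSpace (pcX n H) (innerCheck B n)) ∧
        C.size ≤ B + B ^ 2 + B * n ∧ C.depth = 1 + B + n := by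
  have : NeZero B := ⟨hB.ne'⟩
  obtain ⟨P, g, hg⟩ := exists_isSystematic (Submodule.span (ZMod 2) (Set.range H.row))
  refine ⟨encoder ⟨0, hn⟩ P g, ?_, size_encoder_le _ P g, depth_encoder _ P g⟩
  rw [hg.finrank_codeOf]
  exact encoder_encodes _ hg

end Encoder

/-! ### Total correctness with running times

The decoders use the arrays `0`, `1`, `2` for their input, `3` and `4` for the estimated `Z`- and
`X`-errors, `5` for the estimated error of the outer code, `6` for the numbers of nonzero syndrome
bits of the blocks, `7` for a stack of variables, `8` for the stack height, the variable taken from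
the stack and a loop counter, and `9` for the counter of simulated parallel steps. -/

/-- Started in `s`, the command `c` halts within `T` steps in a memory with the property `Q`. -/
def Run (W P : ℕ) (c : Cmd) (s : Mem) (T : ℕ) (Q : Mem → Prop) : Prop :=
  ∃ t s', t ≤ T ∧ Exec W P c s t s' ∧ Q s'

/-- The memory `s` with cell `i` of array `a` overwritten by `v`. -/
def Mem.set (s : Mem) (a i v : ℕ) : Mem := fun b j => if b = a ∧ j = i then v else s b j

theorem Mem.set_of_ne {s : Mem} {a i v b : ℕ} (h : b ≠ a) : s.set a i v b = s b := by
  funext j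
  simp [Mem.set, h]

theorem Mem.set_same {s : Mem} {a i v : ℕ} : s.set a i v a i = v := by
  simp [Mem.set]

theorem Mem.set_of_ne_idx {s : Mem} {a i v b j : ℕ} (h : j ≠ i) : s.set a i v b j = s b j := by
  simp [Mem.set, h]

/-- The memory `s'` arises from `s` by changes to the arrays in `F` only. -/
def EqOff (F : Finset ℕ) (s s' : Mem) : Prop := ∀ a ∉ F, s' a = s a

namespace EqOff

variable {F G : Finset ℕ} {s s' s'' : Mem}

theorem refl (F : Finset ℕ) (s : Mem) : EqOff F s s := fun _ _ => rfl

theorem trans (h : EqOff F s s') (h' : EqOff F s' s'') : EqOff F s s'' := fun a ha =>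
  (h' a ha).trans (h a ha)

theorem mono (h : EqOff F s s') (hFG : F ⊆ G) : EqOff G s s' := fun a ha =>
  h a fun haF => ha (hFG haF)

theorem set (h : EqOff F s s') {a : ℕ} (ha : a ∈ F) (i v : ℕ) : EqOff F s (s'.set a i v) :=
  fun b hb => (Mem.set_of_ne (ne_of_mem_of_not_mem ha hb).symm).trans (h b hb)

end EqOff

/-- One processor executes `a[addr] := val`. -/
def assign (a : ℕ) (addr val : Expr) : Cmd := Cmd.par (Expr.const 1) (Expr.const 1) a addr val

namespace Run

variable {W P : ℕ}

theorem mono {c : Cmd} {s : Mem} {T T' : ℕ} {Q Q' : Mem → Prop} (h : Run W P c s T Q)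
    (hT : T ≤ T') (hQ : ∀ s', Q s' → Q' s') : Run W P c s T' Q' := by
  obtain ⟨t, s', ht, hexec, hs'⟩ := h
  exact ⟨t, s', ht.trans hT, hexec, hQ s' hs'⟩

theorem skip {s : Mem} {Q : Mem → Prop} (h : Q s) : Run W P Cmd.skip s 1 Q :=
  ⟨1, s, le_rfl, Exec.skip s, h⟩

theorem seq {c d : Cmd} {s : Mem} {T T' : ℕ} {Q Q' : Mem → Prop} (hc : Run W P c s T Q)
    (hd : ∀ s', Q s' → Run W P d s' T' Q') : Run W P (Cmd.seq c d) s (T + T') Q' := by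
  obtain ⟨t, s', ht, hexec, hs'⟩ := hc
  obtain ⟨t', s'', ht', hexec', hs''⟩ := hd s' hs'
  exact ⟨t + t', s'', Nat.add_le_add ht ht', Exec.seq _ _ _ _ _ _ _ hexec hexec', hs''⟩

theorem ite {e : Expr} {c d : Cmd} {s : Mem} {T : ℕ} {Q : Mem → Prop}
    (hc : e.eval s 0 ≠ 0 → Run W P c s T Q) (hd : e.eval s 0 = 0 → Run W P d s T Q) :
    Run W P (Cmd.ite e c d) s (T + 1) Q := by
  by_cases he : e.eval s 0 = 0
  · obtain ⟨t, s', ht, hexec, hs'⟩ := hd he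
    exact ⟨t + 1, s', Nat.add_le_add_right ht 1, Exec.iteFalse _ _ _ _ _ _ he hexec, hs'⟩
  · obtain ⟨t, s', ht, hexec, hs'⟩ := hc he
    exact ⟨t + 1, s', Nat.add_le_add_right ht 1, Exec.iteTrue _ _ _ _ _ _ he hexec, hs'⟩

-- The index of the invariant `I` is the variant of the loop.
theorem loop {e : Expr} {c : Cmd} (I : ℕ → Mem → Prop) {τ : ℕ}
    (hstep : ∀ k s, I k s → e.eval s 0 ≠ 0 → Run W P c s τ fun s' => ∃ k' < k, I k' s')
    {k : ℕ} {s : Mem} (hs : I k s) :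
    Run W P (Cmd.loop e c) s ((τ + 1) * k + 1) fun s' => (∃ k', I k' s') ∧ e.eval s' 0 = 0 := by
  induction k using Nat.strong_induction_on generalizing s with
  | _ k ih =>
    by_cases he : e.eval s 0 = 0
    · exact ⟨1, s, by omega, Exec.loopDone _ _ _ he, ⟨k, hs⟩, he⟩
    · obtain ⟨t, s', ht, hexec, k', hk', hs'⟩ := hstep k s hs he
      obtain ⟨t', s'', ht', hexec', hs''⟩ := ih k' hk' hs'
      refine ⟨t + t' + 1, s'', ?_, Exec.loopStep _ _ _ _ _ _ _ he hexec hexec', hs''⟩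
      have hτ := Nat.mul_le_mul_left (τ + 1) (Nat.succ_le_of_lt hk')
      rw [Nat.succ_eq_add_one, mul_add, mul_one] at hτ
      omega

theorem assign (hP : 1 ≤ P) {a : ℕ} {addr val : Expr} {s : Mem} {Q : Mem → Prop}
    (haddr : addr.eval s 0 ≤ W) (hval : val.eval s 0 ≤ W)
    (hQ : Q (s.set a (addr.eval s 0) (val.eval s 0))) :
    Run W P (PCCSS.assign a addr val) s 1 Q := by
  refine ⟨1, _, le_rfl, Exec.par _ _ _ _ _ _ _ hP ?_ ?_ ?_ ?_, hQ⟩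
  · rintro p ⟨hp, -⟩
    obtain rfl : p = 0 := Nat.lt_one_iff.1 hp
    exact ⟨haddr, hval⟩
  · rintro p q ⟨hp, -⟩ ⟨hq, -⟩ -
    exact (Nat.lt_one_iff.1 hp).trans (Nat.lt_one_iff.1 hq).symm
  · rintro p ⟨hp, -⟩
    obtain rfl : p = 0 := Nat.lt_one_iff.1 hp
    exact Mem.set_same
  · intro b i hbi
    by_cases hb : b = a ∧ i = addr.eval s 0
    · exact absurd ⟨0, ⟨Nat.one_pos, one_ne_zero⟩, hb⟩ hbi
    · simp [Mem.set, hb]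

end Run

theorem eval_lt_ne_zero {e f : Expr} {s : Mem} {p : ℕ} :
    (Expr.lt e f).eval s p ≠ 0 ↔ e.eval s p < f.eval s p := by
  simp [Expr.eval]

/-- `body` for all values of the loop counter, in cell `i` of array `a`, below `bound`. -/
def forCell (a i : ℕ) (bound : Expr) (body : Cmd) : Cmd :=
  Cmd.seq (assign a (Expr.const i) (Expr.const 0))
    (Cmd.loop (Expr.lt (Expr.read a (Expr.const i)) bound)
      (Cmd.seq body
        (assign a (Expr.const i) (Expr.add (Expr.read a (Expr.const i)) (Expr.const 1)))))

theorem Run.forCell {W P a i n τ : ℕ} (hP : 1 ≤ P) (hi : i ≤ W) (hn : n ≤ W) {bound : Expr}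
    {body : Cmd} (I : ℕ → Mem → Prop) (hbound : ∀ k s, I k s → bound.eval s 0 = n)
    (hset : ∀ k s v, I k s → I k (s.set a i v))
    (hbody : ∀ k < n, ∀ s, I k s → s a i = k →
      Run W P body s τ fun s' => I (k + 1) s' ∧ s' a i = k)
    {s : Mem} (hs : I 0 s) : Run W P (PCCSS.forCell a i bound body) s ((τ + 2) * n + 2) (I n) := by
  have htime : (τ + 2) * n + 2 = 1 + ((τ + 1 + 1) * n + 1) := by ring
  rw [htime]
  refine Run.seq (Q := fun s' => s' = s.set a i 0) (Run.assign hP hi (Nat.zero_le _) rfl) ?_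
  rintro _ rfl
  refine (Run.loop (fun r s' => s' a i + r = n ∧ I (s' a i) s') (τ := τ + 1) ?_ ?_).mono le_rfl ?_
  · rintro r s' ⟨hr, hs'⟩ hlt
    rw [eval_lt_ne_zero, hbound _ _ hs'] at hlt
    refine Run.seq (hbody _ hlt s' hs' rfl) ?_
    rintro s'' ⟨hs'', hcell⟩
    have hval : (Expr.add (Expr.read a (Expr.const i)) (Expr.const 1)).eval s'' 0 = s' a i + 1 :=
      congrArg (· + 1) hcell
    refine Run.assign hP hi (hval.trans_le (hlt.trans_le hn)) ⟨r - 1, ?_, ?_⟩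
    · change s' a i < n at hlt
      omega
    · change s' a i < n at hlt
      rw [hval, Expr.eval, Mem.set_same]
      exact ⟨by omega, hset _ _ _ hs''⟩
  · rw [Mem.set_same]
    exact ⟨Nat.zero_add n, hset _ _ _ hs⟩
  · rintro s' ⟨⟨r, hr, hs'⟩, hend⟩
    have hcell : s' a i = n := by
      refine le_antisymm (by omega) (not_lt.1 fun hlt => ?_)
      rw [← hbound _ _ hs'] at hlt
      exact eval_lt_ne_zero (e := Expr.read a (Expr.const i)).2 hlt hend
    rwa [hcell] at hs'

/-- Up to the scratch array `9`, the memory `s'` arises from `s` by writing `V p` to cell `A p` of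
array `a` for all `p < n`. -/
structure Written (a n : ℕ) (A V : ℕ → ℕ) (s s' : Mem) : Prop where
  frame : EqOff {a, 9} s s'
  written : ∀ p < n, s' a (A p) = V p
  unchanged : ∀ i, (∀ p < n, i ≠ A p) → s' a i = s a i

namespace Written

variable {a n : ℕ} {A V : ℕ → ℕ} {s s' : Mem}

theorem eq_ite (h : Written a n id V s s') (i : ℕ) : s' a i = if i < n then V i else s a i := by
  split_ifs with hi
  · exact h.written i hi
  · exact h.unchanged i fun p hp hip => hi (hip ▸ hp)

theorem set_scratch (h : Written a n A V s s') (ha : a ≠ 9) (i v : ℕ) :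
    Written a n A V s (s'.set 9 i v) := by
  refine ⟨h.frame.set (by simp) i v, ?_, ?_⟩ <;> rw [Mem.set_of_ne ha]
  · exact h.written
  · exact h.unchanged

theorem succ (h : Written a n A V s s') (hA : ∀ p < n, A p ≠ A n) :
    Written a (n + 1) A V s (s'.set a (A n) (V n)) := by
  refine ⟨h.frame.set (by simp) _ _, fun p hp => ?_, fun i hi => ?_⟩
  · obtain hp | rfl := Nat.lt_succ_iff_lt_or_eq.1 hp
    · rw [Mem.set_of_ne_idx (hA p hp), h.written p hp]
    · exact Mem.set_same
  · rw [Mem.set_of_ne_idx (hi n n.lt_succ_self)]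
    exact h.unchanged i fun p hp => hi p (hp.trans n.lt_succ_self)

end Written

theorem exists_written (a n : ℕ) {A : ℕ → ℕ} (V : ℕ → ℕ) (s : Mem)
    (hA : Set.InjOn A (Set.Iio n)) :
    ∃ s' : Mem, (∀ b ≠ a, s' b = s b) ∧ (∀ p < n, s' a (A p) = V p) ∧
      ∀ i, (∀ p < n, i ≠ A p) → s' a i = s a i := by
  classical
  refine ⟨Function.update s a fun i => if h : ∃ p < n, A p = i then V h.choose else s a i,
    fun b hb => Function.update_of_ne hb _ _, fun p hp => ?_, fun i hi => ?_⟩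
  · have hex : ∃ q < n, A q = A p := ⟨p, hp, rfl⟩
    rw [Function.update_self, dif_pos hex, hA hex.choose_spec.1 hp hex.choose_spec.2]
  · rw [Function.update_self, dif_neg]
    rintro ⟨p, hp, rfl⟩
    exact hi p hp rfl

theorem Run.parAll {W P : ℕ} {count : Expr} {a : ℕ} {addr val : Expr} {s : Mem} {n : ℕ}
    {A V : ℕ → ℕ} (hcount : count.eval s 0 = n) (hnP : n ≤ P)
    (haddr : ∀ p < n, addr.eval s p = A p) (hval : ∀ p < n, val.eval s p = V p)
    (hAW : ∀ p < n, A p ≤ W) (hVW : ∀ p < n, V p ≤ W) (hA : Set.InjOn A (Set.Iio n)) :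
    Run W P (Cmd.par count (Expr.const 1) a addr val) s 1 (Written a n A V s) := by
  have hactive : ∀ p, Active count (Expr.const 1) s p ↔ p < n := by
    intro p
    rw [Active, hcount]
    simp [Expr.eval]
  obtain ⟨s', hframe, hwritten, hunchanged⟩ := exists_written a n V s hA
  refine ⟨1, s', le_rfl, Exec.par _ _ _ _ _ _ _ (hcount.trans_le hnP) ?_ ?_ ?_ ?_,
    fun b hb => hframe b fun hba => hb (by simp [hba]), hwritten, hunchanged⟩
  · intro p hp
    rw [hactive] at hp
    rw [haddr p hp, hval p hp]
    exact ⟨hAW p hp, hVW p hp⟩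
  · intro p q hp hq h
    rw [hactive] at hp hq
    rw [haddr p hp, haddr q hq] at h
    exact hA hp hq h
  · intro p hp
    rw [hactive] at hp
    rw [haddr p hp, hval p hp, hwritten p hp]
  · intro b i hi
    by_cases hb : b = a
    · subst hb
      refine hunchanged i fun p hp hip => hi ⟨p, (hactive p).2 hp, rfl, ?_⟩
      rw [hip, haddr p hp]
    · rw [hframe b hb]

/-- Replacement of the processor number by an expression. -/
def Expr.substPid : Expr → Expr → Expr
  | const n, _ => const n
  | pid, r => r
  | read a i, r => read a (i.substPid r)
  | add e f, r => add (e.substPid r) (f.substPid r)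
  | sub e f, r => sub (e.substPid r) (f.substPid r)
  | mul e f, r => mul (e.substPid r) (f.substPid r)
  | lt e f, r => lt (e.substPid r) (f.substPid r)

theorem Expr.eval_substPid (e r : Expr) (s : Mem) (p : ℕ) :
    (e.substPid r).eval s p = e.eval s (r.eval s p) := by
  induction e <;> simp_all [Expr.substPid, Expr.eval]

/-- The assignments `a[addr] := val` for all processor numbers below `count`, executed by one
processor one after the other, with its counter in the scratch array `9`, or by `count` processors
in one step. -/
def forAll (parallel : Bool) (count : Expr) (a : ℕ) (addr val : Expr) : Cmd :=
  if parallel then Cmd.par count (Expr.const 1) a addr val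
  else forCell 9 0 count (assign a (addr.substPid (Expr.read 9 (Expr.const 0)))
    (val.substPid (Expr.read 9 (Expr.const 0))))

/-- Running time of `forAll`. -/
def forAllTime (parallel : Bool) (n : ℕ) : ℕ := if parallel then 1 else 3 * n + 2

-- The hypothesis `heval` says that no processor reads a cell that another one writes; therefore the
-- sequential and the parallel execution have the same effect.
theorem Run.forAll {W P : ℕ} (parallel : Bool) {count : Expr} {a : ℕ} {addr val : Expr} {s : Mem}
    {n : ℕ} {A V : ℕ → ℕ} (hP : 1 ≤ P) (hnP : parallel = true → n ≤ P) (hnW : n ≤ W) (ha : a ≠ 9)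
    (hcount : ∀ s', EqOff {a, 9} s s' → count.eval s' 0 = n)
    (heval : ∀ p < n, ∀ s', EqOff {a, 9} s s' →
      (∀ i, (∀ q < n, q ≠ p → i ≠ A q) → s' a i = s a i) →
      addr.eval s' p = A p ∧ val.eval s' p = V p)
    (hAW : ∀ p < n, A p ≤ W) (hVW : ∀ p < n, V p ≤ W) (hA : Set.InjOn A (Set.Iio n)) :
    Run W P (PCCSS.forAll parallel count a addr val) s (forAllTime parallel n)
      (Written a n A V s) := by
  cases parallel with
  | true =>
    have heval' := fun p hp => heval p hp s (EqOff.refl _ s) fun _ _ => rfl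
    exact Run.parAll (hcount s (EqOff.refl _ s)) (hnP rfl) (fun p hp => (heval' p hp).1)
      (fun p hp => (heval' p hp).2) hAW hVW hA
  | false =>
    refine Run.forCell (τ := 1) hP (Nat.zero_le W) hnW (fun k => Written a k A V s)
      (fun k s' h => hcount s' h.frame) (fun k s' v h => h.set_scratch ha 0 v) ?_
      ⟨EqOff.refl _ s, fun p hp => absurd hp p.not_lt_zero, fun _ _ => rfl⟩
    intro k hk s' hs' hcell
    obtain ⟨haddr, hval⟩ := heval k hk s' hs'.frame fun i hi =>
      hs'.unchanged i fun p hp => hi p (hp.trans hk) hp.ne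
    have hsubst : ∀ e : Expr,
        (e.substPid (Expr.read 9 (Expr.const 0))).eval s' 0 = e.eval s' k := fun e => by
      rw [Expr.eval_substPid, Expr.eval, Expr.eval, hcell]
    refine Run.assign hP ?_ ?_ ?_ <;> simp only [hsubst, haddr, hval]
    · exact hAW k hk
    · exact hVW k hk
    · refine ⟨hs'.succ fun p hp h => hp.ne (hA (hp.trans hk) hk h), ?_⟩
      rw [Mem.set_of_ne ha.symm, hcell]

/-- The counter of the outer loops, in cell `2` of array `8`. -/
def counter : Expr := Expr.read 8 (Expr.const 2)

/-! ### The table of the outer code -/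

section Table

theorem bitArray_val {n : ℕ} (f : Fin n → ZMod 2) (i : Fin n) : bitArray f i = (f i).val := by
  simp [bitArray]

theorem bitArray_of_le {n : ℕ} (f : Fin n → ZMod 2) {i : ℕ} (h : n ≤ i) : bitArray f i = 0 := by
  simp [bitArray, Nat.not_lt.2 h]

theorem bitArray_le_one {n : ℕ} (f : Fin n → ZMod 2) (i : ℕ) : bitArray f i ≤ 1 := by
  unfold bitArray
  split_ifs with h
  · exact Nat.lt_succ_iff.1 (ZMod.val_lt _)
  · exact Nat.zero_le 1

theorem mul_add_div_mod {n j : ℕ} (b : ℕ) (hj : j < n) :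
    (b * n + j) / n = b ∧ (b * n + j) % n = j :=
  (Nat.div_mod_unique (Nat.zero_lt_of_lt hj)).2 ⟨by ring, hj⟩

/-- The `i`-th element of `S` in some fixed order; the value `n`, which does not occur in `S`, marks
the end. -/
noncomputable def entryAt {n : ℕ} (S : Finset (Fin n)) (i : ℕ) : ℕ :=
  (S.toList.map Fin.val).getD i n

theorem entryAt_le {n : ℕ} (S : Finset (Fin n)) (i : ℕ) : entryAt S i ≤ n := by
  rw [entryAt, List.getD_eq_getElem?_getD, List.getElem?_map]
  cases S.toList[i]? with
  | none => simp
  | some a => simp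

theorem sum_range_getD {α M : Type*} [AddCommMonoid M] {F : α → M} {d : α} (hd : F d = 0)
    (l : List α) {r : ℕ} (hr : l.length ≤ r) :
    ∑ i ∈ range r, F (l.getD i d) = (l.map F).sum := by
  induction l generalizing r with
  | nil => simp [hd]
  | cons a l ih =>
    obtain ⟨r, rfl⟩ := Nat.exists_eq_add_one.2 (Nat.zero_lt_of_lt hr)
    rw [sum_range_succ', List.map_cons, List.sum_cons, add_comm]
    simp only [List.getD_cons_succ, List.getD_cons_zero]
    rw [ih (Nat.succ_le_succ_iff.1 hr)]

theorem sum_entryAt {n r : ℕ} {S : Finset (Fin n)} (hS : #S ≤ r) {F : ℕ → ℕ} (hF : F n = 0) :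
    ∑ i ∈ range r, F (entryAt S i) = ∑ a ∈ S, F a := by
  simp only [entryAt]
  rw [sum_range_getD hF _ (by simpa using hS), List.map_map]
  exact sum_map_toList _ _

theorem exists_entryAt_eq {n r : ℕ} {S : Finset (Fin n)} (hS : #S ≤ r) {a : Fin n} (ha : a ∈ S) :
    ∃ i < r, entryAt S i = a := by
  have hmem : a.val ∈ S.toList.map Fin.val := List.mem_map.2 ⟨a, mem_toList.2 ha, rfl⟩
  obtain ⟨i, hi, hia⟩ := List.mem_iff_getElem.1 hmem
  refine ⟨i, lt_of_lt_of_le (by simpa using hi) hS, ?_⟩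
  rw [entryAt, List.getD_eq_getElem _ _ hi, hia]

variable {m B : ℕ} {H : Matrix (Fin m) (Fin B) (ZMod 2)} {D Δ : ℕ}

/-- The `i`-th check of the variable `v`; if there is none, the value is `m`. -/
noncomputable def checkAt (H : Matrix (Fin m) (Fin B) (ZMod 2)) (v i : ℕ) : ℕ :=
  if h : v < B then entryAt (checksOf H ⟨v, h⟩) i else m

/-- The `k`-th variable of the check `c`; if there is none, the value is `B`. -/
noncomputable def varAt (H : Matrix (Fin m) (Fin B) (ZMod 2)) (c k : ℕ) : ℕ :=
  if h : c < m then entryAt (varsOf H ⟨c, h⟩) k else B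

theorem checkAt_val (v : Fin B) (i : ℕ) : checkAt H v i = entryAt (checksOf H v) i :=
  dif_pos v.isLt

theorem varAt_val (c : Fin m) (k : ℕ) : varAt H c k = entryAt (varsOf H c) k :=
  dif_pos c.isLt

theorem checkAt_le (v i : ℕ) : checkAt H v i ≤ m := by
  unfold checkAt
  split_ifs
  exacts [entryAt_le _ _, le_rfl]

theorem varAt_le (c k : ℕ) : varAt H c k ≤ B := by
  unfold varAt
  split_ifs
  exacts [entryAt_le _ _, le_rfl]

theorem exists_varAt_checkAt_eq (hcol : ∀ j, #(checksOf H j) ≤ D) (hrow : ∀ c, #(varsOf H c) ≤ Δ)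
    {v j : Fin B} (h : ¬ Disjoint (checksOf H j) (checksOf H v)) :
    ∃ i < D, ∃ k < Δ, varAt H (checkAt H v i) k = j := by
  obtain ⟨c, hcj, hcv⟩ := not_disjoint_iff.1 h
  obtain ⟨i, hi, hic⟩ := exists_entryAt_eq (hcol v) hcv
  obtain ⟨k, hk, hkj⟩ := exists_entryAt_eq (hrow c) (mem_varsOf.2 (mem_checksOf.1 hcj))
  exact ⟨i, hi, k, hk, by rw [checkAt_val, hic, varAt_val, hkj]⟩

/-- The array `f` contains the number `B` and the length `n` of the blocks, the number `L` of
decoding rounds, the parities of the numbers up to `Δ + 1`, the checks of all variables, and the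
variables of these checks. These data are interleaved modulo `4`. The variable `B`, which does not
exist, has a row too, so that the entries of the table can be used as indices of the table. -/
structure IsTable (H : Matrix (Fin m) (Fin B) (ZMod 2)) (D Δ n L : ℕ) (f : ℕ → ℕ) : Prop where
  blocks : f 0 = B
  length : f 4 = n
  rounds : f 8 = L
  parity : ∀ x ≤ Δ + 1, f (4 * x + 1) = x % 2
  check : ∀ v ≤ B, ∀ i < D, f (4 * (v * D + i) + 2) = checkAt H v i
  var : ∀ v ≤ B, ∀ i < D, ∀ k < Δ, f (4 * ((v * D + i) * Δ + k) + 3) = varAt H (checkAt H v i) k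

/-- The entries of the table. -/
noncomputable def tableFun (H : Matrix (Fin m) (Fin B) (ZMod 2)) (D Δ n L x : ℕ) : ℕ :=
  if x % 4 = 0 then if x = 0 then B else if x = 4 then n else if x = 8 then L else 0
  else if x % 4 = 1 then x / 4 % 2
  else if x % 4 = 2 then checkAt H (x / 4 / D) (x / 4 % D)
  else varAt H (checkAt H (x / 4 / Δ / D) (x / 4 / Δ % D)) (x / 4 % Δ)

theorem tableFun_le (n L x : ℕ) : tableFun H D Δ n L x ≤ B + n + L + m + 1 := by
  have hcheck := checkAt_le (H := H) (x / 4 / D) (x / 4 % D)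
  have hvar := varAt_le (H := H) (checkAt H (x / 4 / Δ / D) (x / 4 / Δ % D)) (x / 4 % Δ)
  unfold tableFun
  split_ifs <;> omega

theorem tableFun_parity (n L x : ℕ) : tableFun H D Δ n L (4 * x + 1) = x % 2 := by
  rw [tableFun, if_neg (by omega), if_pos (by omega)]
  omega

theorem tableFun_check (n L v : ℕ) {i : ℕ} (hi : i < D) :
    tableFun H D Δ n L (4 * (v * D + i) + 2) = checkAt H v i := by
  have hdiv : (4 * (v * D + i) + 2) / 4 = v * D + i := by omega
  rw [tableFun, if_neg (by omega), if_neg (by omega), if_pos (by omega), hdiv,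
    (mul_add_div_mod v hi).1, (mul_add_div_mod v hi).2]

theorem tableFun_var (n L v : ℕ) {i k : ℕ} (hi : i < D) (hk : k < Δ) :
    tableFun H D Δ n L (4 * ((v * D + i) * Δ + k) + 3) = varAt H (checkAt H v i) k := by
  have hdiv : (4 * ((v * D + i) * Δ + k) + 3) / 4 = (v * D + i) * Δ + k := by omega
  rw [tableFun, if_neg (by omega), if_neg (by omega), if_neg (by omega), hdiv,
    (mul_add_div_mod _ hk).1, (mul_add_div_mod _ hk).2, (mul_add_div_mod v hi).1,
    (mul_add_div_mod v hi).2]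

/-- A number of entries that is sufficient for the table. -/
def tableLength (B D Δ : ℕ) : ℕ := 4 * ((B + 1) * D * (Δ + 1) + Δ + 3)

theorem mul_add_lt_tableLength {v i : ℕ} (hv : v ≤ B) (hi : i < D) :
    4 * (v * D + i) + 2 < tableLength B D Δ := by
  have hrows : (v + 1) * D ≤ (B + 1) * D := Nat.mul_le_mul_right D (Nat.succ_le_succ hv)
  have hcols : (B + 1) * D ≤ (B + 1) * D * (Δ + 1) := Nat.le_mul_of_pos_right _ Δ.succ_pos
  rw [add_mul, one_mul] at hrows
  unfold tableLength
  omega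

theorem mul_add_mul_add_lt_tableLength {v i k : ℕ} (hv : v ≤ B) (hi : i < D) (hk : k < Δ) :
    4 * ((v * D + i) * Δ + k) + 3 < tableLength B D Δ := by
  have hrows : (v + 1) * D ≤ (B + 1) * D := Nat.mul_le_mul_right D (Nat.succ_le_succ hv)
  rw [add_mul, one_mul] at hrows
  have hcols : (v * D + i + 1) * Δ ≤ (B + 1) * D * (Δ + 1) :=
    Nat.mul_le_mul (by omega) Δ.le_succ
  rw [add_mul, one_mul] at hcols
  unfold tableLength
  omega

theorem exists_table (H : Matrix (Fin m) (Fin B) (ZMod 2)) (D Δ n L : ℕ) :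
    ∃ table : List ℕ, table.length = tableLength B D Δ ∧ (∀ a ∈ table, a ≤ B + n + L + m + 1) ∧
      IsTable H D Δ n L fun i => table.getD i 0 := by
  have hget : ∀ i < tableLength B D Δ,
      ((List.range (tableLength B D Δ)).map (tableFun H D Δ n L)).getD i 0 =
        tableFun H D Δ n L i := by
    intro i hi
    rw [List.getD_eq_getElem _ _ (by simpa using hi), List.getElem_map, List.getElem_range]
  have hlen : 4 * (Δ + 3) ≤ tableLength B D Δ := by
    unfold tableLength
    omega
  refine ⟨(List.range (tableLength B D Δ)).map (tableFun H D Δ n L), by simp, ?_, ?_⟩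
  · intro a ha
    obtain ⟨x, -, rfl⟩ := List.mem_map.1 ha
    exact tableFun_le n L x
  · constructor
    · exact hget 0 (by omega)
    · exact hget 4 (by omega)
    · exact hget 8 (by omega)
    · exact fun x hx => (hget _ (by omega)).trans (tableFun_parity n L x)
    · exact fun v hv i hi => (hget _ (mul_add_lt_tableLength hv hi)).trans (tableFun_check n L v hi)
    · exact fun v hv i hi k hk =>
        (hget _ (mul_add_mul_add_lt_tableLength hv hi hk)).trans (tableFun_var n L v hi hk)

end Table

/-! ### Counting violated checks -/

/-- The sum of the expressions `f 0, …, f (n - 1)`. -/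
def sumExpr (f : ℕ → Expr) : ℕ → Expr
  | 0 => Expr.const 0
  | n + 1 => Expr.add (sumExpr f n) (f n)

theorem eval_sumExpr (f : ℕ → Expr) (n : ℕ) (s : Mem) (p : ℕ) :
    (sumExpr f n).eval s p = ∑ i ∈ range n, (f i).eval s p := by
  induction n with
  | zero => rfl
  | succ n ih => rw [sum_range_succ, ← ih, sumExpr, Expr.eval]

/-- Cell `i` of the part of the table with residue `a` modulo `4`. -/
def tableExpr (a : ℕ) (i : Expr) : Expr :=
  Expr.read 0 (Expr.add (Expr.mul (Expr.const 4) i) (Expr.const a))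

theorem eval_tableExpr (a : ℕ) (i : Expr) (s : Mem) (p : ℕ) :
    (tableExpr a i).eval s p = s 0 (4 * i.eval s p + a) := rfl

/-- The `i`-th check of the variable `v`. -/
def checkExpr (D : ℕ) (v : Expr) (i : ℕ) : Expr :=
  tableExpr 2 (Expr.add (Expr.mul v (Expr.const D)) (Expr.const i))

/-- The `k`-th variable of the `i`-th check of the variable `v`. -/
def varExpr (D Δ : ℕ) (v : Expr) (i k : ℕ) : Expr :=
  tableExpr 3 (Expr.add (Expr.mul (Expr.add (Expr.mul v (Expr.const D)) (Expr.const i))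
    (Expr.const Δ)) (Expr.const k))

/-- The bit of the syndrome of the remaining error at the `i`-th check of the variable `v`, for the
syndrome in array `1` and the estimated error in array `5`. -/
def residualExpr (D Δ : ℕ) (v : Expr) (i : ℕ) : Expr :=
  tableExpr 1 (Expr.add (Expr.read 1 (checkExpr D v i))
    (sumExpr (fun k => Expr.read 5 (varExpr D Δ v i k)) Δ))

/-- The number of violated checks of the variable `v`. -/
def unsatExpr (D Δ : ℕ) (v : Expr) : Expr := sumExpr (residualExpr D Δ v) D

/-- The memory `s` holds the table, the syndrome of `x`, and the estimate `est` of `x`. -/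
structure OuterState {m B : ℕ} (H : Matrix (Fin m) (Fin B) (ZMod 2)) (D Δ n L : ℕ)
    (x est : Fin B → ZMod 2) (s : Mem) : Prop where
  table : IsTable H D Δ n L (s 0)
  syndrome : s 1 = bitArray (H.mulVec x)
  estimate : s 5 = bitArray est

section Unsat

variable {m B : ℕ} {H : Matrix (Fin m) (Fin B) (ZMod 2)} {D Δ n L : ℕ} {x est : Fin B → ZMod 2}

theorem val_sum_zmod_two {ι : Type*} (S : Finset ι) (f : ι → ZMod 2) :
    (∑ i ∈ S, f i).val = (∑ i ∈ S, (f i).val) % 2 := by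
  have hcast : ∑ i ∈ S, f i = ((∑ i ∈ S, (f i).val : ℕ) : ZMod 2) := by
    rw [Nat.cast_sum]
    exact sum_congr rfl fun i _ => (ZMod.natCast_zmod_val (f i)).symm
  rw [hcast, ZMod.val_natCast]

theorem syndrome_add_sum_mod_two (hrow : ∀ c, #(varsOf H c) ≤ Δ) (x est : Fin B → ZMod 2)
    {c : ℕ} (hc : c ≤ m) :
    (bitArray (H.mulVec x) c + ∑ k ∈ range Δ, bitArray est (varAt H c k)) % 2 =
      bitArray (H.mulVec (x + est)) c := by
  obtain hc | rfl := hc.lt_or_eq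
  · lift c to Fin m using hc
    simp only [varAt_val]
    rw [sum_entryAt (hrow c) (bitArray_of_le est le_rfl), bitArray_val, bitArray_val,
      Matrix.mulVec_add, Pi.add_apply, ZMod.val_add, mulVec_eq_sum_varsOf est, val_sum_zmod_two]
    simp only [bitArray_val, Nat.add_mod_mod]
  · have hvar : ∀ k, varAt H c k = B := fun k => dif_neg c.lt_irrefl
    simp [hvar, bitArray_of_le]

theorem sum_bitArray_checkAt (hcol : ∀ j, #(checksOf H j) ≤ D) (y : Fin B → ZMod 2) (v : Fin B) :
    ∑ i ∈ range D, bitArray (H.mulVec y) (checkAt H v i) = unsatDeg H y v := by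
  simp only [checkAt_val]
  rw [sum_entryAt (hcol v) (bitArray_of_le _ le_rfl), unsatDeg, ← filter_mem_eq_inter, card_filter]
  refine sum_congr rfl fun c _ => ?_
  rw [bitArray_val]
  rcases zmod_two_cases (H.mulVec y c) with hc | hc <;> simp [hc, ZMod.val_one]

theorem sum_bitArray_checkAt_of_le (y : Fin B → ZMod 2) {v : ℕ} (hv : B ≤ v) :
    ∑ i ∈ range D, bitArray (H.mulVec y) (checkAt H v i) = 0 :=
  sum_eq_zero fun _ _ => bitArray_of_le _ (by rw [checkAt, dif_neg hv.not_gt])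

variable {s : Mem} {v : Expr} {p w i : ℕ}

theorem eval_checkExpr (hs : OuterState H D Δ n L x est s) (hv : v.eval s p = w) (hw : w ≤ B)
    (hi : i < D) : (checkExpr D v i).eval s p = checkAt H w i := by
  rw [checkExpr, eval_tableExpr, ← hs.table.check w hw i hi, ← hv]
  rfl

theorem eval_varExpr (hs : OuterState H D Δ n L x est s) (hv : v.eval s p = w) (hw : w ≤ B)
    (hi : i < D) {k : ℕ} (hk : k < Δ) :
    (varExpr D Δ v i k).eval s p = varAt H (checkAt H w i) k := by
  rw [varExpr, eval_tableExpr, ← hs.table.var w hw i hi k hk, ← hv]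
  rfl

theorem eval_residualExpr (hs : OuterState H D Δ n L x est s) (hrow : ∀ c, #(varsOf H c) ≤ Δ)
    (hv : v.eval s p = w) (hw : w ≤ B) (hi : i < D) :
    (residualExpr D Δ v i).eval s p = bitArray (H.mulVec (x + est)) (checkAt H w i) := by
  have hsum : (sumExpr (fun k => Expr.read 5 (varExpr D Δ v i k)) Δ).eval s p =
      ∑ k ∈ range Δ, bitArray est (varAt H (checkAt H w i) k) := by
    rw [eval_sumExpr]
    refine sum_congr rfl fun k hk => ?_
    rw [Expr.eval, eval_varExpr hs hv hw hi (mem_range.1 hk), hs.estimate]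
  have hsum_le : ∑ k ∈ range Δ, bitArray est (varAt H (checkAt H w i) k) ≤ Δ := by
    simpa using sum_le_card_nsmul (range Δ) _ 1 fun k _ => bitArray_le_one est _
  have hsyndrome_le := bitArray_le_one (H.mulVec x) (checkAt H w i)
  rw [residualExpr, eval_tableExpr, Expr.eval, Expr.eval, eval_checkExpr hs hv hw hi, hs.syndrome,
    hsum, hs.table.parity _ (by omega), syndrome_add_sum_mod_two hrow x est (checkAt_le w i)]

theorem eval_unsatExpr (hs : OuterState H D Δ n L x est s) (hrow : ∀ c, #(varsOf H c) ≤ Δ)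
    (hv : v.eval s p = w) (hw : w ≤ B) :
    (unsatExpr D Δ v).eval s p =
      ∑ i ∈ range D, bitArray (H.mulVec (x + est)) (checkAt H w i) := by
  rw [unsatExpr, eval_sumExpr]
  exact sum_congr rfl fun i hi => eval_residualExpr hs hrow hv hw (mem_range.1 hi)

end Unsat

/-! ### Decoding of the inner code -/

/-- The number of blocks. -/
def blocksExpr : Expr := Expr.read 0 (Expr.const 0)

/-- The length of the blocks. -/
def lengthExpr : Expr := Expr.read 0 (Expr.const 4)

/-- The syndrome bit of block `pid` whose number is the counter; it is `0` if there is none. -/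
def syndromeBitExpr : Expr :=
  Expr.mul (Expr.lt counter (Expr.sub lengthExpr (Expr.const 1)))
    (Expr.read 2 (Expr.add (Expr.mul Expr.pid (Expr.sub lengthExpr (Expr.const 1))) counter))

/-- One round of `countInner`. -/
def countInnerStep (parallel : Bool) : Cmd :=
  forAll parallel blocksExpr 6 Expr.pid (Expr.add (Expr.read 6 Expr.pid) syndromeBitExpr)

/-- Array `6` counts the nonzero syndrome bits of every block. -/
def countInner (parallel : Bool) : Cmd := forCell 8 2 lengthExpr (countInnerStep parallel)

/-- One round of `voteInner`. -/
def voteInnerStep (parallel : Bool) : Cmd :=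
  forAll parallel blocksExpr 4 (Expr.add (Expr.mul Expr.pid lengthExpr) counter)
    (Expr.add syndromeBitExpr (Expr.lt lengthExpr (Expr.mul (Expr.const 2) (Expr.read 6 Expr.pid))))

/-- The estimate of the error is written to array `4`; in every block a majority vote decides
between the two errors with the given syndrome. -/
def voteInner (parallel : Bool) : Cmd := forCell 8 2 lengthExpr (voteInnerStep parallel)

/-- Majority decoding of all blocks. -/
def decodeInner (parallel : Bool) : Cmd := Cmd.seq (countInner parallel) (voteInner parallel)

/-- Running time of `countInner` and `voteInner`. -/
def innerTime (parallel : Bool) (B n : ℕ) : ℕ := (forAllTime parallel B + 2) * n + 2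

/-- The machine, with `P` processors and words up to `W`, is large enough for `B` blocks of length
`n`. -/
structure Capacity (parallel : Bool) (W P B n : ℕ) : Prop where
  processors_pos : 1 ≤ P
  blocks_le_processors : parallel = true → B ≤ P
  blocks_pos : 1 ≤ B
  one_lt_length : 1 < n
  size_le : B * n ≤ W

namespace Capacity

variable {parallel : Bool} {W P B n : ℕ}

theorem length_le (h : Capacity parallel W P B n) : n ≤ W :=
  (Nat.le_mul_of_pos_left n h.blocks_pos).trans h.size_le

theorem two_le (h : Capacity parallel W P B n) : 2 ≤ W :=
  Nat.le_trans h.one_lt_length h.length_le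

theorem blocks_le (h : Capacity parallel W P B n) : B ≤ W :=
  (Nat.le_mul_of_pos_right B (Nat.zero_lt_of_lt h.one_lt_length)).trans h.size_le

theorem mul_add_le (h : Capacity parallel W P B n) {b j : ℕ} (hb : b < B) (hj : j < n) :
    b * n + j ≤ W := by
  have hsucc : (b + 1) * n ≤ B * n := Nat.mul_le_mul_right n hb
  rw [add_mul, one_mul] at hsucc
  have hsize := h.size_le
  omega

end Capacity

/-- The memory `s` holds the dimensions of the inner code and the syndrome `σ`. -/
structure InnerState {B n : ℕ} (σ : Fin B × Fin (n - 1) → ZMod 2) (s : Mem) : Prop where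
  blocks : s 0 0 = B
  length : s 0 4 = n
  syndrome : s 2 = bitArray₂ σ

theorem InnerState.of_eqOff {B n : ℕ} {σ : Fin B × Fin (n - 1) → ZMod 2} {F : Finset ℕ}
    {s s' : Mem} (h : InnerState σ s) (hs' : EqOff F s s') (h0 : 0 ∉ F := by decide)
    (h2 : 2 ∉ F := by decide) : InnerState σ s' :=
  ⟨by rw [hs' 0 h0, h.blocks], by rw [hs' 0 h0, h.length], by rw [hs' 2 h2, h.syndrome]⟩

section Inner

variable {B n : ℕ}

/-- The syndrome bit number `j` of block `b`, and `0` for `j = n - 1`. -/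
def syndromeBit (σ : Fin B × Fin (n - 1) → ZMod 2) (b j : ℕ) : ℕ :=
  (if j < n - 1 then 1 else 0) * bitArray₂ σ (b * (n - 1) + j)

/-- The estimated error at position `j` of block `b`, up to even numbers. -/
def innerEstimate (σ : Fin B × Fin (n - 1) → ZMod 2) (b j : ℕ) : ℕ :=
  syndromeBit σ b j + if n < 2 * ∑ i ∈ range n, syndromeBit σ b i then 1 else 0

variable {σ : Fin B × Fin (n - 1) → ZMod 2} {s : Mem} {b i j : ℕ}

theorem syndromeBit_le_one : syndromeBit σ b j ≤ 1 := by
  have hbit : bitArray₂ σ (b * (n - 1) + j) ≤ 1 := bitArray_le_one _ _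
  unfold syndromeBit
  split_ifs <;> omega

theorem sum_syndromeBit_le : ∑ j ∈ range i, syndromeBit σ b j ≤ i := by
  simpa using sum_le_card_nsmul (range i) _ 1 fun j _ => syndromeBit_le_one (σ := σ) (b := b)

theorem innerEstimate_le_two : innerEstimate σ b j ≤ 2 := by
  have hbit := syndromeBit_le_one (σ := σ) (b := b) (j := j)
  unfold innerEstimate
  split_ifs <;> omega

theorem eval_syndromeBitExpr (hs : InnerState σ s) (hcounter : s 8 2 = j) (p : ℕ) :
    syndromeBitExpr.eval s p = syndromeBit σ p j := by
  simp only [syndromeBitExpr, lengthExpr, counter, Expr.eval, hs.length, hs.syndrome, hcounter,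
    syndromeBit]

variable {parallel : Bool} {W P : ℕ}

theorem Run.countInnerStep (hcap : Capacity parallel W P B n) (hs : InnerState σ s)
    (hcounter : s 8 2 = j) (hj : j < n)
    (hcount : ∀ b < B, s 6 b = ∑ i ∈ range j, syndromeBit σ b i) :
    Run W P (PCCSS.countInnerStep parallel) s (forAllTime parallel B)
      (Written 6 B id (fun b => ∑ i ∈ range (j + 1), syndromeBit σ b i) s) := by
  refine Run.forAll parallel hcap.processors_pos hcap.blocks_le_processors hcap.blocks_le
    (by decide) (fun s' hs' => (hs.of_eqOff hs').blocks) (fun b hb s' hs' hcell => ⟨rfl, ?_⟩)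
    (fun b hb => hb.le.trans hcap.blocks_le)
    (fun b _ => sum_syndromeBit_le.trans (hj.trans_le hcap.length_le))
    Function.injective_id.injOn
  rw [Expr.eval, eval_syndromeBitExpr (hs.of_eqOff hs') ((congrFun (hs' 8 (by decide)) 2).trans
    hcounter), sum_range_succ, ← hcount b hb]
  exact congrArg (· + _) (hcell b fun q _ hq => hq.symm)

theorem Run.countInner (hcap : Capacity parallel W P B n) (hs : InnerState σ s)
    (hzero : s 6 = fun _ => 0) :
    Run W P (PCCSS.countInner parallel) s (innerTime parallel B n) fun s' =>
      EqOff {6, 8, 9} s s' ∧ ∀ b < B, s' 6 b = ∑ i ∈ range n, syndromeBit σ b i := by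
  refine Run.forCell (bound := lengthExpr) hcap.processors_pos hcap.two_le hcap.length_le
    (fun j s' => EqOff {6, 8, 9} s s' ∧ ∀ b < B, s' 6 b = ∑ i ∈ range j, syndromeBit σ b i)
    (fun j s' h => (hs.of_eqOff h.1).length) ?_ ?_ ⟨EqOff.refl _ s, fun b _ => by simp [hzero]⟩
  · rintro j s' v ⟨hframe, hcount⟩
    exact ⟨hframe.set (by decide) _ _, by rwa [Mem.set_of_ne (by decide)]⟩
  · rintro j hj s' ⟨hframe, hcount⟩ hcounter
    refine (Run.countInnerStep hcap (hs.of_eqOff hframe) hcounter hj hcount).mono le_rfl ?_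
    exact fun s'' hs'' => ⟨⟨hframe.trans (hs''.frame.mono (by decide)), hs''.written⟩,
      (congrFun (hs''.frame 8 (by decide)) 2).trans hcounter⟩

theorem Run.voteInnerStep (hcap : Capacity parallel W P B n) (hs : InnerState σ s)
    (hcounter : s 8 2 = j) (hj : j < n)
    (hcount : ∀ b < B, s 6 b = ∑ i ∈ range n, syndromeBit σ b i) :
    Run W P (PCCSS.voteInnerStep parallel) s (forAllTime parallel B)
      (Written 4 B (fun b => b * n + j) (fun b => innerEstimate σ b j) s) := by
  refine Run.forAll parallel hcap.processors_pos hcap.blocks_le_processors hcap.blocks_le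
    (by decide) (fun s' hs' => (hs.of_eqOff hs').blocks) (fun b hb s' hs' _ => ?_)
    (fun b hb => hcap.mul_add_le hb hj) (fun b _ => innerEstimate_le_two.trans hcap.two_le)
    fun b _ b' _ hbb' => ?_
  · have hcounter' : s' 8 2 = j := (congrFun (hs' 8 (by decide)) 2).trans hcounter
    have hcount' : s' 6 b = _ := (congrFun (hs' 6 (by decide)) b).trans (hcount b hb)
    have hlength := (hs.of_eqOff hs').length
    constructor
    · simp only [Expr.eval, lengthExpr, counter, hlength, hcounter']
    · rw [Expr.eval, eval_syndromeBitExpr (hs.of_eqOff hs') hcounter']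
      simp only [Expr.eval, lengthExpr, hlength, hcount', innerEstimate]
  · rw [← (mul_add_div_mod b hj).1, ← (mul_add_div_mod b' hj).1]
    exact congrArg (· / n) hbb'

theorem Run.voteInner (hcap : Capacity parallel W P B n) (hs : InnerState σ s)
    (hcount : ∀ b < B, s 6 b = ∑ i ∈ range n, syndromeBit σ b i) :
    Run W P (PCCSS.voteInner parallel) s (innerTime parallel B n) fun s' =>
      EqOff {4, 8, 9} s s' ∧ ∀ b < B, ∀ i < n, s' 4 (b * n + i) = innerEstimate σ b i := by
  refine Run.forCell (bound := lengthExpr) hcap.processors_pos hcap.two_le hcap.length_le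
    (fun j s' => EqOff {4, 8, 9} s s' ∧ ∀ b < B, ∀ i < j, s' 4 (b * n + i) = innerEstimate σ b i)
    (fun j s' h => (hs.of_eqOff h.1).length) ?_ ?_
    ⟨EqOff.refl _ s, fun _ _ i hi => absurd hi i.not_lt_zero⟩
  · rintro j s' v ⟨hframe, hest⟩
    exact ⟨hframe.set (by decide) _ _, by rwa [Mem.set_of_ne (by decide)]⟩
  · rintro j hj s' ⟨hframe, hest⟩ hcounter
    refine (Run.voteInnerStep hcap (hs.of_eqOff hframe) hcounter hj
      (by rwa [hframe 6 (by decide)])).mono le_rfl fun s'' hs'' => ⟨⟨?_, fun b hb i hi => ?_⟩, ?_⟩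
    · exact hframe.trans (hs''.frame.mono (by decide))
    · obtain hi | rfl := Nat.lt_succ_iff_lt_or_eq.1 hi
      · rw [hs''.unchanged _ fun b' _ hbb' => hi.ne ?_, hest b hb i hi]
        rw [← (mul_add_div_mod b (hi.trans hj)).2, ← (mul_add_div_mod b' hj).2, hbb']
      · exact hs''.written b hb
    · exact (congrFun (hs''.frame 8 (by decide)) 2).trans hcounter

theorem Run.decodeInner (hcap : Capacity parallel W P B n) (hs : InnerState σ s)
    (hzero : s 6 = fun _ => 0) :
    Run W P (PCCSS.decodeInner parallel) s (innerTime parallel B n + innerTime parallel B n)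
      fun s' => EqOff {4, 6, 8, 9} s s' ∧
        ∀ b < B, ∀ j < n, s' 4 (b * n + j) = innerEstimate σ b j := by
  refine Run.seq (Run.countInner hcap hs hzero) ?_
  rintro s' ⟨hframe, hcount⟩
  refine (Run.voteInner hcap (hs.of_eqOff hframe) hcount).mono le_rfl ?_
  exact fun s'' ⟨hframe', hest⟩ =>
    ⟨(hframe.mono (by decide)).trans (hframe'.mono (by decide)), hest⟩

end Inner

section Majority

variable {B n : ℕ}

theorem bitArray₂_apply (f : Fin B × Fin n → ZMod 2) (b : Fin B) (j : Fin n) :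
    bitArray₂ f (b * n + j) = (f (b, j)).val := by
  have hindex : b.val * n + j.val = (finProdFinEquiv (b, j)).val := by
    rw [finProdFinEquiv_apply_val]
    ring
  rw [bitArray₂, hindex, bitArray_val, Equiv.symm_apply_apply]

theorem syndromeBit_innerCheck (hn : 0 < n) (e : Fin B × Fin n → ZMod 2) (b : Fin B) (j : Fin n) :
    syndromeBit ((innerCheck B n).mulVec e) b j =
      (e (b, j) + e (b, ⟨n - 1, Nat.sub_lt hn one_pos⟩)).val := by
  unfold syndromeBit
  split_ifs with hj
  · have hbit := bitArray₂_apply ((innerCheck B n).mulVec e) b ⟨j, hj⟩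
    rw [one_mul, hbit, innerCheck_mulVec hn]
    rfl
  · obtain rfl : j = ⟨n - 1, Nat.sub_lt hn one_pos⟩ := Fin.ext (by simp only; omega)
    rw [zero_mul, CharTwo.add_self_eq_zero, ZMod.val_zero]

theorem majority_val_add {w : Fin n → ZMod 2} (hw : 2 * hammingNorm w < n) (a : ZMod 2) :
    (if n < 2 * ∑ i, (w i + a).val then 1 else 0) = a.val := by
  rcases zmod_two_cases a with rfl | rfl
  · have hsum : ∑ i, (w i + 0).val = hammingNorm w := by
      rw [hammingNorm, card_filter]
      refine sum_congr rfl fun i _ => ?_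
      rcases zmod_two_cases (w i) with hi | hi <;> rw [hi] <;> decide
    rw [hsum, if_neg hw.not_gt, ZMod.val_zero]
  · have hsum : ∑ i, (w i + 1).val + hammingNorm w = n := by
      have hone : ∀ i, (w i + 1).val + (if w i ≠ 0 then 1 else 0) = 1 := fun i => by
        rcases zmod_two_cases (w i) with hi | hi <;> rw [hi] <;> decide
      rw [hammingNorm, card_filter, ← sum_add_distrib, sum_congr rfl fun i _ => hone i]
      simp
    rw [if_pos (by omega), ZMod.val_one]

theorem innerEstimate_correct (hn : 0 < n) {e : Fin B × Fin n → ZMod 2}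
    (he : 2 * hammingNorm e < n) (b : Fin B) (j : Fin n) :
    (innerEstimate ((innerCheck B n).mulVec e) b j : ZMod 2) = e (b, j) := by
  have hblock : hammingNorm (fun i => e (b, i)) ≤ hammingNorm e :=
    card_le_card_of_injOn (fun i => (b, i)) (fun i hi => by simpa using hi)
      fun i _ i' _ h => congrArg Prod.snd h
  have hsum : ∑ i ∈ range n, syndromeBit ((innerCheck B n).mulVec e) b i =
      ∑ i, (e (b, i) + e (b, ⟨n - 1, Nat.sub_lt hn one_pos⟩)).val := by
    rw [← Fin.sum_univ_eq_sum_range]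
    exact sum_congr rfl fun i _ => syndromeBit_innerCheck hn e b i
  rw [innerEstimate, hsum, majority_val_add (w := fun i => e (b, i)) (by omega),
    syndromeBit_innerCheck hn, Nat.cast_add, ZMod.natCast_zmod_val, ZMod.natCast_zmod_val,
    add_assoc, CharTwo.add_self_eq_zero, add_zero]

end Majority

/-! ### Decoding of the outer code -/

/-- The number of rounds of parallel bit flipping. -/
def roundsExpr : Expr := Expr.read 0 (Expr.const 8)

/-- `1` if more than half of the `D` checks of the variable `v` are violated, otherwise `0`. -/
def flipExpr (D Δ : ℕ) (v : Expr) : Expr :=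
  Expr.lt (Expr.const D) (Expr.mul (Expr.const 2) (unsatExpr D Δ v))

/-- All variables with many violated checks are flipped simultaneously; the bit `a + f - 2 a f` is
the sum of the bits `a` and `f` modulo `2`. -/
def flipRound (D Δ : ℕ) : Cmd :=
  Cmd.par blocksExpr (Expr.const 1) 5 Expr.pid
    (Expr.sub (Expr.add (Expr.read 5 Expr.pid) (flipExpr D Δ Expr.pid))
      (Expr.mul (Expr.const 2) (Expr.mul (Expr.read 5 Expr.pid) (flipExpr D Δ Expr.pid))))

/-- Parallel bit flipping. -/
def decodeOuterParallel (D Δ : ℕ) : Cmd := forCell 8 2 roundsExpr (flipRound D Δ)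

/-- The height of the stack in array `7`. -/
def heightExpr : Expr := Expr.read 8 (Expr.const 0)

/-- The variable taken from the stack. -/
def topExpr : Expr := Expr.read 8 (Expr.const 1)

/-- Take a variable from the stack. -/
def popStack : Cmd :=
  Cmd.seq (assign 8 (Expr.const 0) (Expr.sub heightExpr (Expr.const 1)))
    (assign 8 (Expr.const 1) (Expr.read 7 heightExpr))

/-- Flip the variable taken from the stack. -/
def flipTop : Cmd := assign 5 topExpr (Expr.sub (Expr.const 1) (Expr.read 5 topExpr))

/-- Put the variables of all checks of the variable taken from the stack on the stack. -/
def pushNeighbours (D Δ : ℕ) : Cmd :=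
  Cmd.seq (forAll false (Expr.const (D * Δ)) 7 (Expr.add heightExpr Expr.pid)
      (tableExpr 3 (Expr.add (Expr.mul topExpr (Expr.const (D * Δ))) Expr.pid)))
    (assign 8 (Expr.const 0) (Expr.add heightExpr (Expr.const (D * Δ))))

/-- One step of sequential bit flipping. -/
def flipStep (D Δ : ℕ) : Cmd :=
  Cmd.seq popStack
    (Cmd.ite (flipExpr D Δ topExpr) (Cmd.seq flipTop (pushNeighbours D Δ)) Cmd.skip)

/-- Put all variables on the stack. -/
def initStack : Cmd :=
  Cmd.seq (forAll false blocksExpr 7 Expr.pid Expr.pid) (assign 8 (Expr.const 0) blocksExpr)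

/-- Sequential bit flipping; the stack always contains all variables that have to be flipped. -/
def decodeOuterSequential (D Δ : ℕ) : Cmd :=
  Cmd.seq initStack (Cmd.loop (Expr.lt (Expr.const 0) heightExpr) (flipStep D Δ))

/-- Write the estimated error of the outer code to the first positions of the blocks. -/
def writeOuter (parallel : Bool) : Cmd :=
  forAll parallel blocksExpr 3 (Expr.mul Expr.pid lengthExpr) (Expr.read 5 Expr.pid)

/-- The memory `s'` arises from `s` by a run of an outer decoder that leaves its estimate of the
error `x` in array `5`; the estimate is correct if `x` has weight at most `t`. -/
def CorrectsOuter {B : ℕ} (x : Fin B → ZMod 2) (t : ℕ) (s s' : Mem) : Prop :=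
  EqOff {5, 7, 8, 9} s s' ∧ ∃ est, s' 5 = bitArray est ∧ (hammingNorm x ≤ t → x + est = 0)

section Outer

variable {m B : ℕ} {H : Matrix (Fin m) (Fin B) (ZMod 2)} {D Δ n L : ℕ} {x y est : Fin B → ZMod 2}
  {s : Mem}

theorem forall_lt_mul_of_forall_mul_add {p : ℕ → Prop} (h : ∀ i < D, ∀ k < Δ, p (i * Δ + k))
    {r : ℕ} (hr : r < D * Δ) : p r := by
  rw [← Nat.div_add_mod' r Δ]
  exact h _ (Nat.div_lt_of_lt_mul (by rwa [mul_comm])) _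
    (Nat.mod_lt r (Nat.pos_of_mul_pos_left (Nat.zero_lt_of_lt hr)))

theorem OuterState.of_eqOff {F : Finset ℕ} {s' : Mem} {est' : Fin B → ZMod 2}
    (hs : OuterState H D Δ n L x est s) (hs' : EqOff F s s') (hest' : s' 5 = bitArray est')
    (h0 : 0 ∉ F := by decide) (h1 : 1 ∉ F := by decide) : OuterState H D Δ n L x est' s' :=
  ⟨by rw [hs' 0 h0]; exact hs.table, by rw [hs' 1 h1, hs.syndrome], hest'⟩

theorem eval_flipExpr (hcol : ∀ j, #(checksOf H j) ≤ D) (hrow : ∀ c, #(varsOf H c) ≤ Δ)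
    (hs : OuterState H D Δ n L x est s) {v : Expr} {p : ℕ} {j : Fin B} (hv : v.eval s p = j) :
    (flipExpr D Δ v).eval s p = if D < 2 * unsatDeg H (x + est) j then 1 else 0 := by
  rw [← sum_bitArray_checkAt hcol, ← eval_unsatExpr hs hrow hv j.isLt.le]
  rfl

theorem eval_flipExpr_ne_zero (hcol : ∀ j, #(checksOf H j) ≤ D) (hrow : ∀ c, #(varsOf H c) ≤ Δ)
    (hs : OuterState H D Δ n L x est s) {v : Expr} {p w : ℕ} (hv : v.eval s p = w) (hw : w ≤ B) :
    (flipExpr D Δ v).eval s p ≠ 0 ↔ ∃ j : Fin B, w = j ∧ D < 2 * unsatDeg H (x + est) j := by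
  obtain hw | rfl := hw.lt_or_eq
  · lift w to Fin B using hw
    simp [eval_flipExpr hcol hrow hs hv, ← Fin.ext_iff]
  · rw [flipExpr, eval_lt_ne_zero, Expr.eval, Expr.eval, eval_unsatExpr hs hrow hv le_rfl,
      sum_bitArray_checkAt_of_le _ le_rfl]
    exact ⟨fun h => absurd h (Nat.not_lt_zero _), fun ⟨j, hj, _⟩ => absurd hj j.isLt.ne'⟩

section Parallel

variable {W P : ℕ}

theorem Run.flipRound (hcol : ∀ j, #(checksOf H j) ≤ D) (hrow : ∀ c, #(varsOf H c) ≤ Δ)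
    (hBP : B ≤ P) (hW : 1 ≤ W) (hBW : B ≤ W) (hs : OuterState H D Δ n L x est s) :
    Run W P (PCCSS.flipRound D Δ) s 1 fun s' =>
      EqOff {5, 9} s s' ∧ ∃ est', s' 5 = bitArray est' ∧ x + est' = flipAll H D (x + est) := by
  let est' : Fin B → ZMod 2 := fun j => est j + if D < 2 * unsatDeg H (x + est) j then 1 else 0
  have hxor : ∀ (a : ZMod 2) (q : Prop) [Decidable q],
      a.val + (if q then 1 else 0) - 2 * (a.val * if q then 1 else 0) =
        (a + if q then 1 else 0).val := fun a q _ => by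
    rcases zmod_two_cases a with rfl | rfl <;> split_ifs <;> decide
  refine (Run.parAll (count := blocksExpr) (A := id) (V := bitArray est') hs.table.blocks hBP
    (fun _ _ => rfl) (fun p hp => ?_) (fun p hp => hp.le.trans hBW)
    (fun p _ => (bitArray_le_one _ _).trans hW) Function.injective_id.injOn).mono le_rfl
    fun s' hs' => ⟨hs'.frame, est', ?_, ?_⟩
  · lift p to Fin B using hp
    simp only [Expr.eval, eval_flipExpr hcol hrow hs (v := Expr.pid) (p := p) rfl, hs.estimate,
      bitArray_val, est', hxor]
  · funext i
    rw [hs'.eq_ite, hs.estimate]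
    split_ifs with hi
    · rfl
    · rw [bitArray_of_le _ (not_lt.1 hi), bitArray_of_le _ (not_lt.1 hi)]
  · exact funext fun j => (add_assoc _ _ _).symm

theorem Run.decodeOuterParallel_iterate (hcol : ∀ j, #(checksOf H j) ≤ D)
    (hrow : ∀ c, #(varsOf H c) ≤ Δ) (hP : 1 ≤ P) (hBP : B ≤ P) (hW : 2 ≤ W) (hBW : B ≤ W)
    (hLW : L ≤ W) (hs : OuterState H D Δ n L x 0 s) :
    Run W P (decodeOuterParallel D Δ) s ((1 + 2) * L + 2) fun s' =>
      EqOff {5, 8, 9} s s' ∧ ∃ est, s' 5 = bitArray est ∧ x + est = (flipAll H D)^[L] x := by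
  refine Run.forCell (bound := roundsExpr) hP hW hLW (fun i s' =>
    EqOff {5, 8, 9} s s' ∧ ∃ est, s' 5 = bitArray est ∧ x + est = (flipAll H D)^[i] x) ?_ ?_ ?_
    ⟨EqOff.refl _ s, 0, hs.estimate, add_zero x⟩
  · rintro i s' ⟨hframe, est, hest, -⟩
    exact (hs.of_eqOff hframe hest).table.rounds
  · rintro i s' v ⟨hframe, hest⟩
    exact ⟨hframe.set (by decide) _ _, by rwa [Mem.set_of_ne (by decide)]⟩
  · rintro i - s' ⟨hframe, est, hest, hiter⟩ hcounter
    refine (Run.flipRound hcol hrow hBP (Nat.one_le_of_lt hW) hBW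
      (hs.of_eqOff hframe hest)).mono le_rfl ?_
    rintro s'' ⟨hframe', est', hest', hflip⟩
    refine ⟨⟨hframe.trans (hframe'.mono (by decide)), est', hest', ?_⟩,
      (congrFun (hframe' 8 (by decide)) 2).trans hcounter⟩
    rw [hflip, hiter, Function.iterate_succ_apply']

theorem Run.decodeOuterParallel {β : ℝ} {e t : ℕ} (hH : Expands H D β e) (hD : 0 < D)
    (hβ : 15 / 16 ≤ β) (ht : 2 * t ≤ e) (hrow : ∀ c, #(varsOf H c) ≤ Δ) (hP : 1 ≤ P)
    (hBP : B ≤ P) (hW : 2 ≤ W) (hBW : B ≤ W) (hLW : L ≤ W) (hBL : B < 2 ^ L)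
    (hs : OuterState H D Δ n L x 0 s) :
    Run W P (PCCSS.decodeOuterParallel D Δ) s ((1 + 2) * L + 2) (CorrectsOuter x t s) := by
  refine (Run.decodeOuterParallel_iterate hH.card_checksOf_le hrow hP hBP hW hBW hLW hs).mono
    le_rfl fun s' ⟨hframe, est, hest, hiter⟩ => ⟨hframe.mono (by decide), est, hest, fun hx => ?_⟩
  rw [hiter, hH.iterate_flipAll_eq_zero hD hβ (by omega) (by simpa using hBL)]

end Parallel

/-- The invariant of sequential bit flipping. The error `x` has been reduced to `y`, the stack
consists of the first `h` cells of `stack`, and at most `k` further steps are necessary, since a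
flip decreases the number of violated checks and adds `D * Δ` cells to the stack. -/
structure FlipInvariant (H : Matrix (Fin m) (Fin B) (ZMod 2)) (D Δ t : ℕ) (x y : Fin B → ZMod 2)
    (k : ℕ) (stack : ℕ → ℕ) (h : ℕ) : Prop where
  le : ∀ i < h, stack i ≤ B
  complete : ∀ j : Fin B, D < 2 * unsatDeg H y j → ∃ i < h, stack i = j
  potential : h + (D * Δ + 1) * #(unsat H y) ≤ k
  weight : hammingNorm x ≤ t → hammingNorm y ≤ 2 * t ∧ #(unsat H y) ≤ D * t

namespace FlipInvariant

variable {β : ℝ} {e t k h : ℕ} {stack stack' : ℕ → ℕ}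

theorem init (hH : Expands H D β e) (hstack : ∀ i < B, stack i = i) :
    FlipInvariant H D Δ t x x (B + (D * Δ + 1) * m) stack B where
  le i hi := (hstack i hi).trans_le hi.le
  complete j _ := ⟨j, j.isLt, hstack j j.isLt⟩
  potential := by
    have hunsat : #(unsat H x) ≤ m := by simpa using card_le_univ (unsat H x)
    gcongr
  weight hx := ⟨by omega, (hH.card_unsat_le x).trans (Nat.mul_le_mul_left D hx)⟩

theorem skip (hinv : FlipInvariant H D Δ t x y (k + 1) stack (h + 1))
    (htop : ¬ ∃ j : Fin B, stack h = j ∧ D < 2 * unsatDeg H y j) :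
    FlipInvariant H D Δ t x y k stack h where
  le i hi := hinv.le i (hi.trans h.lt_succ_self)
  complete j hj := by
    obtain ⟨i, hi, hij⟩ := hinv.complete j hj
    obtain hi | rfl := Nat.lt_succ_iff_lt_or_eq.1 hi
    · exact ⟨i, hi, hij⟩
    · exact absurd ⟨j, hij, hj⟩ htop
  potential := by
    have hpotential := hinv.potential
    omega
  weight := hinv.weight

theorem complete_flip (hinv : FlipInvariant H D Δ t x y k stack (h + 1))
    (hcol : ∀ j, #(checksOf H j) ≤ D) (hrow : ∀ c, #(varsOf H c) ≤ Δ) {j : Fin B}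
    (hj : stack h = j) (hflip : D < 2 * unsatDeg H y j) (hold : ∀ i < h, stack' i = stack i)
    (hnew : ∀ i < D, ∀ l < Δ, stack' (h + (i * Δ + l)) = varAt H (checkAt H j i) l)
    {v : Fin B} (hv : D < 2 * unsatDeg H (y + Pi.single j 1) v) :
    ∃ i < h + D * Δ, stack' i = v := by
  by_cases hdisj : Disjoint (checksOf H v) (checksOf H j)
  · rw [unsatDeg_flip_of_disjoint hdisj] at hv
    obtain ⟨i, hi, hiv⟩ := hinv.complete v hv
    obtain hi | rfl := Nat.lt_succ_iff_lt_or_eq.1 hi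
    · exact ⟨i, by omega, by rw [hold i hi, hiv]⟩
    · obtain rfl : v = j := Fin.ext (hiv.symm.trans hj)
      rw [unsatDeg, disjoint_self_iff_empty _ |>.1 hdisj, empty_inter, card_empty] at hflip
      omega
  · obtain ⟨i, hi, l, hl, hil⟩ := exists_varAt_checkAt_eq hcol hrow hdisj
    have hrows : (i + 1) * Δ ≤ D * Δ := Nat.mul_le_mul_right Δ hi
    rw [add_mul, one_mul] at hrows
    exact ⟨h + (i * Δ + l), by omega, by rw [hnew i hi l hl, hil]⟩

theorem le_flip (hinv : FlipInvariant H D Δ t x y k stack (h + 1)) {j : ℕ}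
    (hold : ∀ i < h, stack' i = stack i)
    (hnew : ∀ i < D, ∀ l < Δ, stack' (h + (i * Δ + l)) = varAt H (checkAt H j i) l) :
    ∀ i < h + D * Δ, stack' i ≤ B := by
  intro i hi
  by_cases hih : i < h
  · rw [hold i hih]
    exact hinv.le i (hih.trans h.lt_succ_self)
  · obtain ⟨r, rfl⟩ := Nat.exists_eq_add_of_le (not_lt.1 hih)
    exact forall_lt_mul_of_forall_mul_add (p := fun r => stack' (h + r) ≤ B)
      (fun i hi l hl => (hnew i hi l hl).trans_le (varAt_le _ _)) (by omega)

theorem flip (hH : Expands H D β e) (hβ : 3 / 4 < β) (ht : 2 * t ≤ e)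
    (hrow : ∀ c, #(varsOf H c) ≤ Δ) (hinv : FlipInvariant H D Δ t x y (k + 1) stack (h + 1))
    {j : Fin B} (hj : stack h = j) (hflip : D < 2 * unsatDeg H y j)
    (hold : ∀ i < h, stack' i = stack i)
    (hnew : ∀ i < D, ∀ l < Δ, stack' (h + (i * Δ + l)) = varAt H (checkAt H j i) l) :
    FlipInvariant H D Δ t x (y + Pi.single j 1) k stack' (h + D * Δ) where
  le := hinv.le_flip hold hnew
  complete _ := hinv.complete_flip hH.card_checksOf_le hrow hj hflip hold hnew
  potential := by
    have hunsat := Nat.mul_le_mul_left (D * Δ + 1)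
      (Nat.succ_le_of_lt (card_unsat_flip_lt (hH.card_checksOf_le j) hflip))
    have hpotential := hinv.potential
    rw [Nat.succ_eq_add_one, mul_add, mul_one] at hunsat
    omega
  weight hx := hH.flip_invariant hβ ht (hinv.weight hx).1 (hinv.weight hx).2 hflip

theorem height_add_le (hinv : FlipInvariant H D Δ t x y (k + 1) stack (h + 1)) {j : Fin B}
    (hflip : D < 2 * unsatDeg H y j) : h + D * Δ ≤ k := by
  have hunsat : 0 < #(unsat H y) := (by omega : 0 < unsatDeg H y j).trans_le
    (unsatDeg_le_card_unsat y j)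
  have hpush := Nat.le_mul_of_pos_right (D * Δ + 1) hunsat
  have hpotential := hinv.potential
  omega

theorem eq_zero (hH : Expands H D β e) (hD : 0 < D) (hβ : 3 / 4 < β) (ht : 2 * t ≤ e)
    (hinv : FlipInvariant H D Δ t x y k stack 0) (hx : hammingNorm x ≤ t) : y = 0 := by
  by_contra hy
  obtain ⟨j, hj⟩ := hH.exists_flippable hD hβ ((hinv.weight hx).1.trans ht) hy
  obtain ⟨i, hi, -⟩ := hinv.complete j hj
  exact i.not_lt_zero hi

end FlipInvariant

section Sequential

variable {W P h : ℕ}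

theorem Run.popStack (hP : 1 ≤ P) (hheight : s 8 0 = h + 1) (hhW : h + 1 ≤ W) (htop : s 7 h ≤ W) :
    Run W P PCCSS.popStack s (1 + 1) fun s' =>
      EqOff {8} s s' ∧ s' 8 0 = h ∧ s' 8 1 = s 7 h := by
  refine Run.seq (Q := fun s' => s' = s.set 8 0 h) ?_ ?_
  · have hval : (Expr.sub heightExpr (Expr.const 1)).eval s 0 = h := by
      simp only [heightExpr, Expr.eval, hheight, Nat.add_sub_cancel]
    exact Run.assign hP (Nat.zero_le W) (by omega) (by rw [hval]; rfl)
  rintro _ rfl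
  have hval : (Expr.read 7 heightExpr).eval (s.set 8 0 h) 0 = s 7 h := by
    simp only [heightExpr, Expr.eval, Mem.set_same]
    rw [Mem.set_of_ne (by decide)]
  refine Run.assign hP (Nat.le_of_add_left_le hhW) (hval.trans_le htop) ⟨?_, ?_, ?_⟩
  · exact ((EqOff.refl _ s).set (by decide) _ _).set (by decide) _ _
  · exact (Mem.set_of_ne_idx Nat.zero_ne_one).trans Mem.set_same
  · rw [← hval]
    exact Mem.set_same

theorem Run.flipTop (hP : 1 ≤ P) (hW : 1 ≤ W) (hBW : B ≤ W) {j : Fin B} (htop : s 8 1 = j)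
    (hest : s 5 = bitArray est) :
    Run W P PCCSS.flipTop s 1 fun s' =>
      EqOff {5} s s' ∧ s' 5 = bitArray (est + Pi.single j 1) := by
  have haddr : topExpr.eval s 0 = j := htop
  have hval : (Expr.sub (Expr.const 1) (Expr.read 5 topExpr)).eval s 0 =
      ((est + Pi.single j 1 : Fin B → ZMod 2) j).val := by
    simp only [Expr.eval, haddr, hest, bitArray_val, Pi.add_apply, Pi.single_eq_same]
    rcases zmod_two_cases (est j) with hj | hj <;> rw [hj] <;> decide
  refine Run.assign hP (haddr.trans_le (j.isLt.le.trans hBW)) ?_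
    ⟨(EqOff.refl _ s).set (by decide) _ _, funext fun i => ?_⟩
  · rw [hval, ← bitArray_val]
    exact (bitArray_le_one _ _).trans hW
  · rw [hval, haddr]
    by_cases hij : i = j
    · rw [hij, Mem.set_same, bitArray_val]
    · rw [Mem.set_of_ne_idx hij, hest]
      by_cases hi : i < B
      · lift i to Fin B using hi
        rw [bitArray_val, bitArray_val, Pi.add_apply, Pi.single_eq_of_ne (Fin.val_ne_iff.1 hij),
          add_zero]
      · rw [bitArray_of_le _ (not_lt.1 hi), bitArray_of_le _ (not_lt.1 hi)]

theorem Run.pushNeighbours (hP : 1 ≤ P) (hBW : B ≤ W) (hhW : h + D * Δ ≤ W)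
    (htable : IsTable H D Δ n L (s 0)) (hheight : s 8 0 = h) {v : ℕ} (htop : s 8 1 = v)
    (hv : v ≤ B) :
    Run W P (PCCSS.pushNeighbours D Δ) s (3 * (D * Δ) + 2 + 1) fun s' =>
      EqOff {7, 8, 9} s s' ∧ s' 8 0 = h + D * Δ ∧ (∀ i < h, s' 7 i = s 7 i) ∧
        ∀ i < D, ∀ k < Δ, s' 7 (h + (i * Δ + k)) = varAt H (checkAt H v i) k := by
  have hentry : ∀ i < D, ∀ k < Δ,
      s 0 (4 * (v * (D * Δ) + (i * Δ + k)) + 3) = varAt H (checkAt H v i) k := by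
    intro i hi k hk
    rw [← htable.var v hv i hi k hk]
    ring_nf
  have hentry_le : ∀ r < D * Δ, s 0 (4 * (v * (D * Δ) + r) + 3) ≤ W := fun r =>
    forall_lt_mul_of_forall_mul_add (p := fun r => s 0 (4 * (v * (D * Δ) + r) + 3) ≤ W)
      fun i hi k hk => (hentry i hi k hk).trans_le ((varAt_le _ _).trans hBW)
  refine Run.seq (Run.forAll false (n := D * Δ) (A := fun r => h + r)
    (V := fun r => s 0 (4 * (v * (D * Δ) + r) + 3)) hP (by simp) (by omega) (by decide)
    (fun _ _ => rfl) (fun r _ s' hs' _ => ?_) (fun r hr => by omega) hentry_le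
    (add_right_injective h).injOn) fun s' hs' => ?_
  · simp only [eval_tableExpr, heightExpr, topExpr, Expr.eval, hs' 8 (by decide),
      hs' 0 (by decide), hheight, htop, and_self]
  · have hval : (Expr.add heightExpr (Expr.const (D * Δ))).eval s' 0 = h + D * Δ := by
      simp only [heightExpr, Expr.eval, hs'.frame 8 (by decide), hheight]
    refine Run.assign hP (Nat.zero_le W) (hval.trans_le hhW)
      ⟨(hs'.frame.mono (by decide)).set (by decide) _ _, hval ▸ Mem.set_same, ?_⟩
    rw [Mem.set_of_ne (by decide)]
    refine ⟨fun i hi => hs'.unchanged i fun r _ => by omega, fun i hi k hk => ?_⟩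
    rw [hs'.written _ ?_, hentry i hi k hk]
    have hrows : (i + 1) * Δ ≤ D * Δ := Nat.mul_le_mul_right Δ hi
    rw [add_mul, one_mul] at hrows
    omega

section Expands

variable {β : ℝ} {e t k : ℕ}

theorem Run.flipTop_pushNeighbours (hH : Expands H D β e) (hβ : 3 / 4 < β) (ht : 2 * t ≤ e)
    (hrow : ∀ c, #(varsOf H c) ≤ Δ) (hP : 1 ≤ P) (hBW : B ≤ W) (hkW : k + 1 ≤ W)
    (hs : OuterState H D Δ n L x est s) (hheight : s 8 0 = h) {j : Fin B} (htop : s 8 1 = j)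
    (hj : s 7 h = j) (hinv : FlipInvariant H D Δ t x (x + est) (k + 1) (s 7) (h + 1))
    (hflip : D < 2 * unsatDeg H (x + est) j) :
    Run W P (Cmd.seq PCCSS.flipTop (PCCSS.pushNeighbours D Δ)) s (1 + (3 * (D * Δ) + 2 + 1))
      fun s' => EqOff {5, 7, 8, 9} s s' ∧ ∃ est', OuterState H D Δ n L x est' s' ∧
        FlipInvariant H D Δ t x (x + est') k (s' 7) (s' 8 0) := by
  refine Run.seq (Run.flipTop hP (Nat.le_of_add_left_le hkW) hBW htop hs.estimate) ?_
  rintro s₁ ⟨hframe₁, hest₁⟩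
  have hs₁ := hs.of_eqOff hframe₁ hest₁
  have h8 : s₁ 8 = s 8 := hframe₁ 8 (by decide)
  have hheight_le := hinv.height_add_le hflip
  refine (Run.pushNeighbours (h := h) hP hBW (by omega) hs₁.table (by rw [h8, hheight])
    (by rw [h8, htop]) j.isLt.le).mono le_rfl ?_
  rintro s₂ ⟨hframe₂, hheight₂, hold, hnew⟩
  rw [hframe₁ 7 (by decide)] at hold
  refine ⟨(hframe₁.mono (by decide)).trans (hframe₂.mono (by decide)), est + Pi.single j 1,
    hs₁.of_eqOff hframe₂ ((hframe₂ 5 (by decide)).trans hest₁), ?_⟩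
  rw [hheight₂, ← add_assoc]
  exact hinv.flip hH hβ ht hrow hj hflip hold hnew

theorem Run.flipStep (hH : Expands H D β e) (hβ : 3 / 4 < β) (ht : 2 * t ≤ e)
    (hrow : ∀ c, #(varsOf H c) ≤ Δ) (hP : 1 ≤ P) (hBW : B ≤ W) (hkW : k + 1 ≤ W)
    (hs : OuterState H D Δ n L x est s) (hheight : s 8 0 = h + 1)
    (hinv : FlipInvariant H D Δ t x (x + est) (k + 1) (s 7) (h + 1)) :
    Run W P (PCCSS.flipStep D Δ) s (3 * (D * Δ) + 7) fun s' => EqOff {5, 7, 8, 9} s s' ∧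
      ∃ est', OuterState H D Δ n L x est' s' ∧
        FlipInvariant H D Δ t x (x + est') k (s' 7) (s' 8 0) := by
  have htime : 3 * (D * Δ) + 7 = 1 + 1 + (1 + (3 * (D * Δ) + 2 + 1) + 1) := by ring
  have hpotential := hinv.potential
  have htop_le : s 7 h ≤ B := hinv.le h h.lt_succ_self
  rw [htime]
  refine Run.seq (Run.popStack hP hheight (by omega) (htop_le.trans hBW)) ?_
  rintro s₁ ⟨hframe₁, hheight₁, htop₁⟩
  have hs₁ := hs.of_eqOff hframe₁ ((hframe₁ 5 (by decide)).trans hs.estimate)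
  have h7 : s₁ 7 = s 7 := hframe₁ 7 (by decide)
  have hflip_iff := eval_flipExpr_ne_zero hH.card_checksOf_le hrow hs₁ (v := topExpr) (p := 0)
    htop₁ htop_le
  refine Run.ite (fun hne => ?_) fun heq => ?_
  · obtain ⟨j, hj, hflip⟩ := hflip_iff.1 hne
    exact (Run.flipTop_pushNeighbours hH hβ ht hrow hP hBW hkW hs₁ hheight₁ (htop₁.trans hj)
      (by rw [h7, hj]) (by rwa [h7]) hflip).mono le_rfl fun s₂ ⟨hframe₂, hs₂⟩ =>
        ⟨(hframe₁.mono (by decide)).trans hframe₂, hs₂⟩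
  · refine (Run.skip ⟨hframe₁.mono (by decide), est, hs₁, ?_⟩).mono (by omega) fun _ hQ => hQ
    rw [hheight₁, h7]
    exact hinv.skip (mt hflip_iff.2 (not_not.2 heq))

theorem Run.initStack (hP : 1 ≤ P) (hBW : B ≤ W) (hs : OuterState H D Δ n L x est s) :
    Run W P PCCSS.initStack s (3 * B + 2 + 1) fun s' =>
      EqOff {7, 8, 9} s s' ∧ s' 8 0 = B ∧ ∀ i < B, s' 7 i = i := by
  have hblocks : ∀ s', EqOff {7, 9} s s' → blocksExpr.eval s' 0 = B := fun s' hs' =>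
    (hs.of_eqOff hs' ((hs' 5 (by decide)).trans hs.estimate)).table.blocks
  refine Run.seq (Run.forAll false (n := B) (A := id) (V := id) hP (by simp) hBW (by decide)
    hblocks (fun p _ s' _ _ => ⟨rfl, rfl⟩) (fun p hp => hp.le.trans hBW)
    (fun p hp => hp.le.trans hBW) Function.injective_id.injOn) fun s' hs' => ?_
  have hval := hblocks s' hs'.frame
  refine Run.assign hP (Nat.zero_le W) (hval.trans_le hBW)
    ⟨(hs'.frame.mono (by decide)).set (by decide) _ _, hval ▸ Mem.set_same, ?_⟩
  rw [Mem.set_of_ne (by decide)]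
  exact hs'.written

theorem Run.decodeOuterSequential (hH : Expands H D β e) (hD : 0 < D) (hβ : 3 / 4 < β)
    (ht : 2 * t ≤ e) (hrow : ∀ c, #(varsOf H c) ≤ Δ) (hP : 1 ≤ P)
    (hW : B + (D * Δ + 1) * m ≤ W) (hs : OuterState H D Δ n L x 0 s) :
    Run W P (PCCSS.decodeOuterSequential D Δ) s
      (3 * B + 2 + 1 + ((3 * (D * Δ) + 7 + 1) * (B + (D * Δ + 1) * m) + 1))
      (CorrectsOuter x t s) := by
  have hBW : B ≤ W := Nat.le_of_add_right_le hW
  refine Run.seq (Run.initStack hP hBW hs) ?_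
  rintro s₁ ⟨hframe₁, hheight₁, hstack₁⟩
  refine (Run.loop (τ := 3 * (D * Δ) + 7) (fun k s' => k ≤ W ∧ EqOff {5, 7, 8, 9} s s' ∧
    ∃ est, OuterState H D Δ n L x est s' ∧
      FlipInvariant H D Δ t x (x + est) k (s' 7) (s' 8 0)) ?_ ⟨hW, hframe₁.mono (by decide), 0,
        hs.of_eqOff hframe₁ ((hframe₁ 5 (by decide)).trans hs.estimate), ?_⟩).mono le_rfl ?_
  · rintro k s' ⟨hkW, hframe, est, hs', hinv⟩ hne
    have hpos : 0 < s' 8 0 := eval_lt_ne_zero.1 hne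
    obtain ⟨h, hheight⟩ := Nat.exists_eq_add_one.2 hpos
    rw [hheight] at hinv
    have hpotential := hinv.potential
    obtain ⟨k, rfl⟩ : ∃ k', k = k' + 1 := Nat.exists_eq_add_one.2 (by omega)
    refine (Run.flipStep hH hβ ht hrow hP hBW hkW hs' hheight hinv).mono le_rfl ?_
    exact fun s'' ⟨hframe', hs''⟩ =>
      ⟨k, k.lt_succ_self, Nat.le_of_succ_le hkW, hframe.trans hframe', hs''⟩
  · rw [add_zero, hheight₁]
    exact FlipInvariant.init hH hstack₁
  · rintro s' ⟨⟨k, -, hframe, est, hs', hinv⟩, hend⟩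
    have hheight : s' 8 0 = 0 := by
      by_contra hne
      have hpos : (Expr.const 0).eval s' 0 < heightExpr.eval s' 0 := Nat.pos_of_ne_zero hne
      exact eval_lt_ne_zero.2 hpos hend
    rw [hheight] at hinv
    exact ⟨hframe, est, hs'.estimate, hinv.eq_zero hH hD hβ ht⟩

end Expands

end Sequential

theorem Run.writeOuter {parallel : Bool} {W P : ℕ} (hcap : Capacity parallel W P B n) (hn : 0 < n)
    (hblocks : s 0 0 = B) (hlength : s 0 4 = n) (hzero : s 3 = fun _ => 0)
    (hest : s 5 = bitArray est) :
    Run W P (PCCSS.writeOuter parallel) s (forAllTime parallel B) fun s' =>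
      EqOff {3, 9} s s' ∧ output s' 3 = firstInBlock hn est := by
  refine (Run.forAll parallel (count := blocksExpr) (A := fun b => b * n) (V := bitArray est)
    hcap.processors_pos hcap.blocks_le_processors hcap.blocks_le (by decide)
    (fun s' hs' => (congrFun (hs' 0 (by decide)) 0).trans hblocks) (fun b _ s' hs' _ => ?_)
    (fun b hb => hcap.mul_add_le hb hn)
    (fun b _ => (bitArray_le_one _ _).trans (Nat.one_le_of_lt hcap.two_le))
    (fun _ _ _ _ => Nat.eq_of_mul_eq_mul_right hn)).mono le_rfl fun s' hs' => ⟨hs'.frame, ?_⟩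
  · simp only [Expr.eval, lengthExpr, hs' 0 (by decide), hs' 5 (by decide), hlength, hest, and_self]
  · funext ⟨b, j⟩
    rw [output, firstInBlock]
    split_ifs with hj
    · rw [hj, add_zero, hs'.written b b.isLt, bitArray_val, ZMod.natCast_zmod_val]
    · rw [hs'.unchanged _ fun b' _ hbb' => hj (Fin.ext ?_), hzero, Nat.cast_zero]
      rw [← (mul_add_div_mod b j.isLt).2, hbb', Nat.mul_mod_left]

end Outer

/-! ### The decoders -/

/-- The decoder of the partially concatenated code that uses the program `outer` for the outer
code. -/
def decoder (parallel : Bool) (outer : Cmd) : Cmd :=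
  Cmd.seq (decodeInner parallel) (Cmd.seq outer (writeOuter parallel))

/-- Running time of a decoder whose outer decoder takes time `T`. -/
def decoderTime (parallel : Bool) (B n T : ℕ) : ℕ :=
  innerTime parallel B n + innerTime parallel B n + (T + forAllTime parallel B)

/-- Up to stabilizers, the arrays `3` and `4` contain the `Z`-error `eZ` if it has weight at most
`tZ` and the `X`-error `eX` if it has weight at most `tX`. -/
def Corrects {m B n : ℕ} (H : Matrix (Fin m) (Fin B) (ZMod 2)) (tZ tX : ℕ)
    (eZ eX : Fin B × Fin n → ZMod 2) (s : Mem) : Prop :=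
  (hammingNorm eZ ≤ tZ → eZ + output s 3 ∈ dualCode (codeOf (innerCheck B n))) ∧
    (hammingNorm eX ≤ tX → eX + output s 4 ∈ dualCode (codeOf (pcX n H)))

section Decoders

variable {m B n : ℕ} {H : Matrix (Fin m) (Fin B) (ZMod 2)}

theorem add_firstInBlock_mem_dualCode (hn : 0 < n) {eZ : Fin B × Fin n → ZMod 2}
    {est : Fin B → ZMod 2} (hest : blockParity eZ + est = 0) :
    eZ + firstInBlock hn est ∈ dualCode (codeOf (innerCheck B n)) := by
  rw [mem_dualCode_innerCheck hn, blockParity_add, blockParity_firstInBlock, hest]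

theorem add_output_eq_zero (hn : 0 < n) {eX : Fin B × Fin n → ZMod 2} {s : Mem}
    (hs : ∀ b < B, ∀ j < n, s 4 (b * n + j) = innerEstimate ((innerCheck B n).mulVec eX) b j)
    (heX : hammingNorm eX ≤ (n - 1) / 2) : eX + output s 4 = 0 := by
  ext ⟨b, j⟩
  rw [Pi.add_apply, output, hs b b.isLt j j.isLt, innerEstimate_correct hn (by omega),
    CharTwo.add_self_eq_zero, Pi.zero_apply]

section Outer

variable {parallel : Bool} {W P D Δ L t T : ℕ} {outer : Cmd}

theorem Run.decoder (hcap : Capacity parallel W P B n)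
    (houter : ∀ x s, OuterState H D Δ n L x 0 s → Run W P outer s T (CorrectsOuter x t s))
    {table : List ℕ} (htable : IsTable H D Δ n L fun i => table.getD i 0)
    (eZ eX : Fin B × Fin n → ZMod 2) :
    Run W P (PCCSS.decoder parallel outer)
      (initMem table (bitArray ((pcX n H).mulVec eZ)) (bitArray₂ ((innerCheck B n).mulVec eX)))
      (decoderTime parallel B n T) (Corrects H t ((n - 1) / 2) eZ eX) := by
  have hn : 0 < n := Nat.zero_lt_of_lt hcap.one_lt_length
  refine Run.seq (Run.decodeInner (σ := (innerCheck B n).mulVec eX) hcap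
    ⟨htable.blocks, htable.length, rfl⟩ rfl) ?_
  rintro s₁ ⟨hframe₁, hinner⟩
  have hs₁ : OuterState H D Δ n L (blockParity eZ) 0 s₁ :=
    { table := by rwa [hframe₁ 0 (by decide)]
      syndrome := by rw [hframe₁ 1 (by decide), ← pcX_mulVec]; rfl
      estimate := by
        rw [hframe₁ 5 (by decide)]
        funext i
        simp [initMem, bitArray] }
  refine Run.seq (houter _ _ hs₁) ?_
  rintro s₂ ⟨hframe₂, est, hest, hcorrect⟩
  have hs₂ := hs₁.of_eqOff hframe₂ hest
  refine (Run.writeOuter hcap hn hs₂.table.blocks hs₂.table.length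
    ((hframe₂ 3 (by decide)).trans (hframe₁ 3 (by decide))) hest).mono le_rfl ?_
  rintro s₃ ⟨hframe₃, hout⟩
  refine ⟨fun heZ => ?_, fun heX => ?_⟩
  · rw [hout]
    exact add_firstInBlock_mem_dualCode hn (hcorrect ((hammingNorm_blockParity_le eZ).trans heZ))
  · rw [add_output_eq_zero hn ?_ heX]
    · exact Submodule.zero_mem _
    · rwa [hframe₃ 4 (by decide), hframe₂ 4 (by decide)]

theorem decodesWithin_decoder (hcap : Capacity parallel W P B n)
    (houter : ∀ x s, OuterState H D Δ n L x 0 s → Run W P outer s T (CorrectsOuter x t s))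
    (hlength : tableLength B D Δ ≤ W) (hentries : B + n + L + m + 1 ≤ W) {T' P' : ℝ}
    (hT : decoderTime parallel B n T ≤ T') (hP : P ≤ P') :
    DecodesWithin n H (decoder parallel outer) t ((n - 1) / 2) W T' P' := by
  obtain ⟨table, hlen, hle, htable⟩ := exists_table H D Δ n L
  refine ⟨table, hlen.trans_le hlength, fun a ha => (hle a ha).trans hentries, fun eZ eX => ?_⟩
  obtain ⟨τ, s, hτ, hexec, hcorrects⟩ := Run.decoder hcap houter htable eZ eX
  exact ⟨P, τ, s, hP, (Nat.cast_le.2 hτ).trans hT, hexec, hcorrects⟩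

end Outer

theorem decodesWithin_sequential {d : ℕ} (hH : Expands H 32 (15 / 16) (d - 1))
    (hrow : ∀ c, #(varsOf H c) ≤ 128) (hm : 2 * m ≤ B) (hB : 1 ≤ B) (hn : 1 < n) :
    DecodesWithin n H (decoder false (decodeOuterSequential 32 128)) ((d - 1) / 2) ((n - 1) / 2)
      (10 ^ 8 * (B * n)) ((10 ^ 8 : ℕ) * (B * n : ℕ)) 1 := by
  have hBn : B * 2 ≤ B * n := Nat.mul_le_mul_left B hn
  have hnB : n ≤ B * n := Nat.le_mul_of_pos_left n hB
  have hcap : Capacity false (10 ^ 8 * (B * n)) 1 B n := ⟨le_rfl, by simp, hB, hn, by omega⟩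
  have houter := fun x s (hs : OuterState H 32 128 n 0 x 0 s) =>
    Run.decodeOuterSequential (t := (d - 1) / 2) (W := 10 ^ 8 * (B * n)) hH (by norm_num)
      (by norm_num) (by omega) hrow le_rfl (by omega) hs
  refine decodesWithin_decoder hcap houter (by unfold tableLength; omega) (by omega) ?_ (by simp)
  have hinner : innerTime false B n = 3 * (B * n) + 4 * n + 2 := by
    simp only [innerTime, forAllTime, Bool.false_eq_true, if_false]
    ring
  rw [← Nat.cast_mul, Nat.cast_le, decoderTime, hinner]
  simp only [forAllTime, Bool.false_eq_true, if_false]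
  omega

theorem natLog_two_le (hB : 1 ≤ B) : (Nat.log 2 B : ℝ) ≤ 2 * Real.log B := by
  have hlog : 0 ≤ Real.log B := Real.log_nonneg (by exact_mod_cast hB)
  calc (Nat.log 2 B : ℝ) ≤ Real.logb 2 B := by simpa using Real.natLog_le_logb B 2
    _ ≤ 2 * Real.log B := by
        rw [Real.logb, div_le_iff₀ (Real.log_pos one_lt_two)]
        nlinarith [Real.log_two_gt_d9]

theorem decodesWithin_parallel {d : ℕ} (hH : Expands H 32 (15 / 16) (d - 1))
    (hrow : ∀ c, #(varsOf H c) ≤ 128) (hm : 2 * m ≤ B) (hB : 1 ≤ B) (hn : 1 < n) :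
    DecodesWithin n H (decoder true (decodeOuterParallel 32 128)) ((d - 1) / 2) ((n - 1) / 2)
      (10 ^ 8 * (B * n)) ((10 ^ 8 : ℕ) * (Real.log B + n))
      ((10 ^ 8 : ℕ) * (B + B * Real.log B)) := by
  have hBn : B * 2 ≤ B * n := Nat.mul_le_mul_left B hn
  have hnB : n ≤ B * n := Nat.le_mul_of_pos_left n hB
  have hlog_le : Nat.log 2 B ≤ B := Nat.log_le_self 2 B
  have hBlog : B < 2 ^ (Nat.log 2 B + 1) := Nat.lt_pow_succ_log_self one_lt_two B
  have hcap : Capacity true (10 ^ 8 * (B * n)) B B n := ⟨hB, fun _ => le_rfl, hB, hn, by omega⟩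
  have houter := fun x s (hs : OuterState H 32 128 n (Nat.log 2 B + 1) x 0 s) =>
    Run.decodeOuterParallel (t := (d - 1) / 2) (W := 10 ^ 8 * (B * n)) hH (by norm_num) le_rfl
      (by omega) hrow hB le_rfl (by omega) (by omega) (by omega) hBlog hs
  have hlog : 0 ≤ Real.log B := Real.log_nonneg (by exact_mod_cast hB)
  refine decodesWithin_decoder hcap houter (by unfold tableLength; omega) (by omega) ?_ ?_
  · have htime : decoderTime true B n ((1 + 2) * (Nat.log 2 B + 1) + 2) =
        6 * n + 3 * Nat.log 2 B + 10 := by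
      simp only [decoderTime, innerTime, forAllTime, if_true]
      ring
    have hn' : (1 : ℝ) ≤ n := by exact_mod_cast hn.le
    rw [htime]
    push_cast
    linarith [natLog_two_le hB]
  · have hBlog' : 0 ≤ B * Real.log B := mul_nonneg (Nat.cast_nonneg B) hlog
    push_cast
    linarith [(Nat.cast_nonneg B : (0 : ℝ) ≤ B)]

end Decoders

/-! ### Outer codes of all lengths -/

theorem IsExpanderCheckMatrix.expands {m B : ℕ} {H : Matrix (Fin m) (Fin B) (ZMod 2)} {D Δ e : ℕ}
    {α β : ℝ} (hH : IsExpanderCheckMatrix H D Δ α β) (he : e ≤ α * B) : Expands H D β e where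
  card_checksOf_le j := (hH.variableDegree j).le
  le_card_biUnion S hS := hH.expansion S ((Nat.cast_le.2 hS).trans he)

theorem expansionRadius_thirty_eight_le : expansionRadius 30 8 ≤ 1 / 128 := by
  have hle := expansionRadius_mul_le_one (g := 30) (lam := 8) (by norm_num) (by norm_num)
  have hpos := expansionRadius_pos (g := 30) (lam := 8) (by norm_num) (by norm_num)
  push_cast at hle
  linarith

theorem exists_isExpanderCheckMatrix_two_mul_le {B : ℕ} (hB : 128 ≤ B) :
    ∃ (m : ℕ) (H : Matrix (Fin m) (Fin B) (ZMod 2)),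
      IsExpanderCheckMatrix H 32 128 (expansionRadius 30 8) (15 / 16) ∧ 2 * m ≤ B := by
  have hq : B ≤ 8 * (32 * (B / 128)) := by omega
  obtain ⟨m, H, hm, hH⟩ := exists_isExpanderCheckMatrix (g := 30) (B := B) (q := B / 128)
    (Δ := 128) (lam := 8) (by norm_num) (by norm_num) (by norm_num) (by omega)
    (by exact_mod_cast hq)
  norm_num at hH
  exact ⟨m, H, hH, by omega⟩

-- Below length 128 the whole space, with distance 1, serves as the outer code.
theorem exists_outer_code (B : ℕ) :
    ∃ (m d : ℕ) (H : Matrix (Fin m) (Fin B) (ZMod 2)),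
      (128 ≤ B → IsExpanderCheckMatrix H 32 128 (expansionRadius 30 8) (15 / 16)) ∧
        Expands H 32 (15 / 16) (d - 1) ∧ (∀ c, #(varsOf H c) ≤ 128) ∧ 2 * m ≤ B ∧
          expansionRadius 30 8 * B ≤ d := by
  have hα : 0 < expansionRadius 30 8 := expansionRadius_pos (by norm_num) (by norm_num)
  by_cases hB : 128 ≤ B
  · obtain ⟨m, H, hH, hm⟩ := exists_isExpanderCheckMatrix_two_mul_le hB
    refine ⟨m, ⌊expansionRadius 30 8 * B⌋₊ + 1, H, fun _ => hH, ?_, hH.checkDegree, hm, ?_⟩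
    · exact hH.expands (Nat.floor_le (by positivity))
    · exact_mod_cast (Nat.lt_floor_add_one _).le
  · refine ⟨0, 1, Matrix.of fun i => i.elim0, fun h => absurd h hB, ⟨fun j => ?_, fun S hS => ?_⟩,
      fun c => c.elim0, by omega, ?_⟩
    · simp [checksOf]
    · rw [card_eq_zero.1 (Nat.le_zero.1 hS)]
      simp
    · have hB' : (B : ℝ) ≤ 128 := by exact_mod_cast (not_le.1 hB).le
      calc expansionRadius 30 8 * B ≤ 1 / 128 * 128 := by
            gcongr
            exact expansionRadius_thirty_eight_le
        _ = (1 : ℕ) := by norm_num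

section Dimension

variable {m B : ℕ} {H : Matrix (Fin m) (Fin B) (ZMod 2)}

theorem le_two_mul_finrank_codeOf (hm : 2 * m ≤ B) :
    B ≤ 2 * Module.finrank (ZMod 2) (codeOf H) := by
  have hcard := card_le_finrank_codeOf_add_card H
  rw [Fintype.card_fin, Fintype.card_fin] at hcard
  omega

theorem exists_mem_codeOf_ne_zero (hm : 2 * m ≤ B) (hB : 1 ≤ B) : ∃ x ∈ codeOf H, x ≠ 0 := by
  refine Submodule.exists_mem_ne_zero_of_ne_bot fun hbot => ?_
  have hdim := le_two_mul_finrank_codeOf (H := H) hm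
  rw [hbot, finrank_bot] at hdim
  omega

theorem expansionRadius_mul_le_finrank_codeOf (hm : 2 * m ≤ B) :
    expansionRadius 30 8 * B ≤ Module.finrank (ZMod 2) (codeOf H) := by
  have hdim : (B : ℝ) ≤ 2 * Module.finrank (ZMod 2) (codeOf H) := by
    exact_mod_cast le_two_mul_finrank_codeOf hm
  have hradius := mul_le_mul_of_nonneg_right expansionRadius_thirty_eight_le (Nat.cast_nonneg B)
  linarith

end Dimension

end PCCSS

theorem theorem2 :
    ∃ (c : ℝ) (K M D Δ : ℕ) (α β : ℝ) (seqDec parDec : PCCSS.Cmd),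
      0 < c ∧ 0 < D ∧ 0 < α ∧ 3 / 4 < β ∧
      ∀ n₀ N : ℕ, 1 < n₀ → 1 < N → n₀ ∣ N →
        ∃ (m k d : ℕ) (H₂ : Matrix (Fin m) (Fin (N / n₀)) (ZMod 2)),
          -- the outer code is an asymptotically good expander code of dimension `k`
          (M ≤ N / n₀ → PCCSS.IsExpanderCheckMatrix H₂ D Δ α β) ∧
          Module.finrank (ZMod 2) (PCCSS.codeOf H₂) = k ∧
          (∀ x ∈ PCCSS.codeOf H₂, x ≠ 0 → d ≤ hammingNorm x) ∧
          -- parameters of the quantum code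
          PCCSS.pcX n₀ H₂ * (PCCSS.innerCheck (N / n₀) n₀).transpose = 0 ∧
          Fintype.card (Fin (N / n₀) × Fin n₀) = N ∧
          Module.finrank ℂ
            (PCCSS.cssSpace (PCCSS.pcX n₀ H₂) (PCCSS.innerCheck (N / n₀) n₀)) = 2 ^ k ∧
          c * (N / n₀ : ℕ) ≤ k ∧
          c * (N / n₀ : ℕ) ≤ d ∧
          d ≤ PCCSS.minWeightOutside (PCCSS.codeOf (PCCSS.pcX n₀ H₂))
            (PCCSS.dualCode (PCCSS.codeOf (PCCSS.innerCheck (N / n₀) n₀))) ∧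
          n₀ ≤ PCCSS.minWeightOutside (PCCSS.codeOf (PCCSS.innerCheck (N / n₀) n₀))
            (PCCSS.dualCode (PCCSS.codeOf (PCCSS.pcX n₀ H₂))) ∧
          -- sequential syndrome decoding
          PCCSS.DecodesWithin n₀ H₂ seqDec ((d - 1) / 2) ((n₀ - 1) / 2) (K * N) (K * N) 1 ∧
          -- parallel syndrome decoding
          PCCSS.DecodesWithin n₀ H₂ parDec ((d - 1) / 2) ((n₀ - 1) / 2) (K * N)
            (K * (Real.log (N / n₀ : ℕ) + n₀))
            (K * ((N / n₀ : ℕ) + (N / n₀ : ℕ) * Real.log (N / n₀ : ℕ))) ∧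
          -- encoding
          ∃ C : PCCSS.Circuit (Fin (N / n₀) × Fin n₀),
            C.Encodes k
              (PCCSS.cssSpace (PCCSS.pcX n₀ H₂) (PCCSS.innerCheck (N / n₀) n₀)) ∧
            C.size ≤ K * ((N / n₀) ^ 2 + N) ∧
            C.depth ≤ K * (N / n₀ + n₀) := by
  have hα : 0 < PCCSS.expansionRadius 30 8 := PCCSS.expansionRadius_pos (by norm_num) (by norm_num)
  refine ⟨PCCSS.expansionRadius 30 8, 10 ^ 8, 128, 32, 128, PCCSS.expansionRadius 30 8, 15 / 16,
    PCCSS.decoder false (PCCSS.decodeOuterSequential 32 128),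
    PCCSS.decoder true (PCCSS.decodeOuterParallel 32 128), hα, by norm_num, hα, by norm_num, ?_⟩
  intro n₀ N hn₀ hN hdvd
  have hn₀' : 0 < n₀ := Nat.zero_lt_of_lt hn₀
  have hBn : N / n₀ * n₀ = N := Nat.div_mul_cancel hdvd
  have hB : 1 ≤ N / n₀ := Nat.div_pos (Nat.le_of_dvd (Nat.zero_lt_of_lt hN) hdvd) hn₀'
  generalize N / n₀ = B at *
  subst hBn
  obtain ⟨m, d, H, hexpander, hH, hrow, hm, hd⟩ := PCCSS.exists_outer_code B
  have hdist : ∀ x ∈ PCCSS.codeOf H, x ≠ 0 → d ≤ hammingNorm x := fun x hx hx0 =>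
    Nat.le_of_pred_lt (hH.lt_hammingNorm (by norm_num) (by norm_num) hx hx0)
  have hne := PCCSS.exists_mem_codeOf_ne_zero (H := H) hm hB
  obtain ⟨C, hC, hsize, hdepth⟩ := PCCSS.exists_encoder hB hn₀' H
  have hsize_le : B ≤ B * n₀ := Nat.le_mul_of_pos_right B hn₀'
  exact ⟨m, Module.finrank (ZMod 2) (PCCSS.codeOf H), d, H, hexpander, rfl, hdist,
    PCCSS.pcX_mul_transpose_innerCheck H, by simp, hC.finrank_eq,
    PCCSS.expansionRadius_mul_le_finrank_codeOf hm, hd, PCCSS.le_minWeightOutside_X hn₀' hdist hne,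
    PCCSS.le_minWeightOutside_Z hn₀' hne, PCCSS.decodesWithin_sequential hH hrow hm hB hn₀,
    PCCSS.decodesWithin_parallel hH hrow hm hB hn₀, C, hC, by omega, by omega⟩
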